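/- For a compact semisimple Lie group $G$ (connected, as usual), the Witten zeta-function of $G$ is the Dirichlet series $$\zeta_G(s)=\sum_{V}(\dim V)^{-s},$$ where $V$ runs over the isomorphism classes of finite-dimensional continuous irreducible complex representations of $G$. **Theorem 5.2.** There exist non-isomorphic compact semisimple Lie groups with the same Witten zeta-function. More precisely, there exist an integer $n\ge 0$ and two subgroups $Z_1,Z_2$ of the center of $SU(2)^n$ such that: 1. there is a bijection $e\colon Z_1\to Z_2$ such that for every $z\in Z_1$ the elements $z$ and $e(z)$ differ by a permutation of the $n$ coordinates (depending on $z$), so that they lie in one orbit of $\mathrm{Aut}(SU(2)^n)$; 2. no (continuous) automorphism of $SU(2)^n$ carries $Z_1$ onto $Z_2$; 3. $G^1=SU(2)^n/Z_1$ and $G^2=SU(2)^n/Z_2$ are compact semisimple Lie groups, and they are not isomorphic, even as topological groups; 4. for every $d$, the groups $G^1$ and $G^2$ have the same finite number of isomorphism classes of irreducible representations of degree $d$; both series $\zeta_{G^1}(s)$ and $\zeta_{G^2}(s)$ converge absolutely in some common half-plane $\mathrm{Re}\,s>c$, and $\zeta_{G^1}(s)=\zeta_{G^2}(s)$ there. 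-/

import Mathlib

open scoped Manifold ContDiff

/-- A compact semisimple Lie group: a compact connected Hausdorff topological group which is
a (finite-dimensional, real, smooth) Lie group and whose Lie algebra is semisimple, i.e. has no
nonzero solvable ideal. A topological group carries at most one smooth Lie group structure, so
this is a property of the topological group. -/
structure IsCompactSemisimpleLieGroup (G : Type*) [Group G] [TopologicalSpace G] : Prop where
  compactSpace : CompactSpace G
  connectedSpace : ConnectedSpace G
  t2Space : T2Space G
  exists_lieGroup : ∃ (d : ℕ) (_ : ChartedSpace (EuclideanSpace ℝ (Fin d)) G)
    (_ : LieGroup (𝓡 d) (minSmoothness ℝ 3) G),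
    LieGroup (𝓡 d) ∞ G ∧ LieAlgebra.HasTrivialRadical ℝ (GroupLieAlgebra (𝓡 d) G)

/-- The continuous irreducible complex representations of `G` on `ℂ ^ d`. Irreducible
representations are nonzero, so there are none for `d = 0`. -/
def ContIrrep (G : Type*) [Group G] [TopologicalSpace G] (d : ℕ) : Type _ :=
  {ρ : Representation ℂ G (Fin d → ℂ) // (∀ v, Continuous fun g => ρ g v) ∧ ρ.IsIrreducible}

/-- Isomorphism of representations. -/
instance ContIrrep.setoid (G : Type*) [Group G] [TopologicalSpace G] (d : ℕ) :
    Setoid (ContIrrep G d) where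
  r ρ σ := Nonempty (Representation.Equiv ρ.1 σ.1)
  iseqv :=
    ⟨fun ρ => ⟨Representation.Equiv.refl ρ.1⟩, fun ⟨f⟩ => ⟨f.symm⟩, fun ⟨f⟩ ⟨g⟩ => ⟨f.trans g⟩⟩

/-- The isomorphism classes of continuous irreducible complex representations of `G` of
degree `d`. Every `d`-dimensional complex vector space is isomorphic to `ℂ ^ d`. -/
def IrrepClass (G : Type*) [Group G] [TopologicalSpace G] (d : ℕ) : Type _ :=
  Quotient (ContIrrep.setoid G d)

/-- The isomorphism classes `V` of all finite-dimensional continuous irreducible complex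
representations of `G`; the first component of `V` is `dim V`. -/
abbrev Irreps (G : Type*) [Group G] [TopologicalSpace G] : Type _ :=
  Σ d : ℕ, IrrepClass G d

/-- The summand `(dim V) ^ (-s)` of the Witten zeta-function. -/
noncomputable def wittenTerm (G : Type*) [Group G] [TopologicalSpace G] (s : ℂ)
    (V : Irreps G) : ℂ :=
  (V.1 : ℂ) ^ (-s)

/-- The Witten zeta-function `ζ_G(s) = ∑_V (dim V) ^ (-s)`, the sum being over the isomorphism
classes of irreducible representations of `G`. -/
noncomputable def wittenZeta (G : Type*) [Group G] [TopologicalSpace G] (s : ℂ) : ℂ :=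
  ∑' V : Irreps G, wittenTerm G s V

/-- The group `SU(2) ^ n`. -/
abbrev SU2Pow (n : ℕ) : Type := Fin n → Matrix.specialUnitaryGroup (Fin 2) ℂ

/-! The vectors of signs are central in `SU(2) ^ n`, so a binary linear code `C` of length `n`
defines a central subgroup and a quotient of `SU(2) ^ n`. By irreducibility every central sign acts
on an irreducible representation as `1` or `-1`. This attaches to the representation a sign vector
`χ`, and the representation factors through the quotient exactly when `χ` lies in the dual code of
`C`. Permuting the factors shows that the number of irreducible representations of degree `d` with
sign vector `χ` depends only on the weight of `χ` (`IrrepClass.card_sign_comp`). Hence codes whose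
duals have the same weight distribution give equal Witten zeta-functions
(`IrrepClass.card_quotient_congr`).

The codes `pairCode` and `evenCode` of length 6 both have 1, 3, 3, 1 words of weight 0, 2, 4, 6, and
each agrees with its own dual up to a permutation of the coordinates. One weight-preserving
bijection therefore handles both the codes and their duals. The codes are inequivalent: the supports
of the three words of weight 2 are disjoint in `pairCode` and overlap in `evenCode`.

Inequivalent codes give quotients that are not isomorphic even as abstract groups. By
`exists_perm_of_mulEquiv` an isomorphism permutes the classes of the elements with a single
coordinate `-1`: such an element is a commutator inside one factor, and lifts of the images of
different factors have disjoint noncentral supports. An automorphism carrying one subgroup onto the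
other would induce such an isomorphism.

Convergence needs only a polynomial bound on the number of representations. Differentiation along
one-parameter subgroups turns a representation into commuting `sl₂`-triples. An irreducible one is
determined by its highest weight, whose entries are natural numbers less than the degree `d`, so
there are at most `d ^ n`; it does not matter which weights occur. The Lie structure comes from
gnomonic coordinates, which do not see signs and so serve all the quotients at once; the bracket
computed in them is the commutator of imaginary quaternions. -/

open scoped Quaternion Topology

/-! ### SU(2) as the group of unit quaternions -/

/-- The group `SU(2)`. -/
abbrev SU2 : Type := Matrix.specialUnitaryGroup (Fin 2) ℂ

namespace SU2

/-- Unitarity makes one side the inverse of `g`, determinant one the other. In consequence the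
second row is determined by the first, which is all that `toQ` reads. -/
theorem star_eq_adjugate (g : SU2) : star g.1 = g.1.adjugate := by
  obtain ⟨A, hA⟩ := g
  rw [Matrix.mem_specialUnitaryGroup_iff, Matrix.mem_unitaryGroup_iff'] at hA
  have h' : A * A.adjugate = 1 := by rw [Matrix.mul_adjugate, hA.2, one_smul]
  calc star A = star A * (A * A.adjugate) := by rw [h', mul_one]
    _ = A.adjugate := by rw [← mul_assoc, hA.1, one_mul]

theorem apply_one_one (g : SU2) : g.1 1 1 = star (g.1 0 0) := by
  have := congrFun (congrFun (star_eq_adjugate g) 0) 0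
  simpa [Matrix.adjugate_fin_two, Matrix.star_apply] using this.symm

theorem apply_one_zero (g : SU2) : g.1 1 0 = -star (g.1 0 1) := by
  have := congrFun (congrFun (star_eq_adjugate g) 1) 0
  have h2 : star (g.1 0 1) = -g.1 1 0 := by
    simpa [Matrix.adjugate_fin_two, Matrix.star_apply] using this
  rw [h2, neg_neg]

/-- The quaternion with given components. -/
def quat (a b c d : ℝ) : ℍ[ℝ] := ⟨a, b, c, d⟩

@[simp] theorem quat_re (a b c d : ℝ) : (quat a b c d).re = a := rfl
@[simp] theorem quat_imI (a b c d : ℝ) : (quat a b c d).imI = b := rfl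
@[simp] theorem quat_imJ (a b c d : ℝ) : (quat a b c d).imJ = c := rfl
@[simp] theorem quat_imK (a b c d : ℝ) : (quat a b c d).imK = d := rfl

/-- The quaternion corresponding to an element of `SU(2)`. -/
noncomputable def toQ : SU2 →* ℍ[ℝ] where
  toFun g := quat (g.1 0 0).re (g.1 0 0).im (g.1 0 1).re (g.1 0 1).im
  map_one' := by ext <;> simp
  map_mul' g h := by
    ext <;> simp [Matrix.mul_apply, Fin.sum_univ_two, apply_one_one, apply_one_zero] <;> ring

theorem toQ_apply (g : SU2) :
    toQ g = quat (g.1 0 0).re (g.1 0 0).im (g.1 0 1).re (g.1 0 1).im := rfl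

theorem normSq_toQ (g : SU2) : Quaternion.normSq (toQ g) = 1 := by
  have h := g.2
  rw [Matrix.mem_specialUnitaryGroup_iff] at h
  have h2 := h.2
  rw [Matrix.det_fin_two, apply_one_one, apply_one_zero] at h2
  have := congrArg Complex.re h2
  simp at this
  rw [Quaternion.normSq_def']
  simp [toQ_apply]
  nlinarith

theorem norm_toQ (g : SU2) : ‖toQ g‖ = 1 := by
  have := normSq_toQ g
  rw [Quaternion.normSq_eq_norm_mul_self] at this
  nlinarith [norm_nonneg (toQ g)]

/-- The element of `SU(2)` corresponding to a unit quaternion. -/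
noncomputable def ofQ (q : Metric.sphere (0 : ℍ[ℝ]) 1) : SU2 :=
  ⟨!![⟨q.1.re, q.1.imI⟩, ⟨q.1.imJ, q.1.imK⟩; ⟨-q.1.imJ, q.1.imK⟩, ⟨q.1.re, -q.1.imI⟩], by
    have h : q.1.re ^ 2 + q.1.imI ^ 2 + q.1.imJ ^ 2 + q.1.imK ^ 2 = 1 := by
      rw [← Quaternion.normSq_def', Quaternion.normSq_eq_norm_mul_self]
      simp [mem_sphere_zero_iff_norm.1 q.2]
    rw [Matrix.mem_specialUnitaryGroup_iff, Matrix.mem_unitaryGroup_iff]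
    constructor
    · ext i j
      fin_cases i <;> fin_cases j <;> apply Complex.ext <;>
        simp [Matrix.mul_apply, Fin.sum_univ_two, Matrix.star_apply] <;> nlinarith
    · rw [Matrix.det_fin_two]
      apply Complex.ext <;> simp <;> nlinarith⟩

theorem toQ_ofQ (q : Metric.sphere (0 : ℍ[ℝ]) 1) : toQ (ofQ q) = q := by
  ext <;> simp [toQ_apply, ofQ]

theorem toQ_injective : Function.Injective toQ := by
  intro g h hgh
  have h0 := congrArg QuaternionAlgebra.re hgh
  have h1 := congrArg QuaternionAlgebra.imI hgh
  have h2 := congrArg QuaternionAlgebra.imJ hgh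
  have h3 := congrArg QuaternionAlgebra.imK hgh
  simp only [toQ_apply, quat_re, quat_imI, quat_imJ, quat_imK] at h0 h1 h2 h3
  have e0 := Complex.ext h0 h1
  have e1 := Complex.ext h2 h3
  ext i j
  fin_cases i <;> fin_cases j
  · exact e0
  · exact e1
  · simp only [Fin.mk_one, Fin.zero_eta]; rw [apply_one_zero, apply_one_zero, e1]
  · simp only [Fin.mk_one]; rw [apply_one_one, apply_one_one, e0]

theorem ofQ_toQ (g : SU2) (h : toQ g ∈ Metric.sphere (0 : ℍ[ℝ]) 1) : ofQ ⟨toQ g, h⟩ = g :=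
  toQ_injective (toQ_ofQ _)

theorem exists_toQ_eq {q : ℍ[ℝ]} (hq : ‖q‖ = 1) : ∃ g : SU2, toQ g = q :=
  ⟨ofQ ⟨q, by simpa using hq⟩, toQ_ofQ _⟩

theorem ofQ_surjective : Function.Surjective ofQ := fun g =>
  ⟨⟨toQ g, by simpa using norm_toQ g⟩, ofQ_toQ g _⟩

theorem continuous_quat {X : Type*} [TopologicalSpace X] {a b c d : X → ℝ}
    (ha : Continuous a) (hb : Continuous b) (hc : Continuous c) (hd : Continuous d) :
    Continuous fun x => quat (a x) (b x) (c x) (d x) := by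
  have : (fun x => quat (a x) (b x) (c x) (d x)) = fun x =>
      Quaternion.linearIsometryEquivTuple.symm (!₂[a x, b x, c x, d x]) := by
    funext x
    rfl
  rw [this]
  refine Quaternion.linearIsometryEquivTuple.symm.continuous.comp ?_
  refine (PiLp.continuous_toLp 2 _).comp (continuous_pi fun i => ?_)
  fin_cases i <;> simpa

theorem continuous_toQ : Continuous toQ := by
  have h : ∀ i j, Continuous fun g : SU2 => g.1 i j := fun i j =>
    (continuous_apply_apply i j).comp continuous_subtype_val
  exact continuous_quat (Complex.continuous_re.comp (h 0 0))
    (Complex.continuous_im.comp (h 0 0)) (Complex.continuous_re.comp (h 0 1))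
    (Complex.continuous_im.comp (h 0 1))

theorem continuous_complex_mk {X : Type*} [TopologicalSpace X] {a b : X → ℝ}
    (ha : Continuous a) (hb : Continuous b) : Continuous fun x => (⟨a x, b x⟩ : ℂ) :=
  Complex.equivRealProdCLM.symm.continuous.comp (ha.prodMk hb)

theorem continuous_ofQ : Continuous ofQ := by
  refine Continuous.subtype_mk ?_ _
  have h0 := Quaternion.continuous_re.comp (continuous_subtype_val (p := (· ∈ Metric.sphere (0 : ℍ[ℝ]) 1)))
  have h1 := Quaternion.continuous_imI.comp (continuous_subtype_val (p := (· ∈ Metric.sphere (0 : ℍ[ℝ]) 1)))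
  have h2 := Quaternion.continuous_imJ.comp (continuous_subtype_val (p := (· ∈ Metric.sphere (0 : ℍ[ℝ]) 1)))
  have h3 := Quaternion.continuous_imK.comp (continuous_subtype_val (p := (· ∈ Metric.sphere (0 : ℍ[ℝ]) 1)))
  refine continuous_matrix fun i j => ?_
  fin_cases i <;> fin_cases j
  · exact continuous_complex_mk h0 h1
  · exact continuous_complex_mk h2 h3
  · exact continuous_complex_mk h2.neg h3
  · exact continuous_complex_mk h0 h1.neg

theorem toQ_mem_sphere (g : SU2) : toQ g ∈ Metric.sphere (0 : ℍ[ℝ]) 1 := by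
  simpa using norm_toQ g

/-- Continuity and convergence in `SU2` can thus be tested on quaternions. -/
theorem isInducing_toQ : Topology.IsInducing toQ :=
  Topology.IsInducing.subtypeVal.comp (Homeomorph.mk
    ⟨ofQ, fun g => ⟨toQ g, toQ_mem_sphere g⟩, fun q => Subtype.ext (toQ_ofQ q),
      fun g => ofQ_toQ g _⟩ continuous_ofQ (continuous_toQ.subtype_mk _)).symm.isInducing

instance : CompactSpace SU2 := by
  have : CompactSpace (Metric.sphere (0 : ℍ[ℝ]) 1) := isCompact_iff_compactSpace.1 (isCompact_sphere _ _)
  rw [← isCompact_univ_iff, ← ofQ_surjective.range_eq]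
  exact isCompact_range continuous_ofQ

instance : ConnectedSpace SU2 := by
  have h : 1 < Module.rank ℝ ℍ[ℝ] := by
    rw [Quaternion.rank_eq_four]; norm_num
  have : ConnectedSpace (Metric.sphere (0 : ℍ[ℝ]) 1) :=
    isConnected_iff_connectedSpace.1 (isConnected_sphere h _ zero_le_one)
  exact ofQ_surjective.connectedSpace continuous_ofQ

/-- The element `-1` of `SU(2)`. -/
instance : Neg SU2 where
  neg g := ⟨-g.1, by
    have h := g.2
    rw [Matrix.mem_specialUnitaryGroup_iff, Matrix.mem_unitaryGroup_iff] at h ⊢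
    refine ⟨by simpa using h.1, ?_⟩
    rw [Matrix.det_neg, h.2]; simp⟩

instance : HasDistribNeg SU2 where
  neg_neg g := Subtype.ext (neg_neg g.1)
  neg_mul g h := Subtype.ext (neg_mul g.1 h.1)
  mul_neg g h := Subtype.ext (mul_neg g.1 h.1)

theorem toQ_neg (g : SU2) : toQ (-g) = -toQ g := by
  have h : (-g).1 = -g.1 := rfl
  ext <;> simp [toQ_apply, h]

theorem neg_ne (g : SU2) : -g ≠ g := by
  intro h
  have h1 := congrArg toQ h
  rw [toQ_neg] at h1
  have h2 : (2 : ℝ) • toQ g = 0 := by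
    rw [two_smul]; nth_rewrite 1 [← h1]; simp
  have := norm_toQ g
  rw [(smul_eq_zero.1 h2).resolve_left two_ne_zero] at this
  simp at this

theorem toQ_inv (g : SU2) : toQ g⁻¹ = star (toQ g) := by
  have h : toQ g⁻¹ * toQ g = 1 := by rw [← map_mul, inv_mul_cancel, map_one]
  have h' : toQ g * star (toQ g) = 1 := by
    rw [Quaternion.self_mul_star, normSq_toQ]; simp
  calc toQ g⁻¹ = toQ g⁻¹ * (toQ g * star (toQ g)) := by rw [h', mul_one]
    _ = star (toQ g) := by rw [← mul_assoc, h, one_mul]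

instance : IsTopologicalGroup SU2 where
  continuous_mul := continuous_mul
  continuous_inv := by
    rw [isInducing_toQ.continuous_iff]
    have : toQ ∘ (fun g => g⁻¹) = fun g => star (toQ g) := funext toQ_inv
    rw [this]
    exact continuous_star.comp continuous_toQ

/-! ### Commuting up to sign with all conjugates -/

theorem forall_eq_zero_or_of_mul {a b c x y z : ℝ} (h11 : a * x = 0) (h12 : a * y = 0)
    (h13 : a * z = 0) (h21 : b * x = 0) (h22 : b * y = 0) (h23 : b * z = 0) (h31 : c * x = 0)
    (h32 : c * y = 0) (h33 : c * z = 0) : (a = 0 ∧ b = 0 ∧ c = 0) ∨ (x = 0 ∧ y = 0 ∧ z = 0) := by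
  by_cases hx : x = 0
  · by_cases hy : y = 0
    · by_cases hz : z = 0
      · exact Or.inr ⟨hx, hy, hz⟩
      · simp_all
    · simp_all
  · simp_all

/-- Conjugation by `g` rotates the imaginary part of `q`, and commuting with `p` means that the
cross product of the imaginary parts vanishes. A few rotations isolate all nine products of
coordinates. -/
theorem im_mul_im_eq_zero_of_commute {p q : ℍ[ℝ]}
    (h : ∀ g : ℍ[ℝ], p * (g * q * star g) = g * q * star g * p) :
    (p.imI = 0 ∧ p.imJ = 0 ∧ p.imK = 0) ∨ (q.imI = 0 ∧ q.imJ = 0 ∧ q.imK = 0) := by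
  have key : ∀ a b c d : ℝ, _ := fun a b c d => Quaternion.ext_iff.1 (h (quat a b c d))
  -- The half-turns given by `i` and `j` flip the signs of two coordinates and separate the
  -- off-diagonal products; `1 + i + j + k` permutes the axes cyclically and brings in the diagonal
  -- ones.
  have e1 := key 1 0 0 0
  have e2 := key 0 1 0 0
  have e3 := key 0 0 1 0
  have e4 := key 1 1 1 1
  simp only [Quaternion.re_mul, Quaternion.imI_mul, Quaternion.imJ_mul, Quaternion.imK_mul,
    Quaternion.re_star, Quaternion.imI_star, Quaternion.imJ_star, Quaternion.imK_star,
    quat_re, quat_imI, quat_imJ, quat_imK] at e1 e2 e3 e4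
  obtain ⟨-, a1, a2, a3⟩ := e1
  obtain ⟨-, b1, b2, b3⟩ := e2
  obtain ⟨-, c1, c2, c3⟩ := e3
  obtain ⟨-, d1, d2, d3⟩ := e4
  have h12 : p.imI * q.imJ = 0 := by linarith only [a3, b3]
  have h21 : p.imJ * q.imI = 0 := by linarith only [a3, b3]
  have h13 : p.imI * q.imK = 0 := by linarith only [a2, b2]
  have h31 : p.imK * q.imI = 0 := by linarith only [a2, b2]
  have h23 : p.imJ * q.imK = 0 := by linarith only [a1, c1]
  have h32 : p.imK * q.imJ = 0 := by linarith only [a1, c1]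
  have h22 : p.imJ * q.imJ = 0 := by linarith only [d1, h31]
  have h33 : p.imK * q.imK = 0 := by linarith only [d2, h12]
  have h11 : p.imI * q.imI = 0 := by linarith only [d3, h23]
  exact forall_eq_zero_or_of_mul h11 h12 h13 h21 h22 h23 h31 h32 h33

/-- The real part of the relation says that the inner product of the imaginary part of `p` with the
rotated imaginary part of `q` is `p.re * q.re`, scaled by the squared norm of `g`. The twelve chosen
`g` realize the rotations of a tetrahedron: in each group of four the inner products sum to zero, so
`p.re * q.re = 0` and the products of coordinates separate. -/
theorem im_mul_im_eq_zero_of_anticommute {p q : ℍ[ℝ]}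
    (h : ∀ g : ℍ[ℝ], p * (g * q * star g) = -(g * q * star g * p)) :
    (p.imI = 0 ∧ p.imJ = 0 ∧ p.imK = 0) ∨ (q.imI = 0 ∧ q.imJ = 0 ∧ q.imK = 0) := by
  have key : ∀ a b c d : ℝ, _ := fun a b c d => congrArg QuaternionAlgebra.re (h (quat a b c d))
  have e1 := key 1 0 0 0
  have e2 := key 0 1 0 0
  have e3 := key 0 0 1 0
  have e3' := key 0 0 0 1
  have e4 := key 1 1 1 1
  have e5 := key (-1) 1 1 (-1)
  have e6 := key (-1) (-1) 1 1
  have e7 := key (-1) 1 (-1) 1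
  have f4 := key 1 (-1) (-1) (-1)
  have f5 := key 1 1 1 (-1)
  have f6 := key 1 (-1) 1 1
  have f7 := key 1 1 (-1) 1
  simp only [Quaternion.re_mul, Quaternion.imI_mul, Quaternion.imJ_mul, Quaternion.imK_mul,
    Quaternion.re_star, Quaternion.imI_star, Quaternion.imJ_star, Quaternion.imK_star,
    Quaternion.re_neg, quat_re, quat_imI, quat_imJ, quat_imK] at e1 e2 e3 e3' e4 e5 e6 e7 f4 f5 f6 f7
  have h11 : p.imI * q.imI = 0 := by linarith only [e1, e2, e3, e3']
  have h22 : p.imJ * q.imJ = 0 := by linarith only [e1, e2, e3, e3']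
  have h33 : p.imK * q.imK = 0 := by linarith only [e1, e2, e3, e3']
  have h13 : p.imI * q.imK = 0 := by linarith only [e4, e5, e6, e7]
  have h21 : p.imJ * q.imI = 0 := by linarith only [e4, e5, e6, e7]
  have h32 : p.imK * q.imJ = 0 := by linarith only [e4, e5, e6, e7]
  have h12 : p.imI * q.imJ = 0 := by linarith only [f4, f5, f6, f7]
  have h23 : p.imJ * q.imK = 0 := by linarith only [f4, f5, f6, f7]
  have h31 : p.imK * q.imI = 0 := by linarith only [f4, f5, f6, f7]
  exact forall_eq_zero_or_of_mul h11 h12 h13 h21 h22 h23 h31 h32 h33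

theorem eq_one_or_neg_one_of_im {g : SU2}
    (h : (toQ g).imI = 0 ∧ (toQ g).imJ = 0 ∧ (toQ g).imK = 0) : g = 1 ∨ g = -1 := by
  have h1 := normSq_toQ g
  rw [Quaternion.normSq_def', h.1, h.2.1, h.2.2] at h1
  have h2 : ((toQ g).re - 1) * ((toQ g).re + 1) = 0 := by linarith
  rcases mul_eq_zero.1 h2 with h3 | h3
  · left
    apply toQ_injective
    rw [map_one]
    ext <;> simp [h.1, h.2.1, h.2.2]; linarith
  · right
    apply toQ_injective
    rw [toQ_neg, map_one]
    ext <;> simp [h.1, h.2.1, h.2.2]; linarith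

/-- Both sides are homogeneous of degree two in `g`, so unit quaternions suffice; the two preceding
criteria can then be evaluated at quaternions with entries `0, ±1`. -/
theorem conj_scale {p q : ℍ[ℝ]} {ε : ℝ}
    (h : ∀ g : ℍ[ℝ], ‖g‖ = 1 → p * (g * q * star g) = ε • (g * q * star g * p)) (g : ℍ[ℝ]) :
    p * (g * q * star g) = ε • (g * q * star g * p) := by
  rcases eq_or_ne g 0 with rfl | hg
  · simp
  · have hg' : ‖g‖ ≠ 0 := norm_ne_zero_iff.2 hg
    have := h (‖g‖⁻¹ • g) (by rw [norm_smul, norm_inv, norm_norm, inv_mul_cancel₀ hg'])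
    simp only [Quaternion.star_smul, smul_mul_assoc, mul_smul_comm] at this
    rw [smul_comm ε, smul_comm ε] at this
    exact smul_right_injective _ (inv_ne_zero hg') (smul_right_injective _ (inv_ne_zero hg') this)

/-- If `x` commutes up to sign with all conjugates of `y`, then `x` or `y` is `± 1`. -/
theorem eq_one_or_neg_one_of_commute_conj {x y : SU2}
    (h : ∀ g, x * (g * y * g⁻¹) = g * y * g⁻¹ * x ∨ x * (g * y * g⁻¹) = -(g * y * g⁻¹ * x)) :
    (x = 1 ∨ x = -1) ∨ (y = 1 ∨ y = -1) := by
  have c1 : Continuous fun g => toQ (x * (g * y * g⁻¹)) := by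
    exact continuous_toQ.comp (continuous_const.mul
      ((continuous_id.mul continuous_const).mul continuous_inv))
  have c2 : Continuous fun g => toQ (g * y * g⁻¹ * x) := by
    exact continuous_toQ.comp (((continuous_id.mul continuous_const).mul continuous_inv).mul
      continuous_const)
  have hA : IsClosed {g : SU2 | x * (g * y * g⁻¹) = g * y * g⁻¹ * x} := by
    have := isClosed_eq c1 c2
    simpa only [toQ_injective.eq_iff] using this
  have hB : IsClosed {g : SU2 | x * (g * y * g⁻¹) = -(g * y * g⁻¹ * x)} := by
    have := isClosed_eq c1 c2.neg
    simpa only [Pi.neg_apply, ← toQ_neg, toQ_injective.eq_iff] using this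
  -- Both sets are closed and, as `-g ≠ g`, they are complementary. By connectedness of `SU(2)` the
  -- sign is the same for all `g`.
  have hAB : {g : SU2 | x * (g * y * g⁻¹) = g * y * g⁻¹ * x}ᶜ =
      {g : SU2 | x * (g * y * g⁻¹) = -(g * y * g⁻¹ * x)} := by
    ext g
    simp only [Set.mem_compl_iff, Set.mem_ofPred_eq]
    refine ⟨(h g).resolve_left, fun h1 h2 => neg_ne _ (h1.symm.trans h2)⟩
  have hcl : IsClopen {g : SU2 | x * (g * y * g⁻¹) = g * y * g⁻¹ * x} :=
    ⟨hA, by rw [← isClosed_compl_iff, hAB]; exact hB⟩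
  rcases isClopen_iff.1 hcl with h0 | h0
  · rw [h0, Set.compl_empty, eq_comm, Set.eq_univ_iff_forall] at hAB
    refine (im_mul_im_eq_zero_of_anticommute (p := toQ x) (q := toQ y) fun g => ?_).imp
      eq_one_or_neg_one_of_im eq_one_or_neg_one_of_im
    rw [← neg_one_smul ℝ]
    refine conj_scale (fun g hg => ?_) g
    obtain ⟨g, rfl⟩ := exists_toQ_eq hg
    rw [← toQ_inv, ← map_mul, ← map_mul, ← map_mul, ← map_mul, neg_one_smul, ← toQ_neg]
    exact congrArg toQ (hAB g)
  · rw [Set.eq_univ_iff_forall] at h0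
    refine (im_mul_im_eq_zero_of_commute (p := toQ x) (q := toQ y) fun g => ?_).imp
      eq_one_or_neg_one_of_im eq_one_or_neg_one_of_im
    rw [← one_smul ℝ (_ * toQ x)]
    refine conj_scale (fun g hg => ?_) g
    obtain ⟨g, rfl⟩ := exists_toQ_eq hg
    rw [← toQ_inv, ← map_mul, ← map_mul, ← map_mul, ← map_mul, one_smul]
    exact congrArg toQ (h0 g)

end SU2

/-! ### Isomorphisms between quotients by signs -/

section

namespace SU2

/-- The element of `SU(2)` corresponding to the quaternion `i`. -/
noncomputable def qi : SU2 := ofQ ⟨quat 0 1 0 0, by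
  rw [mem_sphere_zero_iff_norm, ← sq_eq_sq₀ (norm_nonneg _) zero_le_one, sq,
    ← Quaternion.normSq_eq_norm_mul_self, Quaternion.normSq_def']; simp⟩

/-- The element of `SU(2)` corresponding to the quaternion `j`. -/
noncomputable def qj : SU2 := ofQ ⟨quat 0 0 1 0, by
  rw [mem_sphere_zero_iff_norm, ← sq_eq_sq₀ (norm_nonneg _) zero_le_one, sq,
    ← Quaternion.normSq_eq_norm_mul_self, Quaternion.normSq_def']; simp⟩

theorem qi_mul_qj : qi * qj = -(qj * qi) := by
  apply toQ_injective
  rw [toQ_neg, map_mul, map_mul, qi, qj, toQ_ofQ, toQ_ofQ]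
  ext <;> simp

/-- As a commutator, `-1` can be followed through an abstract isomorphism. -/
theorem qi_qj_commutator : qi * qj * qi⁻¹ * qj⁻¹ = -1 := by
  rw [qi_mul_qj]; simp [mul_assoc]

theorem qi_ne : ¬(qi = 1 ∨ qi = -1) := by
  rintro (h | h)
  · have := congrArg (fun g => (toQ g).imI) h
    simp [qi, toQ_ofQ] at this
  · have := congrArg (fun g => (toQ g).imI) h
    simp [qi, toQ_ofQ, toQ_neg] at this

theorem commutator_eq_one_left {x y : SU2} (h : x = 1 ∨ x = -1) : x * y * x⁻¹ * y⁻¹ = 1 := by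
  have h1 : (-1 : SU2)⁻¹ = -1 := inv_eq_of_mul_eq_one_left (by simp)
  rcases h with rfl | rfl <;> simp [h1]

end SU2

variable {n : ℕ}

theorem commute_mulSingle_conj {i j : Fin n} (hij : i ≠ j) (a b : SU2) (h : SU2Pow n) :
    Commute (Pi.mulSingle i a) (h * Pi.mulSingle j b * h⁻¹) := by
  funext k
  rcases eq_or_ne k i with rfl | hk
  · simp [Pi.mulSingle_eq_of_ne hij]
  · simp [Pi.mulSingle_eq_of_ne hk]

/-- Commuting modulo a group of signs is commuting up to sign in every coordinate, and conjugators
supported at `k` already give all conjugates of `b k`. -/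
theorem eq_one_or_neg_one_of_commute_mk {Z : Subgroup (SU2Pow n)} [Z.Normal]
    (hZ : ∀ z ∈ Z, ∀ i, z i = 1 ∨ z i = -1) {a b : SU2Pow n}
    (h : ∀ g : SU2Pow n, Commute (a : SU2Pow n ⧸ Z) ((g * b * g⁻¹ : SU2Pow n) : SU2Pow n ⧸ Z))
    (k : Fin n) : (a k = 1 ∨ a k = -1) ∨ (b k = 1 ∨ b k = -1) := by
  refine SU2.eq_one_or_neg_one_of_commute_conj fun g => ?_
  have h1 := (h (Pi.mulSingle k g)).eq.symm
  rw [← QuotientGroup.mk_mul, ← QuotientGroup.mk_mul, QuotientGroup.eq] at h1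
  have h2 := hZ _ h1 k
  simp only [Pi.mul_apply, Pi.inv_apply, Pi.mulSingle_eq_same] at h2
  rcases h2 with h2 | h2
  · left
    rw [inv_mul_eq_one] at h2
    exact h2.symm
  · right
    rw [inv_mul_eq_iff_eq_mul] at h2
    rw [h2]; simp

/-- An isomorphism between quotients of `SU(2) ^ n` by groups of signs permutes the classes of
the elements which are `-1` at one coordinate and `1` at the others. -/
theorem exists_perm_of_mulEquiv {Z₁ Z₂ : Subgroup (SU2Pow n)} [Z₁.Normal] [Z₂.Normal]
    (hZ₁ : ∀ i, Pi.mulSingle i (-1) ∉ Z₁) (hZ₂ : ∀ z ∈ Z₂, ∀ i, z i = 1 ∨ z i = -1)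
    (φ : (SU2Pow n ⧸ Z₁) ≃* (SU2Pow n ⧸ Z₂)) :
    ∃ τ : Equiv.Perm (Fin n), ∀ i,
      φ ((Pi.mulSingle i (-1) : SU2Pow n) : SU2Pow n ⧸ Z₁) =
        ((Pi.mulSingle (τ i) (-1) : SU2Pow n) : SU2Pow n ⧸ Z₂) := by
  have hφ : ∀ g : SU2Pow n ⧸ Z₁, ∃ x : SU2Pow n, (x : SU2Pow n ⧸ Z₂) = φ g := fun g =>
    QuotientGroup.mk_surjective _
  have hφ' : ∀ g : SU2Pow n, ∃ x : SU2Pow n, φ (x : SU2Pow n ⧸ Z₁) = (g : SU2Pow n ⧸ Z₂) := fun g => by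
    obtain ⟨x, hx⟩ := QuotientGroup.mk_surjective (φ.symm g)
    exact ⟨x, by rw [hx, φ.apply_symm_apply]⟩
  -- The commutator `w i` of these lifts represents the image of the element with `-1` at the single
  -- coordinate `i`.
  choose x hx using fun i => hφ ((Pi.mulSingle i SU2.qi : SU2Pow n) : SU2Pow n ⧸ Z₁)
  choose y hy using fun i => hφ ((Pi.mulSingle i SU2.qj : SU2Pow n) : SU2Pow n ⧸ Z₁)
  let w : Fin n → SU2Pow n := fun i => x i * y i * (x i)⁻¹ * (y i)⁻¹
  have hw : ∀ i, (w i : SU2Pow n ⧸ Z₂) = φ ((Pi.mulSingle i (-1) : SU2Pow n) : SU2Pow n ⧸ Z₁) := by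
    intro i
    simp only [w, QuotientGroup.mk_mul, QuotientGroup.mk_inv, hx, hy]
    simp only [← map_mul, ← map_inv, ← QuotientGroup.mk_mul, ← QuotientGroup.mk_inv,
      ← Pi.mulSingle_mul, ← Pi.mulSingle_inv, SU2.qi_qj_commutator]
  -- Elements of different factors commute with all conjugates of each other. This passes through
  -- `φ`, because every conjugator on the right-hand side is the image of some `h`.
  have hconj : ∀ i j, i ≠ j → ∀ k, (x i k = 1 ∨ x i k = -1) ∨ (x j k = 1 ∨ x j k = -1) := by
    intro i j hij k
    refine eq_one_or_neg_one_of_commute_mk hZ₂ (fun g => ?_) k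
    obtain ⟨h, hh⟩ := hφ' g
    rw [QuotientGroup.mk_mul, QuotientGroup.mk_mul, QuotientGroup.mk_inv, hx, hx, ← hh,
      ← map_inv, ← map_mul, ← map_mul, ← QuotientGroup.mk_inv, ← QuotientGroup.mk_mul,
      ← QuotientGroup.mk_mul]
    exact ((commute_mulSingle_conj hij _ _ h).map (QuotientGroup.mk' Z₁)).map φ
  -- `w i` is central modulo `Z₂`; testing it against an element that is noncentral in every
  -- coordinate forces its coordinates to be signs.
  have hcentral : ∀ i k, w i k = 1 ∨ w i k = -1 := by
    intro i k
    refine (eq_one_or_neg_one_of_commute_mk (b := fun _ => SU2.qi) hZ₂ (fun g => ?_) k).resolve_right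
      SU2.qi_ne
    obtain ⟨h, hh⟩ := hφ' (g * (fun _ => SU2.qi) * g⁻¹)
    rw [hw, ← hh]
    refine Commute.map (Commute.map ?_ (QuotientGroup.mk' Z₁)) φ
    funext l
    rcases eq_or_ne l i with rfl | hl
    · simp
    · simp [Pi.mulSingle_eq_of_ne hl]
  have hne : ∀ i, ∃ k, w i k ≠ 1 := by
    intro i
    by_contra! hcon
    have h1 : w i = 1 := funext hcon
    have h2 := hw i
    rw [h1, QuotientGroup.mk_one, eq_comm, EmbeddingLike.map_eq_one_iff, QuotientGroup.eq_one_iff] at h2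
    exact hZ₁ i h2
  choose τ hτ using hne
  -- Where `w i` is nontrivial, `x i` is noncentral, so `x j` is central there and `w j` is trivial.
  -- The `n` supports are thus nonempty and pairwise disjoint in a set of `n` coordinates, hence
  -- singletons.
  have hdisj : ∀ i j, i ≠ j → w j (τ i) = 1 := by
    intro i j hij
    have h1 : ¬(x i (τ i) = 1 ∨ x i (τ i) = -1) := fun h =>
      hτ i (SU2.commutator_eq_one_left h)
    exact SU2.commutator_eq_one_left ((hconj i j hij (τ i)).resolve_left h1)
  have hinj : Function.Injective τ := by
    intro i j hij
    by_contra hne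
    exact hτ j (hij ▸ hdisj i j hne)
  have hbij := Finite.injective_iff_bijective.1 hinj
  refine ⟨Equiv.ofBijective τ hbij, fun i => ?_⟩
  rw [← hw]
  congr 1
  funext k
  rw [Equiv.ofBijective_apply]
  rcases eq_or_ne k (τ i) with rfl | hk
  · rw [Pi.mulSingle_eq_same]
    exact (hcentral _ _).resolve_left (hτ i)
  · rw [Pi.mulSingle_eq_of_ne hk]
    obtain ⟨j, rfl⟩ := hbij.2 k
    exact hdisj j i fun h => hk (by rw [h])

/-! ### Binary codes as central subgroups -/

/-- The element of the center of `SU(2)` of the given sign. -/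
noncomputable def signSU2 : ℤˣ →* SU2 where
  toFun u := if u = 1 then 1 else -1
  map_one' := by simp
  map_mul' u v := by
    rcases Int.units_eq_one_or u with rfl | rfl <;> rcases Int.units_eq_one_or v with rfl | rfl <;>
      simp

@[simp] theorem signSU2_neg_one : signSU2 (-1) = -1 := by
  simp [signSU2]

theorem signSU2_eq (u : ℤˣ) : signSU2 u = 1 ∨ signSU2 u = -1 := by
  rcases Int.units_eq_one_or u with rfl | rfl <;> simp

theorem signSU2_injective : Function.Injective signSU2 := by
  rw [injective_iff_map_eq_one]
  intro u hu
  rcases Int.units_eq_one_or u with rfl | rfl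
  · rfl
  · simp only [signSU2_neg_one] at hu
    exact absurd hu (SU2.neg_ne 1)

/-- The central element of `SU(2) ^ n` with the given signs. -/
noncomputable def signPow (n : ℕ) : (Fin n → ℤˣ) →* SU2Pow n where
  toFun u i := signSU2 (u i)
  map_one' := by funext i; simp
  map_mul' _ _ := by funext i; simp

theorem signPow_apply (u : Fin n → ℤˣ) (i : Fin n) : signPow n u i = signSU2 (u i) := rfl

theorem signPow_injective : Function.Injective (signPow n) := fun _ _ h =>
  funext fun i => signSU2_injective (congrFun h i)

theorem signPow_mulSingle (i : Fin n) :
    signPow n (Pi.mulSingle i (-1)) = Pi.mulSingle i (-1) := by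
  funext j
  rw [signPow_apply]
  rcases eq_or_ne j i with rfl | h
  · simp
  · simp [Pi.mulSingle_eq_of_ne h]

theorem signPow_mem_center (u : Fin n → ℤˣ) : signPow n u ∈ Subgroup.center (SU2Pow n) := by
  rw [Subgroup.mem_center_iff]
  intro g
  funext i
  rw [Pi.mul_apply, Pi.mul_apply, signPow_apply]
  rcases signSU2_eq (u i) with h | h <;> simp [h]

/-- The central subgroup of `SU(2) ^ n` given by a binary code. -/
noncomputable def codeSubgroup (C : Subgroup (Fin n → ℤˣ)) : Subgroup (SU2Pow n) :=
  C.map (signPow n)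

theorem codeSubgroup_le_center (C : Subgroup (Fin n → ℤˣ)) :
    codeSubgroup C ≤ Subgroup.center (SU2Pow n) := by
  rintro _ ⟨u, -, rfl⟩
  exact signPow_mem_center u

instance codeSubgroup_normal (C : Subgroup (Fin n → ℤˣ)) : (codeSubgroup C).Normal where
  conj_mem z hz g := by
    rw [Subgroup.mem_center_iff.1 (codeSubgroup_le_center C hz) g]
    simpa

theorem signPow_mem_codeSubgroup {C : Subgroup (Fin n → ℤˣ)} {u : Fin n → ℤˣ} :
    signPow n u ∈ codeSubgroup C ↔ u ∈ C :=
  Subgroup.mem_map_iff_mem signPow_injective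

theorem codeSubgroup_apply {C : Subgroup (Fin n → ℤˣ)} {z : SU2Pow n} (hz : z ∈ codeSubgroup C)
    (i : Fin n) : z i = 1 ∨ z i = -1 := by
  obtain ⟨u, -, rfl⟩ := hz
  exact signSU2_eq _

theorem finite_codeSubgroup (C : Subgroup (Fin n → ℤˣ)) : Finite (codeSubgroup C) :=
  (Set.toFinite (C : Set (Fin n → ℤˣ))).image (signPow n)

/-- The code consisting of three pairs of equal coordinates. -/
def pairCode : Subgroup (Fin 6 → ℤˣ) where
  carrier := {u | u 0 = u 1 ∧ u 2 = u 3 ∧ u 4 = u 5}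
  one_mem' := ⟨rfl, rfl, rfl⟩
  mul_mem' {u v} hu hv := by
    simp only [Set.mem_ofPred_eq, Pi.mul_apply] at *
    simp [hu, hv]
  inv_mem' {u} hu := by
    simp only [Set.mem_ofPred_eq, Pi.inv_apply] at *
    simp [hu]

/-- The code with the same weights as `pairCode` which is the sum of the even code on the first
three coordinates and of the repetition code. -/
def evenCode : Subgroup (Fin 6 → ℤˣ) where
  carrier := {u | u 0 * u 1 * u 2 = u 3 ∧ u 3 = u 4 ∧ u 4 = u 5}
  one_mem' := ⟨rfl, rfl, rfl⟩
  mul_mem' {u v} hu hv := by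
    simp only [Set.mem_ofPred_eq, Pi.mul_apply] at *
    refine ⟨?_, by simp [hu, hv], by simp [hu, hv]⟩
    rw [← hu.1, ← hv.1]
    ac_rfl
  inv_mem' {u} hu := by
    simp only [Set.mem_ofPred_eq, Pi.inv_apply] at *
    simp [hu]

theorem mem_pairCode {u : Fin 6 → ℤˣ} : u ∈ pairCode ↔ u 0 = u 1 ∧ u 2 = u 3 ∧ u 4 = u 5 := Iff.rfl

theorem mem_evenCode {u : Fin 6 → ℤˣ} :
    u ∈ evenCode ↔ u 0 * u 1 * u 2 = u 3 ∧ u 3 = u 4 ∧ u 4 = u 5 := Iff.rfl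

instance (u : Fin 6 → ℤˣ) : Decidable (u ∈ pairCode) := decidable_of_iff _ mem_pairCode.symm
instance (u : Fin 6 → ℤˣ) : Decidable (u ∈ evenCode) := decidable_of_iff _ mem_evenCode.symm

/-- The permutation obtained from an isomorphism would match the words of weight two of the codes,
whose supports meet in `evenCode` but not in `pairCode`. -/
theorem isEmpty_mulEquiv_codeSubgroup :
    IsEmpty ((SU2Pow 6 ⧸ codeSubgroup pairCode) ≃* (SU2Pow 6 ⧸ codeSubgroup evenCode)) := by
  refine ⟨fun φ => ?_⟩
  obtain ⟨τ, hτ⟩ := exists_perm_of_mulEquiv (fun i => by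
    rw [← signPow_mulSingle, signPow_mem_codeSubgroup]
    revert i; decide) (fun z => codeSubgroup_apply) φ
  have h2 : ∀ i j, (Pi.mulSingle i (-1) : Fin 6 → ℤˣ)⁻¹ * Pi.mulSingle j (-1) ∈ evenCode →
      (Pi.mulSingle (τ.symm i) (-1) : Fin 6 → ℤˣ)⁻¹ * Pi.mulSingle (τ.symm j) (-1) ∈ pairCode := by
    intro i j hij
    rw [← signPow_mem_codeSubgroup, map_mul, map_inv, ← QuotientGroup.eq, signPow_mulSingle,
      signPow_mulSingle] at hij ⊢
    apply φ.injective
    rw [hτ, hτ, τ.apply_symm_apply, τ.apply_symm_apply, hij]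
  -- The supports `{0, 1}` and `{0, 2}` share a coordinate; no two distinct words of weight two in
  -- `pairCode` do.
  have h01 := h2 0 1 (by decide)
  have h02 := h2 0 2 (by decide)
  have n01 : τ.symm 0 ≠ τ.symm 1 := τ.symm.injective.ne (by decide)
  have n02 : τ.symm 0 ≠ τ.symm 2 := τ.symm.injective.ne (by decide)
  have n12 : τ.symm 1 ≠ τ.symm 2 := τ.symm.injective.ne (by decide)
  generalize τ.symm 0 = a at *
  generalize τ.symm 1 = b at *
  generalize τ.symm 2 = c at *
  revert a b c
  decide

end

/-! ### Lie groups from one parametrization at the identity -/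

/-- A topological group with a local parametrization `S` of a neighbourhood of the identity, with
inverse `φ`, in which the group operations are smooth. -/
class SmoothLocalParam (Γ : Type*) [Group Γ] [TopologicalSpace Γ] [IsTopologicalGroup Γ]
    (E : Type*) [NormedAddCommGroup E] [NormedSpace ℝ E] where
  /-- The local coordinates. -/
  φ : Γ → E
  /-- The parametrization. -/
  S : E → Γ
  S_zero : S 0 = 1
  φ_S : ∀ x, φ (S x) = x
  continuous_S : Continuous S
  isOpen_range : IsOpen (Set.range S)
  continuousOn_φ : ContinuousOn φ (Set.range S)
  -- These are the coordinate expressions in translated charts. The transition from the chart at `a`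
  -- to the one at `b` involves only `b⁻¹ * a`, multiplication near `(a, b)` only `b`, and for
  -- multiplication and inversion smoothness at the origin suffices because every point is the
  -- centre of a chart.
  contDiffAt_trans : ∀ g x, g * S x ∈ Set.range S → ContDiffAt ℝ ∞ (fun y => φ (g * S y)) x
  contDiffAt_mul : ∀ g, ContDiffAt ℝ ∞ (fun p : E × E => φ (g⁻¹ * (S p.1 * (g * S p.2)))) (0, 0)
  contDiffAt_inv : ∀ g, ContDiffAt ℝ ∞ (fun x => φ (g * ((S x)⁻¹ * g⁻¹))) 0

namespace SmoothLocalParam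

variable (Γ : Type*) [Group Γ] [TopologicalSpace Γ] [IsTopologicalGroup Γ]
  (E : Type*) [NormedAddCommGroup E] [NormedSpace ℝ E] [SmoothLocalParam Γ E]

theorem φ_one : φ (1 : Γ) = (0 : E) := by
  rw [← S_zero (E := E), φ_S]

/-- The chart at the identity. -/
def chartOne : OpenPartialHomeomorph Γ E where
  toFun := φ
  invFun := S
  source := Set.range (S : E → Γ)
  target := Set.univ
  map_source' _ _ := Set.mem_univ _
  map_target' x _ := Set.mem_range_self x
  left_inv' := by rintro _ ⟨x, rfl⟩; rw [φ_S]
  right_inv' x _ := φ_S x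
  open_source := isOpen_range
  open_target := isOpen_univ
  continuousOn_toFun := continuousOn_φ
  continuousOn_invFun := continuous_S.continuousOn

/-- The chart at a point, obtained by translation. -/
def chart (a : Γ) : OpenPartialHomeomorph Γ E :=
  (Homeomorph.mulLeft a⁻¹).toOpenPartialHomeomorph.trans (chartOne Γ E)

variable {Γ E}

theorem chart_apply (a b : Γ) : chart Γ E a b = φ (a⁻¹ * b) := rfl

theorem chart_symm_apply (a : Γ) (x : E) : (chart Γ E a).symm x = a * S x := by
  change a⁻¹⁻¹ * S x = a * S x
  rw [inv_inv]

theorem chart_source (a : Γ) : (chart Γ E a).source = {b | a⁻¹ * b ∈ Set.range (S : E → Γ)} := by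
  ext b
  simp [chart, chartOne]

theorem chart_target (a : Γ) : (chart Γ E a).target = Set.univ := by
  ext b
  simp [chart, chartOne]

variable (Γ E) in
/-- The charted space structure given by the translates of the chart at the identity. -/
abbrev chartedSpace : ChartedSpace E Γ where
  atlas := Set.range (chart Γ E)
  chartAt := chart Γ E
  mem_chart_source a := by
    rw [chart_source]
    exact ⟨0, by rw [S_zero, inv_mul_cancel]⟩
  chart_mem_atlas := Set.mem_range_self

attribute [local instance] chartedSpace

theorem chartAt_eq (a : Γ) : chartAt E a = chart Γ E a := rfl

theorem extChartAt_apply (a b : Γ) : extChartAt 𝓘(ℝ, E) a b = φ (a⁻¹ * b) := by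
  simp [chartAt_eq, chart_apply]

theorem extChartAt_symm_apply (a : Γ) (x : E) : (extChartAt 𝓘(ℝ, E) a).symm x = a * S x := by
  simp [chartAt_eq, chart_symm_apply]

theorem extChartAt_target (a : Γ) : (extChartAt 𝓘(ℝ, E) a).target = Set.univ := by
  simp [chartAt_eq, chart_target]

instance isManifold : IsManifold 𝓘(ℝ, E) ∞ Γ := by
  refine isManifold_of_contDiffOn _ _ _ ?_
  rintro _ _ ⟨a, rfl⟩ ⟨b, rfl⟩ x ⟨hx, -⟩
  refine ContDiffAt.contDiffWithinAt ?_
  have h1 : (𝓘(ℝ, E) ∘ (chart Γ E a).symm.trans (chart Γ E b) ∘ 𝓘(ℝ, E).symm) =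
      fun y => φ (b⁻¹ * a * S y) := by
    funext y
    simp [chart_apply, chart_symm_apply, mul_assoc]
  rw [h1]
  refine contDiffAt_trans _ _ ?_
  have h2 : x ∈ ((chart Γ E a).symm.trans (chart Γ E b)).source := hx
  rw [OpenPartialHomeomorph.trans_source, Set.mem_inter_iff, Set.mem_preimage, chart_source,
    chart_symm_apply] at h2
  simpa [mul_assoc] using h2.2

theorem lieGroup : LieGroup 𝓘(ℝ, E) ∞ Γ where
  contMDiff_mul := by
    rintro ⟨a, b⟩
    rw [contMDiffAt_iff]
    refine ⟨continuous_mul.continuousAt, ContDiffAt.contDiffWithinAt ?_⟩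
    have h1 : extChartAt (𝓘(ℝ, E).prod 𝓘(ℝ, E)) (a, b) (a, b) = (0, 0) := by
      rw [extChartAt_prod]
      refine Prod.ext ?_ ?_
      · exact (extChartAt_apply a a).trans (by rw [inv_mul_cancel, φ_one])
      · exact (extChartAt_apply b b).trans (by rw [inv_mul_cancel, φ_one])
    rw [h1]
    refine (contDiffAt_mul (E := E) b).congr_of_eventuallyEq (Filter.Eventually.of_forall ?_)
    rintro ⟨x, y⟩
    simp only [Function.comp_apply, extChartAt_prod, PartialEquiv.prod_symm, PartialEquiv.prod_coe,
      extChartAt_apply, extChartAt_symm_apply]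
    congr 1
    group
  contMDiff_inv := by
    intro a
    rw [contMDiffAt_iff]
    refine ⟨continuous_inv.continuousAt, ContDiffAt.contDiffWithinAt ?_⟩
    rw [extChartAt_apply, inv_mul_cancel, φ_one]
    refine (contDiffAt_inv (E := E) a).congr_of_eventuallyEq (Filter.Eventually.of_forall ?_)
    intro x
    simp only [Function.comp_apply, extChartAt_apply, extChartAt_symm_apply]
    congr 1
    group

/-- The left invariant vector field in the coordinates at the identity. -/
noncomputable def invariantField (Γ : Type*) [Group Γ] [TopologicalSpace Γ] [IsTopologicalGroup Γ]
    [SmoothLocalParam Γ E] (v : E) (x : E) : E :=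
  fderiv ℝ (fun y => φ ((S x : Γ) * S y)) (0 : E) v

/-- The chart at `g` is the translate of the chart at `1`, so left translation by `g` reads as the
identity map. -/
theorem mfderiv_mulLeft_one (g : Γ) :
    (mfderiv 𝓘(ℝ, E) 𝓘(ℝ, E) (g * ·) (1 : Γ) : E →L[ℝ] E) = ContinuousLinearMap.id ℝ E := by
  have := (lieGroup (Γ := Γ) (E := E))
  have hd : MDifferentiableAt 𝓘(ℝ, E) 𝓘(ℝ, E) (g * ·) (1 : Γ) :=
    (contMDiff_mul_left (I := 𝓘(ℝ, E)) (n := ∞)).mdifferentiableAt (by simp)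
  have h1 : writtenInExtChartAt 𝓘(ℝ, E) 𝓘(ℝ, E) (1 : Γ) (g * ·) = id := by
    funext x
    simp only [writtenInExtChartAt, Function.comp_apply, extChartAt_apply, extChartAt_symm_apply]
    rw [mul_one, one_mul, inv_mul_cancel_left, φ_S, id]
  refine hd.mfderiv.trans ?_
  rw [h1, modelWithCornersSelf_coe, Set.range_id, fderivWithin_univ]
  exact fderiv_id

theorem mfderiv_extChartAt_one (g : Γ) (hg : g ∈ Set.range (S : E → Γ)) :
    (mfderiv 𝓘(ℝ, E) 𝓘(ℝ, E) (extChartAt 𝓘(ℝ, E) (1 : Γ)) g : E →L[ℝ] E) =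
      fderiv ℝ (fun y : E => (φ (g * S y) : E)) (0 : E) := by
  have hd : MDifferentiableAt 𝓘(ℝ, E) 𝓘(ℝ, E) (extChartAt 𝓘(ℝ, E) (1 : Γ)) g := by
    have := IsManifold.of_le (I := 𝓘(ℝ, E)) (M := Γ) (m := 1) (n := ∞) (by simp)
    apply mdifferentiableAt_extChartAt
    rw [chartAt_eq, chart_source]
    simpa using hg
  have h1 : writtenInExtChartAt 𝓘(ℝ, E) 𝓘(ℝ, E) g (extChartAt 𝓘(ℝ, E) (1 : Γ)) =
      fun y : E => (φ (g * S y) : E) := by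
    funext x
    rw [writtenInExtChartAt, extChartAt_model_space_eq_id]
    simp only [PartialEquiv.refl_coe, Function.comp_apply, id_eq, extChartAt_apply,
      extChartAt_symm_apply, inv_one, one_mul]
  have h2 : extChartAt 𝓘(ℝ, E) g g = 0 := by
    rw [extChartAt_apply, inv_mul_cancel, φ_one]
  have h3 : fderivWithin ℝ (writtenInExtChartAt 𝓘(ℝ, E) 𝓘(ℝ, E) g (extChartAt 𝓘(ℝ, E) (1 : Γ)))
      (Set.range 𝓘(ℝ, E)) (extChartAt 𝓘(ℝ, E) g g) =
      fderiv ℝ (fun y : E => (φ (g * S y) : E)) (0 : E) := by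
    rw [h1, h2, modelWithCornersSelf_coe, Set.range_id, fderivWithin_univ]
  exact hd.mfderiv.trans h3

/-- The derivative of the inverse chart is inverted by the derivative of the chart at `S x`, which
`mfderiv_extChartAt_one` computes; left translation contributes the identity. -/
theorem mpullback_mulInvariantVectorField (v : E) (x : E) :
    VectorField.mpullbackWithin 𝓘(ℝ, E) 𝓘(ℝ, E) (extChartAt 𝓘(ℝ, E) (1 : Γ)).symm
      (mulInvariantVectorField (I := 𝓘(ℝ, E)) (G := Γ) v) (Set.range 𝓘(ℝ, E)) x =
      invariantField Γ v x := by
  have := IsManifold.of_le (I := 𝓘(ℝ, E)) (M := Γ) (m := 1) (n := ∞) (by simp)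
  have hx : x ∈ (extChartAt 𝓘(ℝ, E) (1 : Γ)).target := by rw [extChartAt_target]; trivial
  rw [VectorField.mpullbackWithin_apply, ContinuousLinearMap.inverse_eq
    (mfderivWithin_extChartAt_symm_comp_mfderiv_extChartAt hx)
    (mfderiv_extChartAt_comp_mfderivWithin_extChartAt_symm hx)]
  have h1 : (extChartAt 𝓘(ℝ, E) (1 : Γ)).symm x = S x := by
    rw [extChartAt_symm_apply, one_mul]
  rw [h1]
  refine (DFunLike.congr_fun (mfderiv_extChartAt_one (S x : Γ) ⟨x, rfl⟩) _).trans ?_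
  rw [invariantField]
  congr 1
  exact DFunLike.congr_fun (mfderiv_mulLeft_one (E := E) (S x : Γ)) v

/-- The chart at the identity has derivative the identity there, so the bracket of the Lie algebra
becomes an ordinary bracket of vector fields on `E`. -/
theorem bracket_eq (v w : E) :
    (Bracket.bracket (L := GroupLieAlgebra 𝓘(ℝ, E) Γ) (M := GroupLieAlgebra 𝓘(ℝ, E) Γ) v w : E) =
      VectorField.lieBracket ℝ (invariantField (E := E) Γ v) (invariantField (E := E) Γ w) 0 := by
  have h0 : (mfderiv 𝓘(ℝ, E) 𝓘(ℝ, E) (extChartAt 𝓘(ℝ, E) (1 : Γ)) 1 : E →L[ℝ] E) =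
      ContinuousLinearMap.id ℝ E := by
    refine (mfderiv_extChartAt_one _ ⟨0, S_zero⟩).trans ?_
    simp only [one_mul, φ_S]
    exact fderiv_id
  have hv : VectorField.mpullbackWithin 𝓘(ℝ, E) 𝓘(ℝ, E) (extChartAt 𝓘(ℝ, E) (1 : Γ)).symm
      (mulInvariantVectorField (I := 𝓘(ℝ, E)) (G := Γ) v) (Set.range 𝓘(ℝ, E)) =
      invariantField (E := E) Γ v := funext (mpullback_mulInvariantVectorField v)
  have hw : VectorField.mpullbackWithin 𝓘(ℝ, E) 𝓘(ℝ, E) (extChartAt 𝓘(ℝ, E) (1 : Γ)).symm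
      (mulInvariantVectorField (I := 𝓘(ℝ, E)) (G := Γ) w) (Set.range 𝓘(ℝ, E)) =
      invariantField (E := E) Γ w := funext (mpullback_mulInvariantVectorField w)
  have h1 : (mfderiv 𝓘(ℝ, E) 𝓘(ℝ, E) (extChartAt 𝓘(ℝ, E) (1 : Γ)) 1).inverse =
      ContinuousLinearMap.id ℝ E :=
    (congrArg ContinuousLinearMap.inverse h0).trans ContinuousLinearMap.inverse_id
  have h2 : extChartAt 𝓘(ℝ, E) (1 : Γ) 1 = 0 := by
    rw [extChartAt_apply, inv_mul_cancel, φ_one]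
  have h3 : VectorField.lieBracketWithin ℝ
      (VectorField.mpullbackWithin 𝓘(ℝ, E) 𝓘(ℝ, E) (extChartAt 𝓘(ℝ, E) (1 : Γ)).symm
        (mulInvariantVectorField (I := 𝓘(ℝ, E)) (G := Γ) v) (Set.range 𝓘(ℝ, E)))
      (VectorField.mpullbackWithin 𝓘(ℝ, E) 𝓘(ℝ, E) (extChartAt 𝓘(ℝ, E) (1 : Γ)).symm
        (mulInvariantVectorField (I := 𝓘(ℝ, E)) (G := Γ) w) (Set.range 𝓘(ℝ, E)))
      ((extChartAt 𝓘(ℝ, E) (1 : Γ)).symm ⁻¹' Set.univ ∩ Set.range 𝓘(ℝ, E))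
      (extChartAt 𝓘(ℝ, E) (1 : Γ) 1) =
      VectorField.lieBracket ℝ (invariantField (E := E) Γ v) (invariantField (E := E) Γ w) 0 := by
    rw [hv, hw, h2, Set.preimage_univ, Set.univ_inter, modelWithCornersSelf_coe, Set.range_id,
      VectorField.lieBracketWithin_univ]
  exact (DFunLike.congr_fun h1 _).trans h3

end SmoothLocalParam

/-! ### Gnomonic coordinates on SU(2) -/

namespace SU2

/-- The purely imaginary quaternion with given components. -/
noncomputable def imQ : (Fin 3 → ℝ) →L[ℝ] ℍ[ℝ] :=
  LinearMap.toContinuousLinearMap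
    { toFun := fun x => quat 0 (x 0) (x 1) (x 2)
      map_add' := fun x y => by ext <;> simp
      map_smul' := fun c x => by ext <;> simp }

/-- The components of the imaginary part of a quaternion. -/
noncomputable def compQ : ℍ[ℝ] →L[ℝ] (Fin 3 → ℝ) :=
  LinearMap.toContinuousLinearMap
    { toFun := fun q => ![q.imI, q.imJ, q.imK]
      map_add' := fun x y => by simp
      map_smul' := fun c x => by simp }

/-- The real part of a quaternion. -/
noncomputable def reQ : ℍ[ℝ] →L[ℝ] ℝ :=
  LinearMap.toContinuousLinearMap
    { toFun := fun q => q.re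
      map_add' := fun x y => by simp
      map_smul' := fun c x => by simp }

theorem imQ_apply (x : Fin 3 → ℝ) : imQ x = quat 0 (x 0) (x 1) (x 2) := rfl
theorem compQ_apply (q : ℍ[ℝ]) : compQ q = ![q.imI, q.imJ, q.imK] := rfl
theorem reQ_apply (q : ℍ[ℝ]) : reQ q = q.re := rfl

theorem compQ_imQ (x : Fin 3 → ℝ) : compQ (imQ x) = x := by
  funext i
  fin_cases i <;> simp [compQ_apply, imQ_apply]

theorem star_imQ (x : Fin 3 → ℝ) : star (imQ x) = -imQ x := by
  ext <;> simp [imQ_apply]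

/-- The gnomonic coordinates of a quaternion. -/
noncomputable def gnomonic (q : ℍ[ℝ]) : Fin 3 → ℝ := (reQ q)⁻¹ • compQ q

/-- Central projection sees only the line through `q`. Normalizing factors therefore disappear from
products, and the sign `-1` is invisible. -/
theorem gnomonic_smul {c : ℝ} (hc : c ≠ 0) (q : ℍ[ℝ]) : gnomonic (c • q) = gnomonic q := by
  rw [gnomonic, gnomonic, map_smul, map_smul, smul_smul, smul_eq_mul, mul_inv, mul_comm c⁻¹,
    mul_assoc, inv_mul_cancel₀ hc, mul_one]

theorem gnomonic_neg (q : ℍ[ℝ]) : gnomonic (-q) = gnomonic q := by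
  rw [← neg_one_smul ℝ, gnomonic_smul (by norm_num)]

theorem contDiffAt_gnomonic {q : ℍ[ℝ]} (hq : q.re ≠ 0) : ContDiffAt ℝ ∞ gnomonic q :=
  ContDiffAt.smul (reQ.contDiff.contDiffAt.inv hq) compQ.contDiff.contDiffAt

theorem one_add_imQ_ne_zero (x : Fin 3 → ℝ) : 1 + imQ x ≠ 0 := by
  intro h
  have := congrArg (fun q : ℍ[ℝ] => q.re) h
  simp [imQ_apply] at this

/-- The inverse of the gnomonic projection. -/
noncomputable def param (x : Fin 3 → ℝ) : SU2 :=
  ofQ ⟨‖1 + imQ x‖⁻¹ • (1 + imQ x), by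
    rw [mem_sphere_zero_iff_norm, norm_smul, norm_inv, norm_norm,
      inv_mul_cancel₀ (norm_ne_zero_iff.2 (one_add_imQ_ne_zero x))]⟩

theorem toQ_param (x : Fin 3 → ℝ) : toQ (param x) = ‖1 + imQ x‖⁻¹ • (1 + imQ x) := toQ_ofQ _

theorem toQ_param_re_pos (x : Fin 3 → ℝ) : 0 < (toQ (param x)).re := by
  have := norm_pos_iff.2 (one_add_imQ_ne_zero x)
  rw [toQ_param]
  simp [imQ_apply]
  simpa [imQ_apply] using this

theorem continuous_param : Continuous param := by
  rw [isInducing_toQ.continuous_iff]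
  have h : toQ ∘ param = fun x => ‖1 + imQ x‖⁻¹ • (1 + imQ x) := funext toQ_param
  rw [h]
  have h1 : Continuous fun x => 1 + imQ x := continuous_const.add imQ.continuous
  exact (h1.norm.inv₀ fun x => norm_ne_zero_iff.2 (one_add_imQ_ne_zero x)).smul h1

theorem param_zero : param 0 = 1 := by
  apply toQ_injective
  rw [toQ_param]; simp

theorem gnomonic_param (x : Fin 3 → ℝ) : gnomonic (toQ (param x)) = x := by
  rw [toQ_param, gnomonic_smul (inv_ne_zero (norm_ne_zero_iff.2 (one_add_imQ_ne_zero x)))]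
  rw [gnomonic, map_add compQ, compQ_imQ]
  funext i
  fin_cases i <;> simp [reQ_apply, compQ_apply, imQ_apply, Matrix.vecHead, Matrix.vecTail]

theorem param_gnomonic {g : SU2} (hg : 0 < (toQ g).re) : param (gnomonic (toQ g)) = g := by
  apply toQ_injective
  have h : 1 + imQ (gnomonic (toQ g)) = ((toQ g).re)⁻¹ • toQ g := by
    ext <;> simp [imQ_apply, gnomonic, compQ_apply, reQ_apply, hg.ne']
  rw [toQ_param, h, norm_smul, norm_toQ, mul_one, norm_inv, Real.norm_of_nonneg hg.le, inv_inv,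
    smul_smul, mul_inv_cancel₀ hg.ne', one_smul]

theorem gnomonic_mul_param (g : SU2) (x : Fin 3 → ℝ) :
    gnomonic (toQ (g * param x)) = gnomonic (toQ g * (1 + imQ x)) := by
  rw [map_mul, toQ_param, mul_smul_comm,
    gnomonic_smul (inv_ne_zero (norm_ne_zero_iff.2 (one_add_imQ_ne_zero x)))]

theorem gnomonic_conj_param (g : SU2) (x y : Fin 3 → ℝ) :
    gnomonic (toQ (g⁻¹ * (param x * (g * param y)))) =
      gnomonic (toQ g⁻¹ * ((1 + imQ x) * (toQ g * (1 + imQ y)))) := by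
  rw [map_mul, map_mul, map_mul, toQ_param, toQ_param]
  simp only [mul_smul_comm, smul_mul_assoc]
  rw [gnomonic_smul (inv_ne_zero (norm_ne_zero_iff.2 (one_add_imQ_ne_zero y))),
    gnomonic_smul (inv_ne_zero (norm_ne_zero_iff.2 (one_add_imQ_ne_zero x)))]

theorem gnomonic_conj_param_inv (g : SU2) (x : Fin 3 → ℝ) :
    gnomonic (toQ (g * ((param x)⁻¹ * g⁻¹))) =
      gnomonic (toQ g * ((1 - imQ x) * toQ g⁻¹)) := by
  rw [map_mul, map_mul, toQ_inv (param x), toQ_param]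
  rw [Quaternion.star_smul, star_add, star_one, star_imQ, ← sub_eq_add_neg]
  simp only [mul_smul_comm, smul_mul_assoc]
  rw [gnomonic_smul (inv_ne_zero (norm_ne_zero_iff.2 (one_add_imQ_ne_zero x)))]

theorem toQ_mul_toQ_inv (g : SU2) : toQ g * toQ g⁻¹ = 1 := by
  rw [← map_mul, mul_inv_cancel, map_one]

theorem toQ_inv_mul_toQ (g : SU2) : toQ g⁻¹ * toQ g = 1 := by
  rw [← map_mul, inv_mul_cancel, map_one]

/-- The left invariant vector field on `SU(2)` in gnomonic coordinates. -/
noncomputable def leftField (v x : Fin 3 → ℝ) : Fin 3 → ℝ :=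
  v + compQ (imQ x * imQ v) - reQ (imQ x * imQ v) • x

/-- Quotient rule for `compQ / reQ`; the denominator equals `1` at `y = 0` because `imQ x` has no
real part. -/
theorem hasFDerivAt_gnomonic_mul (x : Fin 3 → ℝ) :
    ∃ L : (Fin 3 → ℝ) →L[ℝ] (Fin 3 → ℝ), (∀ v, L v = leftField v x) ∧
      HasFDerivAt (fun y => gnomonic ((1 + imQ x) * (1 + imQ y))) L 0 := by
  have h1 : HasFDerivAt (fun y => (1 + imQ x) * (1 + imQ y))
      ((ContinuousLinearMap.mul ℝ ℍ[ℝ] (1 + imQ x)).comp imQ) 0 :=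
    (ContinuousLinearMap.mul ℝ ℍ[ℝ] (1 + imQ x)).hasFDerivAt.comp _ (imQ.hasFDerivAt.const_add 1)
  have h2 := reQ.hasFDerivAt.comp _ h1
  have h3 := compQ.hasFDerivAt.comp _ h1
  have h0 : reQ ((1 + imQ x) * (1 + imQ 0)) = 1 := by
    simp [reQ_apply, imQ_apply]
  have h4 := (hasDerivAt_inv (x := reQ ((1 + imQ x) * (1 + imQ 0)))
    (by rw [h0]; exact one_ne_zero)).comp_hasFDerivAt (0 : Fin 3 → ℝ) h2
  refine ⟨_, fun v => ?_, h4.smul h3⟩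
  funext i
  simp only [Function.comp_apply, h0]
  fin_cases i <;>
  simp [leftField, compQ_apply, reQ_apply, imQ_apply, Matrix.vecHead, Matrix.vecTail] <;> ring

theorem leftField_zero (v : Fin 3 → ℝ) : leftField v 0 = v := by
  simp [leftField]

/-- The last term of `leftField` is quadratic in `x` and does not contribute at the origin. -/
theorem hasFDerivAt_leftField (v : Fin 3 → ℝ) :
    ∃ L : (Fin 3 → ℝ) →L[ℝ] (Fin 3 → ℝ), (∀ w, L w = compQ (imQ w * imQ v)) ∧
      HasFDerivAt (leftField v) L 0 := by
  have h1 : HasFDerivAt (fun x => imQ x * imQ v)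
      (((ContinuousLinearMap.mul ℝ ℍ[ℝ]).flip (imQ v)).comp imQ) 0 :=
    ((ContinuousLinearMap.mul ℝ ℍ[ℝ]).flip (imQ v)).hasFDerivAt.comp _ imQ.hasFDerivAt
  have h2 := reQ.hasFDerivAt.comp _ h1
  have h3 := compQ.hasFDerivAt.comp _ h1
  refine ⟨_, fun w => ?_, (h3.const_add v).sub (h2.smul (hasFDerivAt_id _))⟩
  simp

/-- The commutator of imaginary quaternions is twice the cross product, and `v × (v × w) = ⟨v, w⟩ v
- |v|² w`. Taking for `w` each basis vector, the diagonal entries are minus sums of two squares of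
coordinates of `v`. This excludes abelian ideals. -/
theorem eq_zero_of_double_bracket {v : Fin 3 → ℝ}
    (h : ∀ w, ∃ u, u = compQ (imQ v * imQ w) - compQ (imQ w * imQ v) ∧
      compQ (imQ v * imQ u) - compQ (imQ u * imQ v) = 0) : v = 0 := by
  have key : ∀ w, compQ (imQ v * imQ (compQ (imQ v * imQ w) - compQ (imQ w * imQ v))) -
      compQ (imQ (compQ (imQ v * imQ w) - compQ (imQ w * imQ v)) * imQ v) = 0 := by
    intro w
    obtain ⟨u, rfl, hu⟩ := h w
    exact hu
  have k0 := congrFun (key ![1, 0, 0]) 0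
  have k1 := congrFun (key ![0, 1, 0]) 1
  have k2 := congrFun (key ![0, 0, 1]) 2
  simp [compQ_apply, imQ_apply] at k0 k1 k2
  have e0 : v 0 * v 0 = 0 := by nlinarith [mul_self_nonneg (v 0), mul_self_nonneg (v 1), mul_self_nonneg (v 2)]
  have e1 : v 1 * v 1 = 0 := by nlinarith [mul_self_nonneg (v 0), mul_self_nonneg (v 1), mul_self_nonneg (v 2)]
  have e2 : v 2 * v 2 = 0 := by nlinarith [mul_self_nonneg (v 0), mul_self_nonneg (v 1), mul_self_nonneg (v 2)]
  funext i
  fin_cases i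
  · exact mul_self_eq_zero.1 e0
  · exact mul_self_eq_zero.1 e1
  · exact mul_self_eq_zero.1 e2

end SU2

/-! ### The quotients as compact semisimple Lie groups -/

section

variable {n : ℕ}

/-- The Euclidean model space for `SU(2) ^ n`. -/
abbrev SU2PowModel (n : ℕ) : Type := EuclideanSpace ℝ (Fin (n * 3))

namespace SU2PowModel

/-- The components of a vector of the model space. -/
noncomputable def equiv (n : ℕ) : SU2PowModel n ≃L[ℝ] (Fin n → Fin 3 → ℝ) :=
  -- Any linear isomorphism serves; it is chosen by comparing dimensions.
  ContinuousLinearEquiv.ofFinrankEq (by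
    rw [finrank_euclideanSpace_fin, Module.finrank_pi_fintype]; simp)

/-- A component of a vector of the model space. -/
noncomputable def comp (i : Fin n) : SU2PowModel n →L[ℝ] (Fin 3 → ℝ) :=
  (ContinuousLinearMap.proj i).comp (equiv n).toContinuousLinearMap

theorem comp_apply (i : Fin n) (x : SU2PowModel n) : comp i x = equiv n x i := rfl

theorem ext {x y : SU2PowModel n} (h : ∀ i, comp i x = comp i y) : x = y :=
  (equiv n).injective (funext h)

theorem comp_symm (i : Fin n) (f : Fin n → Fin 3 → ℝ) : comp i ((equiv n).symm f) = f i := by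
  rw [comp_apply, ContinuousLinearEquiv.apply_symm_apply]

theorem contDiffAt_symm {F : Type*} [NormedAddCommGroup F] [NormedSpace ℝ F]
    {f : F → Fin n → Fin 3 → ℝ} {x : F} (h : ∀ i, ContDiffAt ℝ ∞ (fun y => f y i) x) :
    ContDiffAt ℝ ∞ (fun y => (equiv n).symm (f y)) x :=
  (equiv n).symm.contDiff.contDiffAt.comp x (contDiffAt_pi.2 h)

end SU2PowModel

open SU2PowModel SU2

/-- The parametrization of a neighbourhood of the identity in `SU(2) ^ n`. -/
noncomputable def paramPow (x : SU2PowModel n) : SU2Pow n := fun i => param (comp i x)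

/-- The gnomonic coordinates on `SU(2) ^ n`. -/
noncomputable def coordPow (g : SU2Pow n) : SU2PowModel n :=
  (SU2PowModel.equiv n).symm fun i => gnomonic (toQ (g i))

theorem coordPow_paramPow (x : SU2PowModel n) : coordPow (paramPow x) = x :=
  SU2PowModel.ext fun i => by rw [coordPow, comp_symm, paramPow, gnomonic_param]

theorem range_paramPow : Set.range (paramPow (n := n)) = {g | ∀ i, 0 < (toQ (g i)).re} := by
  ext g
  constructor
  · rintro ⟨x, rfl⟩ i
    exact toQ_param_re_pos _
  · intro hg
    exact ⟨coordPow g, funext fun i => by rw [paramPow, coordPow, comp_symm, param_gnomonic (hg i)]⟩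

theorem continuous_toQ_apply (i : Fin n) : Continuous fun g : SU2Pow n => toQ (g i) :=
  continuous_toQ.comp (continuous_apply i)

theorem isOpen_range_paramPow : IsOpen (Set.range (paramPow (n := n))) := by
  rw [range_paramPow, Set.ofPred_forall]
  exact isOpen_iInter_of_finite fun i =>
    isOpen_lt continuous_const (Quaternion.continuous_re.comp (continuous_toQ_apply i))

theorem continuous_paramPow : Continuous (paramPow (n := n)) :=
  continuous_pi fun i => continuous_param.comp (comp i).continuous

theorem continuousAt_coordPow {g : SU2Pow n} (hg : ∀ i, (toQ (g i)).re ≠ 0) :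
    ContinuousAt coordPow g :=
  (SU2PowModel.equiv n).symm.continuous.continuousAt.comp (continuousAt_pi.2 fun i =>
    ContinuousAt.comp (f := fun g : SU2Pow n => toQ (g i)) (contDiffAt_gnomonic (hg i)).continuousAt
      (continuous_toQ_apply i).continuousAt)

theorem coordPow_mul_sign (g z : SU2Pow n) (hz : ∀ i, z i = 1 ∨ z i = -1) :
    coordPow (g * z) = coordPow g :=
  SU2PowModel.ext fun i => by
    rw [coordPow, coordPow, comp_symm, comp_symm, Pi.mul_apply]
    rcases hz i with h | h
    · rw [h, mul_one]
    · rw [h, mul_neg, mul_one, toQ_neg, gnomonic_neg]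

variable (C : Subgroup (Fin n → ℤˣ))

/-- The quotient of `SU(2) ^ n` by the central subgroup given by a code. -/
abbrev CodeQuotient : Type := SU2Pow n ⧸ codeSubgroup C

/-- The gnomonic coordinates on a quotient of `SU(2) ^ n`. -/
noncomputable def coordQuotient : CodeQuotient C → SU2PowModel n :=
  Quotient.lift coordPow fun a b hab => by
    have h := QuotientGroup.leftRel_apply.1 hab
    rw [← coordPow_mul_sign a (a⁻¹ * b) fun i => codeSubgroup_apply h i, mul_inv_cancel_left]

theorem coordQuotient_mk (g : SU2Pow n) : coordQuotient C (g : CodeQuotient C) = coordPow g := rfl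

/-- Representatives of a point in the range of the parametrization differ by signs, so their real
parts may be negative but not zero, and gnomonic coordinates are still smooth there. -/
theorem re_ne_zero_of_mk_eq {C : Subgroup (Fin n → ℤˣ)} {g u : SU2Pow n}
    (h : (u : CodeQuotient C) = (g : CodeQuotient C)) (hu : ∀ i, 0 < (toQ (u i)).re) (i : Fin n) :
    (toQ (g i)).re ≠ 0 := by
  rw [QuotientGroup.eq] at h
  have h1 := codeSubgroup_apply h i
  simp only [Pi.mul_apply, Pi.inv_apply] at h1
  rcases h1 with h1 | h1
  · rw [inv_mul_eq_one] at h1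
    rw [← h1]
    exact (hu i).ne'
  · rw [inv_mul_eq_iff_eq_mul] at h1
    rw [h1, mul_neg, mul_one, toQ_neg, Quaternion.re_neg]
    exact neg_ne_zero.2 (hu i).ne'

noncomputable instance smoothLocalParam : SmoothLocalParam (CodeQuotient C) (SU2PowModel n) where
  φ := coordQuotient C
  S x := (paramPow x : SU2Pow n)
  S_zero := by
    rw [← QuotientGroup.mk_one]
    congr 1
    funext i
    rw [paramPow, map_zero, param_zero, Pi.one_apply]
  φ_S x := coordPow_paramPow x
  continuous_S := QuotientGroup.continuous_mk.comp continuous_paramPow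
  isOpen_range := by
    have h : Set.range (fun x : SU2PowModel n => (paramPow x : CodeQuotient C)) =
        (fun g : SU2Pow n => (g : CodeQuotient C)) '' Set.range paramPow := by
      rw [← Set.range_comp]; rfl
    rw [h]
    exact QuotientGroup.isOpenMap_coe _ isOpen_range_paramPow
  continuousOn_φ := by
    rintro _ ⟨x, rfl⟩
    refine ContinuousAt.continuousWithinAt ?_
    -- The projection is an open quotient map, so continuity may be tested on `SU(2) ^ n`.
    rw [← QuotientGroup.isOpenQuotientMap_mk.continuousAt_comp_iff]
    exact continuousAt_coordPow fun i => (toQ_param_re_pos _).ne'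
  contDiffAt_trans g x h := by
    obtain ⟨g, rfl⟩ := QuotientGroup.mk_surjective g
    obtain ⟨u, hu⟩ := h
    refine contDiffAt_symm (f := fun y i => gnomonic (toQ (g i * param (comp i y)))) fun i => ?_
    have h1 := re_ne_zero_of_mk_eq (g := g * paramPow x) hu (fun i => toQ_param_re_pos _) i
    simp only [gnomonic_mul_param]
    refine ContDiffAt.comp x (contDiffAt_gnomonic fun h2 => h1 ?_) ?_
    · rw [Pi.mul_apply, map_mul, paramPow, toQ_param, mul_smul_comm, Quaternion.re_smul, h2,
        smul_zero]
    · exact contDiffAt_const.mul (contDiffAt_const.add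
        ((imQ.comp (comp i)).contDiff.contDiffAt))
  contDiffAt_mul g := by
    obtain ⟨g, rfl⟩ := QuotientGroup.mk_surjective g
    refine contDiffAt_symm (f := fun (p : SU2PowModel n × SU2PowModel n) i =>
      gnomonic (toQ ((g i)⁻¹ * (param (comp i p.1) * (g i * param (comp i p.2)))))) fun i => ?_
    simp only [gnomonic_conj_param]
    refine ContDiffAt.comp (0, 0) (contDiffAt_gnomonic ?_) ?_
    · simp only [map_zero, add_zero, one_mul, mul_one, toQ_inv_mul_toQ]
      simp
    · exact contDiffAt_const.mul ((contDiffAt_const.add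
        ((imQ.comp (comp i)).contDiff.contDiffAt.comp _ contDiffAt_fst)).mul
        (contDiffAt_const.mul (contDiffAt_const.add
          ((imQ.comp (comp i)).contDiff.contDiffAt.comp _ contDiffAt_snd))))
  contDiffAt_inv g := by
    obtain ⟨g, rfl⟩ := QuotientGroup.mk_surjective g
    refine contDiffAt_symm (f := fun (x : SU2PowModel n) i =>
      gnomonic (toQ (g i * ((param (comp i x))⁻¹ * (g i)⁻¹)))) fun i => ?_
    simp only [gnomonic_conj_param_inv]
    refine ContDiffAt.comp 0 (contDiffAt_gnomonic ?_) ?_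
    · simp only [map_zero, sub_zero, one_mul, toQ_mul_toQ_inv]
      simp
    · exact contDiffAt_const.mul ((contDiffAt_const.sub
        ((imQ.comp (comp i)).contDiff.contDiffAt)).mul contDiffAt_const)

theorem coordQuotient_mul (x y : SU2PowModel n) :
    coordQuotient C ((paramPow x : CodeQuotient C) * (paramPow y : CodeQuotient C)) =
      (SU2PowModel.equiv n).symm fun i =>
        gnomonic ((1 + imQ (comp i x)) * (1 + imQ (comp i y))) := by
  rw [← QuotientGroup.mk_mul, coordQuotient_mk]
  refine SU2PowModel.ext fun i => ?_
  rw [coordPow, comp_symm, comp_symm, Pi.mul_apply, paramPow, paramPow, gnomonic_mul_param,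
    toQ_param, smul_mul_assoc,
    gnomonic_smul (inv_ne_zero (norm_ne_zero_iff.2 (one_add_imQ_ne_zero _)))]

theorem invariantField_eq (v x : SU2PowModel n) :
    SmoothLocalParam.invariantField (CodeQuotient C) v x =
      (SU2PowModel.equiv n).symm fun i => leftField (comp i v) (comp i x) := by
  choose L hL hd using fun i => hasFDerivAt_gnomonic_mul (comp i x)
  have h1 : HasFDerivAt (fun y : SU2PowModel n =>
      coordQuotient C ((paramPow x : CodeQuotient C) * (paramPow y : CodeQuotient C)))
      ((SU2PowModel.equiv n).symm.toContinuousLinearMap.comp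
        (ContinuousLinearMap.pi fun i => (L i).comp (comp i))) 0 := by
    simp only [coordQuotient_mul]
    refine (SU2PowModel.equiv n).symm.toContinuousLinearMap.hasFDerivAt.comp _
      (hasFDerivAt_pi.2 fun i => ?_)
    refine HasFDerivAt.comp (g := fun y => gnomonic ((1 + imQ (comp i x)) * (1 + imQ y))) _ ?_
      (comp i).hasFDerivAt
    rw [map_zero]
    exact hd i
  rw [SmoothLocalParam.invariantField]
  refine (DFunLike.congr_fun h1.fderiv v).trans ?_
  refine SU2PowModel.ext fun i => ?_
  simp [comp_symm, hL]

theorem fderiv_invariantField (v w : SU2PowModel n) (i : Fin n) :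
    comp i (fderiv ℝ (SmoothLocalParam.invariantField (CodeQuotient C) v) 0 w) =
      compQ (imQ (comp i w) * imQ (comp i v)) := by
  choose L hL hd using fun i => hasFDerivAt_leftField (comp i v)
  have h1 : HasFDerivAt (SmoothLocalParam.invariantField (CodeQuotient C) v)
      ((SU2PowModel.equiv n).symm.toContinuousLinearMap.comp
        (ContinuousLinearMap.pi fun i => (L i).comp (comp i))) 0 := by
    rw [funext (invariantField_eq C v)]
    refine (SU2PowModel.equiv n).symm.toContinuousLinearMap.hasFDerivAt.comp _
      (hasFDerivAt_pi.2 fun i => ?_)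
    refine HasFDerivAt.comp (g := leftField (comp i v)) _ ?_ (comp i).hasFDerivAt
    rw [map_zero]
    exact hd i
  rw [h1.fderiv]
  simp [comp_symm, hL]

attribute [local instance] SmoothLocalParam.chartedSpace

theorem comp_bracket (v w : SU2PowModel n) (i : Fin n) :
    comp i (Bracket.bracket (L := GroupLieAlgebra 𝓘(ℝ, SU2PowModel n) (CodeQuotient C))
      (M := GroupLieAlgebra 𝓘(ℝ, SU2PowModel n) (CodeQuotient C)) v w : SU2PowModel n) =
      compQ (imQ (comp i v) * imQ (comp i w)) - compQ (imQ (comp i w) * imQ (comp i v)) := by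
  have h0 : ∀ v : SU2PowModel n, SmoothLocalParam.invariantField (CodeQuotient C) v 0 = v := by
    intro v
    rw [invariantField_eq]
    refine SU2PowModel.ext fun i => ?_
    rw [comp_symm, map_zero, leftField_zero]
  rw [SmoothLocalParam.bracket_eq, VectorField.lieBracket, map_sub, fderiv_invariantField,
    fderiv_invariantField, h0, h0]

/-- The quotient of `SU(2) ^ n` by a group of signs is a compact semisimple Lie group. -/
theorem isCompactSemisimpleLieGroup_codeQuotient :
    IsCompactSemisimpleLieGroup (CodeQuotient C) where
  compactSpace := inferInstance
  connectedSpace := QuotientGroup.mk_surjective.connectedSpace QuotientGroup.continuous_mk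
  t2Space := by
    have := finite_codeSubgroup C
    have : IsClosed (codeSubgroup C : Set (SU2Pow n)) :=
      (Set.toFinite (codeSubgroup C : Set (SU2Pow n))).isClosed
    infer_instance
  exists_lieGroup := by
    have h1 : LieGroup (𝓡 (n * 3)) ∞ (CodeQuotient C) := SmoothLocalParam.lieGroup
    have h2 : LieGroup (𝓡 (n * 3)) (minSmoothness ℝ 3) (CodeQuotient C) := by
      rw [minSmoothness_of_isRCLikeNormedField]
      exact LieGroup.of_le (n := ∞) ENat.LEInfty.out
    refine ⟨n * 3, SmoothLocalParam.chartedSpace _ _, h2, h1, ?_⟩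
    -- For `v` in an abelian ideal, `⁅v, w⁆` is in it too and `⁅v, ⁅v, w⁆⁆ = 0` for all `w`; with
    -- `w` supported in factor `i` this kills component `i` of `v`.
    rw [LieAlgebra.hasTrivialRadical_iff_no_abelian_ideals]
    intro I hI
    rw [LieSubmodule.eq_bot_iff]
    intro v hv
    refine SU2PowModel.ext fun i => ?_
    refine (eq_zero_of_double_bracket fun w => ?_).trans (map_zero (comp i)).symm
    let w' : GroupLieAlgebra (𝓡 (n * 3)) (CodeQuotient C) :=
      (SU2PowModel.equiv n).symm (Pi.single i w)
    have hw' : comp i w' = w := by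
      simp [w', comp_symm]
    have h3 : ⁅v, w'⁆ ∈ I := lie_mem_left ℝ _ I v w' hv
    have h4 : ⁅v, ⁅v, w'⁆⁆ = 0 := by
      have := LieModule.IsTrivial.trivial (⟨v, hv⟩ : I) (⟨⁅v, w'⁆, h3⟩ : I)
      exact congrArg Subtype.val this
    refine ⟨comp i (⁅v, w'⁆ : GroupLieAlgebra (𝓡 (n * 3)) (CodeQuotient C)), ?_, ?_⟩
    · rw [← hw']
      exact comp_bracket C v w' i
    · refine (comp_bracket C v _ i).symm.trans ?_
      exact (congrArg (comp i) h4).trans (map_zero _)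

end

/-! ### One-parameter subgroups of Banach algebras -/

section

open Filter

/-- Telescoping. As `1 ≤ M`, the exponent `k` in place of `k - 1` costs nothing that matters. -/
theorem norm_pow_sub_pow_le {A : Type*} [NormedRing A] [NormOneClass A] {x y : A} {M : ℝ} (hM : 1 ≤ M) (hx : ‖x‖ ≤ M)
    (hy : ‖y‖ ≤ M) (k : ℕ) : ‖x ^ k - y ^ k‖ ≤ k * ‖x - y‖ * M ^ k := by
  induction k with
  | zero => simp
  | succ k ih =>
    have hM0 : 0 ≤ M := zero_le_one.trans hM
    have e : x ^ (k + 1) - y ^ (k + 1) = x ^ k * (x - y) + (x ^ k - y ^ k) * y := by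
      rw [pow_succ, pow_succ]; noncomm_ring
    have h1 : ‖x ^ k * (x - y)‖ ≤ M ^ (k + 1) * ‖x - y‖ := by
      refine (norm_mul_le _ _).trans (mul_le_mul_of_nonneg_right ?_ (norm_nonneg _))
      exact (norm_pow_le _ _).trans ((pow_le_pow_left₀ (norm_nonneg _) hx k).trans
        (pow_le_pow_right₀ hM (Nat.le_succ k)))
    have h2 : ‖(x ^ k - y ^ k) * y‖ ≤ k * ‖x - y‖ * M ^ k * M :=
      (norm_mul_le _ _).trans (mul_le_mul ih hy (norm_nonneg _) (by positivity))
    rw [e]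
    refine (norm_add_le _ _).trans ((add_le_add h1 h2).trans_eq ?_)
    push_cast
    ring

/-- One-parameter subgroups of a monoid. -/
structure IsOneParam {M : Type*} [Monoid M] (F : ℝ → M) : Prop where
  map_zero : F 0 = 1
  map_add : ∀ s t, F (s + t) = F s * F t

namespace IsOneParam

section Monoid

variable {M N : Type*} [Monoid M] [Monoid N] {F : ℝ → M}

theorem map_nsmul (hF : IsOneParam F) (k : ℕ) (t : ℝ) : F (k * t) = F t ^ k := by
  induction k with
  | zero => simp [hF.map_zero]
  | succ k ih => rw [Nat.cast_succ, add_mul, one_mul, hF.map_add, ih, pow_succ]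

theorem mul_neg (hF : IsOneParam F) (t : ℝ) : F t * F (-t) = 1 := by
  rw [← hF.map_add, add_neg_cancel, hF.map_zero]

theorem monoidHom_comp (hF : IsOneParam F) (f : M →* N) : IsOneParam fun t => f (F t) where
  map_zero := by rw [hF.map_zero, map_one]
  map_add s t := by rw [hF.map_add, map_mul]

end Monoid

variable {A : Type*} [NormedRing A] [NormedAlgebra ℝ A] {F G : ℝ → A} {a b : A}

theorem exp [CompleteSpace A] (a : A) : IsOneParam fun t : ℝ => NormedSpace.exp (t • a) where
  map_zero := by simp
  map_add s t := by
    let _ : NormedAlgebra ℚ A := NormedAlgebra.restrictScalars ℚ ℝ A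
    rw [add_smul, NormedSpace.exp_add_of_commute]
    exact ((Commute.refl a).smul_left s).smul_right t

/-- A continuous one-parameter subgroup of a Banach algebra is differentiable. -/
theorem exists_hasDerivAt [CompleteSpace A] (hF : IsOneParam F) (hc : Continuous F) :
    ∃ a, HasDerivAt F a 0 := by
  have hint : ∀ x y, IntervalIntegrable F MeasureTheory.volume x y := fun x y =>
    hc.intervalIntegrable x y
  -- The mean of `F` over a short interval is close to `1`, hence invertible, and `F t * ∫₀ʰ F` is
  -- the integral of `F` from `t` to `t + h`. Dividing expresses `F` through its differentiable
  -- primitive.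
  let Φ : ℝ → A := fun x => ∫ s in (0 : ℝ)..x, F s
  have hΦ : ∀ x, HasDerivAt Φ (F x) x := fun x =>
    intervalIntegral.integral_hasDerivAt_right (hint 0 x) (hc.stronglyMeasurableAtFilter _ _)
      hc.continuousAt
  have h1 : Tendsto (fun h : ℝ => h⁻¹ • (Φ (0 + h) - Φ 0)) (𝓝[≠] 0) (𝓝 1) := by
    have := (hΦ 0).tendsto_slope_zero
    rwa [hF.map_zero] at this
  have h2 : ∀ᶠ h in 𝓝[≠] (0 : ℝ), IsUnit (h⁻¹ • (Φ (0 + h) - Φ 0)) :=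
    h1.eventually (Units.isOpen.mem_nhds isUnit_one)
  obtain ⟨h, hu, hh⟩ := (h2.and self_mem_nhdsWithin).exists
  have h3 : ∀ t, F t * Φ h = Φ (t + h) - Φ t := by
    intro t
    have e1 : F t * Φ h = ∫ s in (0 : ℝ)..h, F t * F s := by
      simp only [Φ]
      rw [← ContinuousLinearMap.mul_apply' ℝ A (F t),
        ← ContinuousLinearMap.intervalIntegral_comp_comm _ (hint 0 h)]
      rfl
    have e2 : (∫ s in (0 : ℝ)..h, F t * F s) = ∫ s in (0 : ℝ)..h, F (t + s) := by
      simp only [hF.map_add]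
    rw [e1, e2, intervalIntegral.integral_comp_add_left F t, add_zero,
      ← intervalIntegral.integral_interval_sub_left (hint 0 (t + h)) (hint 0 t)]
  obtain ⟨u, hu⟩ := hu
  rw [zero_add] at hu
  have h0 : Φ 0 = 0 := by simp [Φ]
  have h4 : ∀ t, F t = h⁻¹ • ((Φ (t + h) - Φ t) * (u⁻¹ : Aˣ)) := by
    intro t
    rw [← h3, mul_assoc, ← mul_smul_comm, ← smul_mul_assoc, ← sub_zero (Φ h), ← h0, ← hu,
      Units.mul_inv, mul_one]
  refine ⟨h⁻¹ • ((F (0 + h) - F 0) * (u⁻¹ : Aˣ)), ?_⟩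
  refine HasDerivAt.congr_of_eventuallyEq ?_ (Eventually.of_forall h4)
  have h5 : HasDerivAt (fun t => Φ (t + h)) (F (0 + h)) 0 := (hΦ (0 + h)).comp_add_const 0 h
  exact ((h5.sub (hΦ 0)).mul_const ((u⁻¹ : Aˣ) : A)).const_smul h⁻¹

theorem tendsto_nsmul_sub_one (hF : IsOneParam F) (ha : HasDerivAt F a 0) (t : ℝ) {N : ℕ → ℕ}
    (hN : Tendsto N atTop atTop) :
    Tendsto (fun k => (N k : ℝ) • (F (t / N k) - 1)) atTop (𝓝 (t • a)) := by
  have h0 : HasDerivAt (fun s => F (t * s)) (t • a) 0 := by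
    have hlin : HasDerivAt (fun s : ℝ => t * s) t 0 := by
      simpa using (hasDerivAt_id (0 : ℝ)).const_mul t
    have ha' : HasDerivAt F a (t * 0) := by rwa [mul_zero]
    exact ha'.scomp (0 : ℝ) hlin
  have h1 := h0.tendsto_slope_zero
  have h2 : Tendsto (fun k => ((N k : ℝ))⁻¹) atTop (𝓝[≠] 0) := by
    have : Tendsto (fun x : ℝ => x⁻¹) atTop (𝓝[≠] 0) :=
      tendsto_inv_atTop_nhdsGT_zero.mono_right (nhdsWithin_mono _ fun x hx => ne_of_gt hx)
    exact this.comp (tendsto_natCast_atTop_atTop.comp hN)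
  refine (h1.comp h2).congr fun k => ?_
  simp [hF.map_zero, div_eq_mul_inv]

/-- Powers of elements close to the identity converge to the one-parameter subgroup with the
corresponding derivative. -/
theorem tendsto_pow [NormOneClass A] (hF : IsOneParam F) (ha : HasDerivAt F a 0) (t : ℝ)
    {N : ℕ → ℕ} (hN : Tendsto N atTop atTop) {c : ℕ → A}
    (hc : Tendsto (fun k => (N k : ℝ) • (c k - 1)) atTop (𝓝 (t • a))) :
    Tendsto (fun k => c k ^ N k) atTop (𝓝 (F t)) := by
  have hd := hF.tendsto_nsmul_sub_one ha t hN
  have hpos : ∀ᶠ k in atTop, 0 < N k := hN.eventually_gt_atTop 0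
  -- Eventually `c k` and `F (t / N k)` both have norm at most `1 + K / N k`, so powers up to `N k`
  -- stay below `exp K`, and the telescoping bound leaves a factor tending to zero.
  set K : ℝ := ‖t • a‖ + 1 with hK
  have hKpos : 0 ≤ K := by positivity
  have hcb : ∀ᶠ k in atTop, ‖(N k : ℝ) • (c k - 1)‖ ≤ K :=
    (hc.norm.eventually_lt_const (by linarith : ‖t • a‖ < K)).mono fun _ h => h.le
  have hdb : ∀ᶠ k in atTop, ‖(N k : ℝ) • (F (t / N k) - 1)‖ ≤ K :=
    (hd.norm.eventually_lt_const (by linarith : ‖t • a‖ < K)).mono fun _ h => h.le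
  have bound : ∀ {x : A} {m : ℕ}, 0 < m → ‖(m : ℝ) • (x - 1)‖ ≤ K → ‖x‖ ≤ 1 + K / m := by
    intro x m hm hx
    have hm' : (0 : ℝ) < m := Nat.cast_pos.2 hm
    rw [norm_smul, Real.norm_of_nonneg hm'.le] at hx
    have h1 : ‖x - 1‖ ≤ K / m := by rwa [le_div_iff₀ hm', mul_comm]
    calc ‖x‖ = ‖1 + (x - 1)‖ := by congr 1; abel
      _ ≤ ‖(1 : A)‖ + ‖x - 1‖ := norm_add_le _ _
      _ ≤ 1 + K / m := by rw [norm_one]; linarith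
  have hdiff : Tendsto (fun k => ‖(N k : ℝ) • (c k - 1) - (N k : ℝ) • (F (t / N k) - 1)‖ *
      Real.exp K) atTop (𝓝 0) := by
    have := ((hc.sub hd).norm).mul_const (Real.exp K)
    simpa using this
  rw [tendsto_iff_norm_sub_tendsto_zero]
  refine squeeze_zero' (Eventually.of_forall fun k => norm_nonneg _) ?_ hdiff
  filter_upwards [hpos, hcb, hdb] with k h1 h2 h3
  have hm' : (0 : ℝ) < N k := Nat.cast_pos.2 h1
  have e1 : F t = F (t / N k) ^ N k := by
    rw [← hF.map_nsmul, mul_div_cancel₀ _ hm'.ne']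
  have h4 : 1 ≤ 1 + K / N k := by
    have : 0 ≤ K / N k := by positivity
    linarith
  rw [e1]
  refine (norm_pow_sub_pow_le h4 (bound h1 h2) (bound h1 h3) (N k)).trans ?_
  have e2 : ‖(N k : ℝ) • (c k - 1) - (N k : ℝ) • (F (t / N k) - 1)‖ =
      N k * ‖c k - F (t / N k)‖ := by
    rw [← smul_sub, norm_smul, Real.norm_of_nonneg hm'.le, sub_sub_sub_cancel_right]
  rw [e2]
  refine mul_le_mul_of_nonneg_left ?_ (by positivity)
  calc (1 + K / N k) ^ N k ≤ Real.exp (K / N k) ^ N k :=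
        pow_le_pow_left₀ (by linarith) (by rw [add_comm]; exact Real.add_one_le_exp _) _
    _ = Real.exp K := by rw [← Real.exp_nat_mul, mul_div_cancel₀ _ hm'.ne']

theorem tendsto_one_add_pow [NormOneClass A] (hF : IsOneParam F) (ha : HasDerivAt F a 0) (t : ℝ) :
    Tendsto (fun k : ℕ => (1 + (t / k) • a) ^ k) atTop (𝓝 (F t)) := by
  refine hF.tendsto_pow ha t tendsto_id (tendsto_const_nhds.congr' ?_)
  filter_upwards [eventually_gt_atTop 0] with k hk
  have hm' : (0 : ℝ) < k := Nat.cast_pos.2 hk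
  simp only [id, add_sub_cancel_left, smul_smul]
  rw [mul_div_cancel₀ _ hm'.ne']

/-- With `f = F (s / k)` and `g = G (s / k)`, the group commutator minus one is `(f * g - g * f) *
f⁻¹ * g⁻¹`. The first factor is also the ring commutator of `f - 1` and `g - 1`, each of which has a
limit when multiplied by `k`. -/
theorem tendsto_commutator (hF : IsOneParam F) (hG : IsOneParam G) (ha : HasDerivAt F a 0)
    (hb : HasDerivAt G b 0) (s : ℝ) :
    Tendsto (fun k : ℕ => ((k ^ 2 : ℕ) : ℝ) •
      (F (s / k) * G (s / k) * F (-(s / k)) * G (-(s / k)) - 1)) atTop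
      (𝓝 (s ^ 2 • (a * b - b * a))) := by
  have h1 := hF.tendsto_nsmul_sub_one ha s tendsto_id
  have h2 := hG.tendsto_nsmul_sub_one hb s tendsto_id
  have h0 : Tendsto (fun k : ℕ => -(s / k)) atTop (𝓝 0) := by
    simpa using (tendsto_const_div_atTop_nhds_zero_nat s).neg
  have h3 := (ha.continuousAt.tendsto.comp h0)
  have h4 := (hb.continuousAt.tendsto.comp h0)
  rw [hF.map_zero] at h3
  rw [hG.map_zero] at h4
  have h5 := (((h1.mul h2).sub (h2.mul h1)).mul h3).mul h4
  have e : ((s • a) * (s • b) - (s • b) * (s • a)) * 1 * 1 = s ^ 2 • (a * b - b * a) := by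
    simp only [mul_one, smul_mul_assoc, mul_smul_comm, smul_sub, smul_smul, sq]
  rw [e] at h5
  refine h5.congr fun k => ?_
  have hFk := hF.mul_neg (s / k)
  have hGk := hG.mul_neg (s / k)
  simp only [Function.comp_apply, id]
  set f := F (s / k)
  set f' := F (-(s / k))
  set g := G (s / k)
  set g' := G (-(s / k))
  have e1 : f * g * f' * g' - 1 = (f * g - g * f) * f' * g' := by
    rw [sub_mul, sub_mul]
    congr 1
    rw [mul_assoc g f f', hFk, mul_one, hGk]
  have e2 : (f - 1) * (g - 1) - (g - 1) * (f - 1) = f * g - g * f := by noncomm_ring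
  rw [e1, ← e2]
  simp only [smul_mul_assoc, mul_smul_comm, smul_smul, ← smul_sub]
  push_cast
  rw [sq]

end IsOneParam

/-- A continuous homomorphism respects the commutators of the derivatives of one-parameter
subgroups. -/
theorem hasDerivAt_commutator {Γ A B : Type*} [Group Γ] [TopologicalSpace Γ] [NormedRing A]
    [NormedAlgebra ℝ A] [CompleteSpace A] [NormOneClass A] [NormedRing B] [NormedAlgebra ℝ B]
    [NormOneClass B] (P : Γ →* B) (hP : Topology.IsInducing P) (R : Γ →* A) (hR : Continuous R)
    {x y z : ℝ → Γ} (hx : IsOneParam x) (hy : IsOneParam y) (hz : IsOneParam z) {a b : B}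
    (ha : HasDerivAt (fun t => P (x t)) a 0) (hb : HasDerivAt (fun t => P (y t)) b 0)
    (hc : HasDerivAt (fun t => P (z t)) (a * b - b * a) 0) {a' b' c' : A}
    (ha' : HasDerivAt (fun t => R (x t)) a' 0) (hb' : HasDerivAt (fun t => R (y t)) b' 0)
    (hc' : HasDerivAt (fun t => R (z t)) c' 0) :
    c' = a' * b' - b' * a' := by
  have hN : Tendsto (fun k : ℕ => k ^ 2) atTop atTop := tendsto_pow_atTop two_ne_zero
  -- The `k ^ 2`-th power of the commutator at parameter `s / k` converges to `z (s ^ 2)`, which is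
  -- seen through the inducing map `P`. Its image under `R` converges to the exponential of the
  -- commutator.
  have key : ∀ s : ℝ, R (z (s ^ 2)) = NormedSpace.exp (s ^ 2 • (a' * b' - b' * a')) := by
    intro s
    let w : ℕ → Γ := fun k => x (s / k) * y (s / k) * x (-(s / k)) * y (-(s / k))
    have h1 : Tendsto (fun k => w k ^ (k ^ 2)) atTop (𝓝 (z (s ^ 2))) := by
      rw [hP.tendsto_nhds_iff]
      have := (hz.monoidHom_comp P).tendsto_pow hc (s ^ 2) hN
        ((hx.monoidHom_comp P).tendsto_commutator (hy.monoidHom_comp P) ha hb s)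
      simpa only [Function.comp_def, map_pow, map_mul, w] using this
    have h2 := (hR.tendsto _).comp h1
    have h3 := (IsOneParam.exp (a' * b' - b' * a')).tendsto_pow
      (by simpa using hasDerivAt_exp_smul_const (𝕂 := ℝ) (a' * b' - b' * a') 0) (s ^ 2) hN
      ((hx.monoidHom_comp R).tendsto_commutator (hy.monoidHom_comp R) ha' hb' s)
    refine tendsto_nhds_unique h2 ?_
    simpa only [Function.comp_def, map_pow, map_mul, w] using h3
  have h4 : HasDerivAt (fun t : ℝ => NormedSpace.exp (t • (a' * b' - b' * a')))
      (a' * b' - b' * a') 0 := by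
    simpa using hasDerivAt_exp_smul_const (𝕂 := ℝ) (a' * b' - b' * a') 0
  -- Squares reach only `t ≥ 0`, so one-sided derivatives are compared.
  have hu : UniqueDiffWithinAt ℝ (Set.Ici (0 : ℝ)) 0 := uniqueDiffOn_Ici 0 0 Set.self_mem_Ici
  refine hu.eq_deriv _ hc'.hasDerivWithinAt (h4.hasDerivWithinAt.congr (fun t ht => ?_) ?_)
  · have := key (√t)
    rwa [Real.sq_sqrt ht] at this
  · simpa using key 0

end

/-! ### Generators of SU(2) and their images -/

section

open Filter

namespace SU2

/-- The quaternions `i`, `j` and `k`. -/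
noncomputable def unitIm : Fin 3 → ℍ[ℝ] := ![quat 0 1 0 0, quat 0 0 1 0, quat 0 0 0 1]

theorem unitIm_mul_self (k : Fin 3) : unitIm k * unitIm k = -1 := by
  fin_cases k <;> ext <;> simp [unitIm]

theorem normSq_cos_add_sin (k : Fin 3) (t : ℝ) :
    ‖Real.cos t • (1 : ℍ[ℝ]) + Real.sin t • unitIm k‖ = 1 := by
  rw [← sq_eq_sq₀ (norm_nonneg _) zero_le_one, sq, ← Quaternion.normSq_eq_norm_mul_self,
    Quaternion.normSq_def']
  fin_cases k <;> simp [unitIm]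

/-- The one-parameter subgroups of `SU(2)` generated by `i`, `j` and `k`. -/
noncomputable def rot (k : Fin 3) (t : ℝ) : SU2 :=
  ofQ ⟨Real.cos t • (1 : ℍ[ℝ]) + Real.sin t • unitIm k, by
    rw [mem_sphere_zero_iff_norm, normSq_cos_add_sin]⟩

theorem toQ_rot (k : Fin 3) (t : ℝ) :
    toQ (rot k t) = Real.cos t • (1 : ℍ[ℝ]) + Real.sin t • unitIm k := toQ_ofQ _

theorem isOneParam_rot (k : Fin 3) : IsOneParam (rot k) where
  map_zero := toQ_injective (by rw [toQ_rot]; simp)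
  map_add s t := toQ_injective (by
    rw [map_mul, toQ_rot, toQ_rot, toQ_rot, Real.cos_add, Real.sin_add]
    have h : ∀ a b c d : ℝ, (a • (1 : ℍ[ℝ]) + b • unitIm k) * (c • (1 : ℍ[ℝ]) + d • unitIm k) =
        (a * c - b * d) • (1 : ℍ[ℝ]) + (b * c + a * d) • unitIm k := by
      intro a b c d
      simp only [add_mul, mul_add, smul_mul_assoc, mul_smul_comm, one_mul, mul_one,
        unitIm_mul_self]
      module
    rw [h])

theorem continuous_rot (k : Fin 3) : Continuous (rot k) := by
  rw [isInducing_toQ.continuous_iff]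
  have h : toQ ∘ rot k = fun t => Real.cos t • (1 : ℍ[ℝ]) + Real.sin t • unitIm k :=
    funext (toQ_rot k)
  rw [h]
  exact (Real.continuous_cos.smul continuous_const).add (Real.continuous_sin.smul continuous_const)

theorem hasDerivAt_toQ_rot (k : Fin 3) : HasDerivAt (fun t => toQ (rot k t)) (unitIm k) 0 := by
  simp only [toQ_rot]
  have h := ((Real.hasDerivAt_cos 0).smul_const (1 : ℍ[ℝ])).add
    ((Real.hasDerivAt_sin 0).smul_const (unitIm k))
  have e : -Real.sin 0 • (1 : ℍ[ℝ]) + Real.cos 0 • unitIm k = unitIm k := by simp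
  rw [e] at h
  exact h

theorem unitIm_commutator (k : Fin 3) :
    unitIm k * unitIm (k + 1) - unitIm (k + 1) * unitIm k = (2 : ℝ) • unitIm (k + 2) := by
  fin_cases k <;> ext <;> simp [unitIm] <;> norm_num

/-- Euler angles. -/
theorem exists_rot_mul_rot_mul_rot (g : SU2) :
    ∃ α β γ : ℝ, g = rot 0 α * rot 1 β * rot 0 γ := by
  let z : ℂ := ⟨(toQ g).re, (toQ g).imI⟩
  let w : ℂ := ⟨(toQ g).imJ, (toQ g).imK⟩
  have hzw : ‖z‖ ^ 2 + ‖w‖ ^ 2 = 1 := by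
    have := normSq_toQ g
    rw [Quaternion.normSq_def'] at this
    rw [← Complex.normSq_eq_norm_sq, ← Complex.normSq_eq_norm_sq, Complex.normSq_apply,
      Complex.normSq_apply]
    simp only [z, w]
    linarith
  obtain ⟨β, hβz, hβw⟩ : ∃ β, Real.cos β = ‖z‖ ∧ Real.sin β = ‖w‖ := by
    refine ⟨Real.arccos ‖z‖, Real.cos_arccos (by linarith [norm_nonneg z]) ?_, ?_⟩
    · nlinarith [sq_nonneg ‖w‖, norm_nonneg z]
    · rw [Real.sin_arccos, ← hzw, add_sub_cancel_left, Real.sqrt_sq (norm_nonneg w)]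
  -- As a quaternion `g = z + w j`, while the product of the three rotations is `cos β e^{i(α+γ)} +
  -- sin β e^{i(α-γ)} j`; so `α + γ` and `α - γ` must be the arguments of `z` and `w`.
  refine ⟨(z.arg + w.arg) / 2, β, (z.arg - w.arg) / 2, toQ_injective ?_⟩
  have c1 : Real.cos z.arg = Real.cos ((z.arg + w.arg) / 2) * Real.cos ((z.arg - w.arg) / 2) -
      Real.sin ((z.arg + w.arg) / 2) * Real.sin ((z.arg - w.arg) / 2) := by
    rw [← Real.cos_add]; congr 1; ring
  have s1 : Real.sin z.arg = Real.sin ((z.arg + w.arg) / 2) * Real.cos ((z.arg - w.arg) / 2) +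
      Real.cos ((z.arg + w.arg) / 2) * Real.sin ((z.arg - w.arg) / 2) := by
    rw [← Real.sin_add]; congr 1; ring
  have c2 : Real.cos w.arg = Real.cos ((z.arg + w.arg) / 2) * Real.cos ((z.arg - w.arg) / 2) +
      Real.sin ((z.arg + w.arg) / 2) * Real.sin ((z.arg - w.arg) / 2) := by
    rw [← Real.cos_sub]; congr 1; ring
  have s2 : Real.sin w.arg = Real.sin ((z.arg + w.arg) / 2) * Real.cos ((z.arg - w.arg) / 2) -
      Real.cos ((z.arg + w.arg) / 2) * Real.sin ((z.arg - w.arg) / 2) := by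
    rw [← Real.sin_sub]; congr 1; ring
  have r1 : (toQ g).re = ‖z‖ * Real.cos z.arg := (Complex.norm_mul_cos_arg z).symm
  have r2 : (toQ g).imI = ‖z‖ * Real.sin z.arg := (Complex.norm_mul_sin_arg z).symm
  have r3 : (toQ g).imJ = ‖w‖ * Real.cos w.arg := (Complex.norm_mul_cos_arg w).symm
  have r4 : (toQ g).imK = ‖w‖ * Real.sin w.arg := (Complex.norm_mul_sin_arg w).symm
  rw [c1, ← hβz] at r1
  rw [s1, ← hβz] at r2
  rw [c2, ← hβw] at r3
  rw [s2, ← hβw] at r4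
  rw [map_mul, map_mul, toQ_rot, toQ_rot, toQ_rot]
  ext
  · rw [r1]; simp [unitIm]; ring
  · rw [r2]; simp [unitIm]; ring
  · rw [r3]; simp [unitIm]; ring
  · rw [r4]; simp [unitIm]; ring

theorem isOneParam_map_rot {M : Type*} [Monoid M] (R : SU2 →* M) (k : Fin 3) : IsOneParam fun t => R (rot k t) :=
  (isOneParam_rot k).monoidHom_comp R

theorem hasDerivAt_comp_two_mul {B : Type*} [NormedAddCommGroup B] [NormedSpace ℝ B] {F : ℝ → B}
    {b : B} (hF : HasDerivAt F b 0) : HasDerivAt (fun t => F (2 * t)) ((2 : ℝ) • b) 0 := by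
  have hlin : HasDerivAt (fun s : ℝ => 2 * s) 2 0 := by
    simpa using (hasDerivAt_id (0 : ℝ)).const_mul 2
  have hF' : HasDerivAt F b (2 * 0) := by rwa [mul_zero]
  exact hF'.scomp (0 : ℝ) hlin

section Generator

variable {A : Type*} [NormedRing A] [NormedAlgebra ℝ A] [CompleteSpace A]

/-- The derivative at `0` of a homomorphism along the one-parameter subgroups `rot k`. -/
noncomputable def generator (R : SU2 →* A) (k : Fin 3) : A := deriv (fun t => R (rot k t)) 0

theorem hasDerivAt_generator {R : SU2 →* A} (hR : Continuous R) (k : Fin 3) :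
    HasDerivAt (fun t => R (rot k t)) (generator R k) 0 := by
  obtain ⟨a, ha⟩ := (isOneParam_map_rot R k).exists_hasDerivAt (hR.comp (continuous_rot k))
  exact ha.differentiableAt.hasDerivAt

/-- The quaternion relation `[i, j] = 2k` is transported by `hasDerivAt_commutator`; the factor 2 is
absorbed by running the third one-parameter subgroup at double speed. -/
theorem generator_commutator [NormOneClass A] {R : SU2 →* A} (hR : Continuous R) (k : Fin 3) :
    generator R k * generator R (k + 1) - generator R (k + 1) * generator R k =
      (2 : ℝ) • generator R (k + 2) := by
  have hz : IsOneParam fun t => rot (k + 2) (2 * t) :=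
    ⟨by rw [mul_zero, (isOneParam_rot _).map_zero],
      fun s t => by rw [mul_add, (isOneParam_rot _).map_add]⟩
  refine (hasDerivAt_commutator toQ isInducing_toQ R hR (isOneParam_rot k)
    (isOneParam_rot (k + 1)) hz (hasDerivAt_toQ_rot _) (hasDerivAt_toQ_rot _) ?_
    (hasDerivAt_generator hR _) (hasDerivAt_generator hR _) ?_).symm
  · rw [unitIm_commutator]
    exact hasDerivAt_comp_two_mul (hasDerivAt_toQ_rot _)
  · exact hasDerivAt_comp_two_mul (F := fun t => R (rot (k + 2) t)) (hasDerivAt_generator hR _)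

theorem commute_generator {R : SU2 →* A} (hR : Continuous R) {c : A}
    (hc : ∀ g, Commute c (R g)) (k : Fin 3) : Commute c (generator R k) := by
  have h := hasDerivAt_generator hR k
  have h1 := h.const_mul c
  have h2 := h.mul_const c
  have e : (fun t => c * R (rot k t)) = fun t => R (rot k t) * c := funext fun t => hc _
  rw [e] at h1
  exact h1.unique h2

end Generator

end SU2

end

/-! ### Commuting sl₂-triples and highest weights -/

/-- A family of pairwise commuting `sl₂`-triples of endomorphisms of a complex vector space. -/
structure Sl2Family (n : ℕ) (V : Type*) [AddCommGroup V] [Module ℂ V] where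
  H : Fin n → Module.End ℂ V
  E : Fin n → Module.End ℂ V
  F : Fin n → Module.End ℂ V
  commutator_H_E : ∀ i, H i * E i - E i * H i = (2 : ℂ) • E i
  commutator_H_F : ∀ i, H i * F i - F i * H i = -((2 : ℂ) • F i)
  commutator_E_F : ∀ i, E i * F i - F i * E i = H i
  commute_H_H : ∀ i j, i ≠ j → Commute (H i) (H j)
  commute_H_E : ∀ i j, i ≠ j → Commute (H i) (E j)
  commute_H_F : ∀ i j, i ≠ j → Commute (H i) (F j)
  commute_E_F : ∀ i j, i ≠ j → Commute (E i) (F j)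

namespace Sl2Family

variable {n : ℕ} {V W : Type*} [AddCommGroup V] [Module ℂ V] [AddCommGroup W] [Module ℂ W]
  (S : Sl2Family n V) (T : Sl2Family n W)

/-- Submodules which are stable under a family of `sl₂`-triples. -/
structure IsStable (U : Submodule ℂ V) : Prop where
  H_mem : ∀ i, ∀ u ∈ U, S.H i u ∈ U
  E_mem : ∀ i, ∀ u ∈ U, S.E i u ∈ U
  F_mem : ∀ i, ∀ u ∈ U, S.F i u ∈ U

/-- Vectors of weight `μ` which are annihilated by the raising operators. -/
structure IsHighestWeight (μ : Fin n → ℂ) (v : V) : Prop where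
  H_apply : ∀ i, S.H i v = μ i • v
  E_apply : ∀ i, S.E i v = 0

/-- The sum of the diagonal operators. -/
def Hsum : Module.End ℂ V := ∑ i, S.H i

theorem H_apply_E_self (i : Fin n) (v : V) : S.H i (S.E i v) = S.E i (S.H i v) + (2 : ℂ) • S.E i v := by
  have := LinearMap.congr_fun (S.commutator_H_E i) v
  simp only [LinearMap.sub_apply, Module.End.mul_apply, LinearMap.smul_apply] at this
  rw [← this]; abel

theorem H_apply_F_self (i : Fin n) (v : V) : S.H i (S.F i v) = S.F i (S.H i v) - (2 : ℂ) • S.F i v := by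
  have := LinearMap.congr_fun (S.commutator_H_F i) v
  simp only [LinearMap.sub_apply, Module.End.mul_apply, LinearMap.neg_apply, LinearMap.smul_apply] at this
  rw [sub_eq_add_neg (S.F i (S.H i v)), ← this]; abel

theorem E_apply_F_self (i : Fin n) (v : V) : S.E i (S.F i v) = S.F i (S.E i v) + S.H i v := by
  have := LinearMap.congr_fun (S.commutator_E_F i) v
  simp only [LinearMap.sub_apply, Module.End.mul_apply] at this
  rw [← this]; abel

theorem H_apply_H (i j : Fin n) (v : V) : S.H i (S.H j v) = S.H j (S.H i v) := by
  rcases eq_or_ne i j with rfl | h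
  · rfl
  · exact LinearMap.congr_fun (S.commute_H_H i j h) v

theorem H_apply_E {i j : Fin n} (h : i ≠ j) (v : V) : S.H i (S.E j v) = S.E j (S.H i v) :=
  LinearMap.congr_fun (S.commute_H_E i j h) v

theorem H_apply_F {i j : Fin n} (h : i ≠ j) (v : V) : S.H i (S.F j v) = S.F j (S.H i v) :=
  LinearMap.congr_fun (S.commute_H_F i j h) v

theorem E_apply_F {i j : Fin n} (h : i ≠ j) (v : V) : S.E i (S.F j v) = S.F j (S.E i v) :=
  LinearMap.congr_fun (S.commute_E_F i j h) v

theorem Hsum_apply (v : V) : S.Hsum v = ∑ i, S.H i v := by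
  simp [Hsum]

theorem Hsum_apply_H (j : Fin n) (v : V) : S.Hsum (S.H j v) = S.H j (S.Hsum v) := by
  simp only [Hsum_apply, map_sum, S.H_apply_H _ j]

theorem Hsum_apply_E (j : Fin n) (v : V) :
    S.Hsum (S.E j v) = S.E j (S.Hsum v) + (2 : ℂ) • S.E j v := by
  rw [Hsum_apply, Hsum_apply, map_sum, ← Finset.add_sum_erase _ _ (Finset.mem_univ j),
    ← Finset.add_sum_erase _ (fun i => S.E j (S.H i v)) (Finset.mem_univ j), H_apply_E_self,
    Finset.sum_congr rfl fun i hi => S.H_apply_E (Finset.ne_of_mem_erase hi) v]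
  abel

theorem Hsum_apply_F (j : Fin n) (v : V) :
    S.Hsum (S.F j v) = S.F j (S.Hsum v) - (2 : ℂ) • S.F j v := by
  rw [Hsum_apply, Hsum_apply, map_sum, ← Finset.add_sum_erase _ _ (Finset.mem_univ j),
    ← Finset.add_sum_erase _ (fun i => S.F j (S.H i v)) (Finset.mem_univ j), H_apply_F_self,
    Finset.sum_congr rfl fun i hi => S.H_apply_F (Finset.ne_of_mem_erase hi) v]
  abel

/-- Each further `H j` preserves the joint eigenspace of the previous ones, where it has an
eigenvector. -/
theorem exists_common_eigenvector [FiniteDimensional ℂ V] {K : Submodule ℂ V} (hK : K ≠ ⊥)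
    (hst : ∀ i, ∀ v ∈ K, S.H i v ∈ K) (s : Finset (Fin n)) :
    ∃ μ : Fin n → ℂ, ∃ v ∈ K, v ≠ 0 ∧ ∀ i ∈ s, S.H i v = μ i • v := by
  induction s using Finset.induction_on with
  | empty =>
    obtain ⟨v, hv, hv0⟩ := Submodule.exists_mem_ne_zero_of_ne_bot hK
    exact ⟨0, v, hv, hv0, by simp⟩
  | insert j s hj ih =>
    obtain ⟨μ, v, hv, hv0, hs⟩ := ih
    let L : Submodule ℂ V := K ⊓ ⨅ i ∈ s, Module.End.eigenspace (S.H i) (μ i)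
    have hL : ∀ u, u ∈ L ↔ u ∈ K ∧ ∀ i ∈ s, S.H i u = μ i • u := by
      intro u
      simp [L, Submodule.mem_iInf]
    have hst' : ∀ u ∈ L, S.H j u ∈ L := by
      intro u hu
      rw [hL] at hu ⊢
      exact ⟨hst j u hu.1, fun i hi => by rw [S.H_apply_H, hu.2 i hi, map_smul]⟩
    have : Nontrivial L := ⟨⟨⟨v, (hL v).2 ⟨hv, hs⟩⟩, 0, fun h => hv0 (congrArg Subtype.val h)⟩⟩
    obtain ⟨ν, hν⟩ := Module.End.exists_eigenvalue ((S.H j).restrict hst')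
    obtain ⟨u, hu⟩ := hν.exists_hasEigenvector
    have hu1 : S.H j u = ν • (u : V) := congrArg Subtype.val hu.apply_eq_smul
    have hu2 := (hL u).1 u.2
    refine ⟨Function.update μ j ν, u, hu2.1, fun h => hu.2 (Subtype.ext h), fun i hi => ?_⟩
    rcases eq_or_ne i j with rfl | hij
    · rw [Function.update_self, hu1]
    · rw [Function.update_of_ne hij]
      exact hu2.2 i ((Finset.mem_insert.1 hi).resolve_left hij)

/-- Every `E i` raises the eigenvalue of `Hsum` by 2, so it kills the eigenspace whose eigenvalue
has maximal real part. That eigenspace contains a common eigenvector of all `H i`. -/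
theorem exists_isHighestWeight [FiniteDimensional ℂ V] [Nontrivial V] :
    ∃ (μ : Fin n → ℂ) (v : V), v ≠ 0 ∧ S.IsHighestWeight μ v := by
  obtain ⟨c, hc⟩ := Module.End.exists_eigenvalue S.Hsum
  obtain ⟨d, hd, hmax⟩ := Set.exists_max_image _ Complex.re (Module.End.finite_hasEigenvalue S.Hsum)
    ⟨c, hc⟩
  obtain ⟨μ, v, hv, hv0, hs⟩ := S.exists_common_eigenvector (K := Module.End.eigenspace S.Hsum d) hd
    (fun i v hv => by
      rw [Module.End.mem_eigenspace_iff] at hv ⊢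
      rw [Hsum_apply_H, hv, map_smul]) Finset.univ
  rw [Module.End.mem_eigenspace_iff] at hv
  refine ⟨μ, v, hv0, fun i => hs i (Finset.mem_univ i), fun i => ?_⟩
  by_contra hE
  have h1 : Module.End.HasEigenvalue S.Hsum (d + 2) :=
    Module.End.hasEigenvalue_of_hasEigenvector (x := S.E i v) ⟨by
      rw [Module.End.mem_eigenspace_iff, Hsum_apply_E, hv, map_smul, add_smul], hE⟩
  have h2 := hmax _ h1
  simp at h2
  norm_num at h2

variable {S}

section

attribute [local instance] LieRing.ofAssociativeRing

/-- By `sl₂` theory the vectors `F ^ k v` with `k ≤ m` are nonzero eigenvectors of `H i` with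
distinct eigenvalues, so `m + 1` is at most the dimension. `H i = 0` is treated apart because
`IsSl2Triple` demands a nonzero `h`. -/
theorem IsHighestWeight.exists_nat [FiniteDimensional ℂ V] {μ : Fin n → ℂ} {v : V}
    (h : S.IsHighestWeight μ v) (hv : v ≠ 0) (i : Fin n) :
    ∃ m : ℕ, μ i = m ∧ m < Module.finrank ℂ V := by
  by_cases hH : S.H i = 0
  · have h1 := h.H_apply i
    rw [hH, LinearMap.zero_apply, eq_comm, smul_eq_zero] at h1
    have : Nontrivial V := ⟨v, 0, hv⟩
    exact ⟨0, by simpa using h1.resolve_right hv, Module.finrank_pos⟩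
  · have t : IsSl2Triple (S.H i) (S.E i) (S.F i) :=
      { h_ne_zero := hH
        lie_e_f := S.commutator_E_F i
        lie_h_e_nsmul := by
          rw [Ring.lie_def, S.commutator_H_E, two_smul, two_smul]
        lie_h_f_nsmul := by
          rw [Ring.lie_def, S.commutator_H_F, two_smul, two_smul] }
    have P : t.HasPrimitiveVectorWith v (μ i) := ⟨hv, h.H_apply i, h.E_apply i⟩
    obtain ⟨m, hm⟩ := P.exists_nat
    refine ⟨m, hm, ?_⟩
    have hli := Module.End.eigenvectors_linearIndependent' (S.H i)
      (fun k : Fin (m + 1) => μ i - 2 * ((k : ℕ) : ℂ)) (fun k l hkl => by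
        have : ((k : ℕ) : ℂ) = (l : ℕ) := by simpa using hkl
        exact Fin.ext (Nat.cast_injective this))
      (fun k => ((LieModule.toEnd ℂ (Module.End ℂ V) V (S.F i)) ^ (k : ℕ)) v)
      (fun k => ⟨Module.End.mem_eigenspace_iff.2 (P.lie_h_pow_toEnd_f k),
        P.pow_toEnd_f_ne_zero_of_eq_nat hm (Nat.lt_succ_iff.1 k.2)⟩)
    have := hli.fintype_card_le_finrank
    simpa using this

end

variable (S)

/-- A product of lowering operators applied to a vector. -/
def lower (v : V) : List (Fin n) → V
  | [] => v
  | i :: l => S.F i (lower v l)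

/-- The submodule spanned by the images of a vector under lowering operators. -/
def lowerSpan (v : V) : Submodule ℂ V := Submodule.span ℂ (Set.range (S.lower v))

variable {S} {μ : Fin n → ℂ} {v : V}

theorem IsHighestWeight.H_lower (h : S.IsHighestWeight μ v) (i : Fin n) (l : List (Fin n)) :
    ∃ c : ℂ, S.H i (S.lower v l) = c • S.lower v l := by
  induction l with
  | nil => exact ⟨μ i, h.H_apply i⟩
  | cons j l ih =>
    obtain ⟨c, hc⟩ := ih
    rcases eq_or_ne i j with rfl | hij
    · exact ⟨c - 2, by rw [lower, H_apply_F_self, hc, map_smul, sub_smul]⟩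
    · exact ⟨c, by rw [lower, H_apply_F _ hij, hc, map_smul]⟩

theorem IsHighestWeight.Hsum_lower (h : S.IsHighestWeight μ v) (l : List (Fin n)) :
    S.Hsum (S.lower v l) = (∑ i, μ i - 2 * (l.length : ℂ)) • S.lower v l := by
  induction l with
  | nil => simp [lower, Hsum_apply, h.H_apply, Finset.sum_smul]
  | cons j l ih =>
    rw [lower, Hsum_apply_F, ih, map_smul, ← sub_smul, List.length_cons]
    congr 1
    push_cast
    ring

theorem mem_lowerSpan (v : V) : v ∈ S.lowerSpan v :=
  Submodule.subset_span ⟨[], rfl⟩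

theorem lower_mem (l : List (Fin n)) : S.lower v l ∈ S.lowerSpan v :=
  Submodule.subset_span ⟨l, rfl⟩

theorem stable_of_lower (A : Module.End ℂ V) (h : ∀ l, A (S.lower v l) ∈ S.lowerSpan v) :
    ∀ u ∈ S.lowerSpan v, A u ∈ S.lowerSpan v := by
  intro u hu
  have : S.lowerSpan v ≤ (S.lowerSpan v).comap A := by
    rw [lowerSpan, Submodule.span_le]
    rintro _ ⟨l, rfl⟩
    exact h l
  exact this hu

/-- Only the raising operators need an argument: moving `E i` past a lowering operator leaves at
most a term in `H i`, which acts on words by scalars. -/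
theorem IsHighestWeight.isStable_lowerSpan (h : S.IsHighestWeight μ v) :
    S.IsStable (S.lowerSpan v) := by
  have hF : ∀ i, ∀ u ∈ S.lowerSpan v, S.F i u ∈ S.lowerSpan v := fun i =>
    stable_of_lower _ fun l => lower_mem (i :: l)
  have hH : ∀ i l, S.H i (S.lower v l) ∈ S.lowerSpan v := fun i l => by
    obtain ⟨c, hc⟩ := h.H_lower i l
    rw [hc]
    exact Submodule.smul_mem _ _ (lower_mem l)
  refine ⟨fun i => stable_of_lower _ (hH i), fun i => stable_of_lower _ fun l => ?_, hF⟩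
  induction l with
  | nil => rw [lower, h.E_apply]; exact Submodule.zero_mem _
  | cons j l ih =>
    rw [lower]
    rcases eq_or_ne i j with rfl | hij
    · rw [E_apply_F_self]
      exact Submodule.add_mem _ (hF _ _ ih) (hH _ _)
    · rw [E_apply_F _ hij]
      exact hF _ _ ih

/-- Every nonempty word of lowering operators changes the eigenvalue of `Hsum`, and distinct
eigenspaces are independent; so the top eigenspace of `lowerSpan v` is a line. -/
theorem IsHighestWeight.mem_span_of_mem_lowerSpan (h : S.IsHighestWeight μ v) {u : V}
    (hu : u ∈ S.lowerSpan v) (hu' : S.Hsum u = (∑ i, μ i) • u) : u ∈ Submodule.span ℂ {v} := by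
  let N : Submodule ℂ V := ⨆ ν ≠ ∑ i, μ i, Module.End.eigenspace S.Hsum ν
  have hle : S.lowerSpan v ≤ Submodule.span ℂ {v} ⊔ N := by
    rw [lowerSpan, Submodule.span_le]
    rintro _ ⟨l, rfl⟩
    rcases l with _ | ⟨j, l⟩
    · exact Submodule.mem_sup_left (Submodule.mem_span_singleton_self v)
    · refine Submodule.mem_sup_right (Submodule.mem_iSup_of_mem
        (∑ i, μ i - 2 * ((j :: l).length : ℂ)) (Submodule.mem_iSup_of_mem ?_ ?_))
      · rw [Ne, sub_eq_self, mul_eq_zero]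
        simp only [OfNat.ofNat_ne_zero, false_or, Nat.cast_eq_zero]
        simp
      · exact Module.End.mem_eigenspace_iff.2 (h.Hsum_lower _)
  obtain ⟨x, hx, y, hy, rfl⟩ := Submodule.mem_sup.1 (hle hu)
  obtain ⟨c, rfl⟩ := Submodule.mem_span_singleton.1 hx
  have hv : S.Hsum v = (∑ i, μ i) • v := by
    simpa [lower] using h.Hsum_lower []
  have hy' : y ∈ Module.End.eigenspace S.Hsum (∑ i, μ i) := by
    rw [Module.End.mem_eigenspace_iff]
    rw [map_add, map_smul, hv, smul_add, smul_comm] at hu'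
    exact add_left_cancel hu'
  have hy0 : y = 0 := by
    have := (Module.End.eigenspaces_iSupIndep S.Hsum) (∑ i, μ i)
    exact (Submodule.disjoint_def.1 this) y hy' hy
  rw [hy0, add_zero]
  exact hx

variable (S)

/-- The direct sum of two families of `sl₂`-triples. -/
def prod : Sl2Family n (V × W) where
  H i := (S.H i).prodMap (T.H i)
  E i := (S.E i).prodMap (T.E i)
  F i := (S.F i).prodMap (T.F i)
  commutator_H_E i := by
    refine LinearMap.ext fun x => Prod.ext ?_ ?_
    · exact LinearMap.congr_fun (S.commutator_H_E i) x.1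
    · exact LinearMap.congr_fun (T.commutator_H_E i) x.2
  commutator_H_F i := by
    refine LinearMap.ext fun x => Prod.ext ?_ ?_
    · exact LinearMap.congr_fun (S.commutator_H_F i) x.1
    · exact LinearMap.congr_fun (T.commutator_H_F i) x.2
  commutator_E_F i := by
    refine LinearMap.ext fun x => Prod.ext ?_ ?_
    · exact LinearMap.congr_fun (S.commutator_E_F i) x.1
    · exact LinearMap.congr_fun (T.commutator_E_F i) x.2
  commute_H_H i j h := by
    refine LinearMap.ext fun x => Prod.ext ?_ ?_
    · exact LinearMap.congr_fun (S.commute_H_H i j h) x.1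
    · exact LinearMap.congr_fun (T.commute_H_H i j h) x.2
  commute_H_E i j h := by
    refine LinearMap.ext fun x => Prod.ext ?_ ?_
    · exact LinearMap.congr_fun (S.commute_H_E i j h) x.1
    · exact LinearMap.congr_fun (T.commute_H_E i j h) x.2
  commute_H_F i j h := by
    refine LinearMap.ext fun x => Prod.ext ?_ ?_
    · exact LinearMap.congr_fun (S.commute_H_F i j h) x.1
    · exact LinearMap.congr_fun (T.commute_H_F i j h) x.2
  commute_E_F i j h := by
    refine LinearMap.ext fun x => Prod.ext ?_ ?_
    · exact LinearMap.congr_fun (S.commute_E_F i j h) x.1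
    · exact LinearMap.congr_fun (T.commute_E_F i j h) x.2

/-- There are no nontrivial stable submodules. -/
def IsIrreducible : Prop := ∀ U : Submodule ℂ V, S.IsStable U → U = ⊥ ∨ U = ⊤

variable {S T}

/-- Irreducible families of `sl₂`-triples with the same highest weight are isomorphic. -/
theorem exists_linearEquiv (hS : S.IsIrreducible) (hT : T.IsIrreducible) {w : W}
    (hv : S.IsHighestWeight μ v) (hw : T.IsHighestWeight μ w) (hv0 : v ≠ 0) (hw0 : w ≠ 0) :
    ∃ e : V ≃ₗ[ℂ] W, ∀ i x, e (S.H i x) = T.H i (e x) ∧ e (S.E i x) = T.E i (e x) ∧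
      e (S.F i x) = T.F i (e x) := by
  have hvw : (S.prod T).IsHighestWeight μ (v, w) :=
    ⟨fun i => Prod.ext (hv.H_apply i) (hw.H_apply i),
      fun i => Prod.ext (hv.E_apply i) (hw.E_apply i)⟩
  -- `U` is shown to be the graph of the desired isomorphism.
  let U := (S.prod T).lowerSpan (v, w)
  have hU : (S.prod T).IsStable U := hvw.isStable_lowerSpan
  have hvU : (v, w) ∈ U := mem_lowerSpan _
  have hsum : ∀ x : V × W, (S.prod T).Hsum x = (S.Hsum x.1, T.Hsum x.2) := by
    intro x
    simp only [Hsum_apply, prod, LinearMap.prodMap_apply]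
    exact Prod.ext (by simp [Prod.fst_sum]) (by simp [Prod.snd_sum])
  have hv' : S.Hsum v = (∑ i, μ i) • v := by simpa [lower] using hv.Hsum_lower []
  have hw' : T.Hsum w = (∑ i, μ i) • w := by simpa [lower] using hw.Hsum_lower []
  -- Otherwise irreducibility puts `(v, 0)` into `U`. It has the top eigenvalue of `Hsum`, hence is
  -- a multiple of `(v, w)`, which is impossible as `v` and `w` are nonzero.
  have hV0 : U.comap (LinearMap.inl ℂ V W) = ⊥ := by
    refine (hS _ ⟨fun i x hx => ?_, fun i x hx => ?_, fun i x hx => ?_⟩).resolve_right fun htop => ?_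
    · simpa [prod] using hU.H_mem i _ hx
    · simpa [prod] using hU.E_mem i _ hx
    · simpa [prod] using hU.F_mem i _ hx
    · have h1 : (v, (0 : W)) ∈ U := by
        have : v ∈ U.comap (LinearMap.inl ℂ V W) := htop ▸ Submodule.mem_top
        exact this
      obtain ⟨c, hc⟩ := Submodule.mem_span_singleton.1
        (hvw.mem_span_of_mem_lowerSpan h1 (by rw [hsum, hv', map_zero, Prod.smul_mk, smul_zero]))
      have h2 := congrArg Prod.snd hc
      have h3 := congrArg Prod.fst hc
      simp only [Prod.smul_mk] at h2 h3
      rw [(smul_eq_zero.1 h2).resolve_right hw0, zero_smul] at h3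
      exact hv0 h3.symm
  have hW0 : U.comap (LinearMap.inr ℂ V W) = ⊥ := by
    refine (hT _ ⟨fun i x hx => ?_, fun i x hx => ?_, fun i x hx => ?_⟩).resolve_right fun htop => ?_
    · simpa [prod] using hU.H_mem i _ hx
    · simpa [prod] using hU.E_mem i _ hx
    · simpa [prod] using hU.F_mem i _ hx
    · have h1 : ((0 : V), w) ∈ U := by
        have : w ∈ U.comap (LinearMap.inr ℂ V W) := htop ▸ Submodule.mem_top
        exact this
      obtain ⟨c, hc⟩ := Submodule.mem_span_singleton.1
        (hvw.mem_span_of_mem_lowerSpan h1 (by rw [hsum, hw', map_zero, Prod.smul_mk, smul_zero]))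
      have h2 := congrArg Prod.fst hc
      have h3 := congrArg Prod.snd hc
      simp only [Prod.smul_mk] at h2 h3
      rw [(smul_eq_zero.1 h2).resolve_right hv0, zero_smul] at h3
      exact hw0 h3.symm
  have hfst : U.map (LinearMap.fst ℂ V W) = ⊤ := by
    refine (hS _ ⟨?_, ?_, ?_⟩).resolve_left fun hbot => hv0 ?_
    · rintro i _ ⟨x, hx, rfl⟩
      exact ⟨_, hU.H_mem i x hx, rfl⟩
    · rintro i _ ⟨x, hx, rfl⟩
      exact ⟨_, hU.E_mem i x hx, rfl⟩
    · rintro i _ ⟨x, hx, rfl⟩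
      exact ⟨_, hU.F_mem i x hx, rfl⟩
    · have : v ∈ U.map (LinearMap.fst ℂ V W) := ⟨_, hvU, rfl⟩
      rwa [hbot, Submodule.mem_bot] at this
  have hsnd : U.map (LinearMap.snd ℂ V W) = ⊤ := by
    refine (hT _ ⟨?_, ?_, ?_⟩).resolve_left fun hbot => hw0 ?_
    · rintro i _ ⟨x, hx, rfl⟩
      exact ⟨_, hU.H_mem i x hx, rfl⟩
    · rintro i _ ⟨x, hx, rfl⟩
      exact ⟨_, hU.E_mem i x hx, rfl⟩
    · rintro i _ ⟨x, hx, rfl⟩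
      exact ⟨_, hU.F_mem i x hx, rfl⟩
    · have : w ∈ U.map (LinearMap.snd ℂ V W) := ⟨_, hvU, rfl⟩
      rwa [hbot, Submodule.mem_bot] at this
  let p : U →ₗ[ℂ] V := (LinearMap.fst ℂ V W).comp U.subtype
  let q : U →ₗ[ℂ] W := (LinearMap.snd ℂ V W).comp U.subtype
  have hp : Function.Bijective p := by
    constructor
    · rw [← LinearMap.ker_eq_bot, LinearMap.ker_eq_bot']
      rintro ⟨⟨a, b⟩, hab⟩ h
      have ha : a = 0 := h
      subst ha
      have hb : b ∈ U.comap (LinearMap.inr ℂ V W) := hab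
      rw [hW0, Submodule.mem_bot] at hb
      subst hb
      rfl
    · intro a
      have : a ∈ U.map (LinearMap.fst ℂ V W) := hfst ▸ Submodule.mem_top
      obtain ⟨x, hx, rfl⟩ := this
      exact ⟨⟨x, hx⟩, rfl⟩
  have hq : Function.Bijective q := by
    constructor
    · rw [← LinearMap.ker_eq_bot, LinearMap.ker_eq_bot']
      rintro ⟨⟨a, b⟩, hab⟩ h
      have hb : b = 0 := h
      subst hb
      have ha : a ∈ U.comap (LinearMap.inl ℂ V W) := hab
      rw [hV0, Submodule.mem_bot] at ha
      subst ha
      rfl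
    · intro a
      have : a ∈ U.map (LinearMap.snd ℂ V W) := hsnd ▸ Submodule.mem_top
      obtain ⟨x, hx, rfl⟩ := this
      exact ⟨⟨x, hx⟩, rfl⟩
  let e := (LinearEquiv.ofBijective p hp).symm.trans (LinearEquiv.ofBijective q hq)
  have he : ∀ x (hx : x ∈ U), e x.1 = x.2 := by
    intro x hx
    have : (LinearEquiv.ofBijective p hp).symm x.1 = ⟨x, hx⟩ := by
      rw [LinearEquiv.symm_apply_eq]; rfl
    change (LinearEquiv.ofBijective q hq) ((LinearEquiv.ofBijective p hp).symm x.1) = x.2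
    rw [this]; rfl
  refine ⟨e, fun i a => ?_⟩
  obtain ⟨⟨x, hx⟩, rfl⟩ := hp.2 a
  change e (S.H i x.1) = T.H i (e x.1) ∧ e (S.E i x.1) = T.E i (e x.1) ∧
    e (S.F i x.1) = T.F i (e x.1)
  rw [he x hx]
  exact ⟨he _ (hU.H_mem i x hx), he _ (hU.E_mem i x hx), he _ (hU.F_mem i x hx)⟩

end Sl2Family

/-! ### Passing between generators and group elements -/

section

open Filter

namespace Sl2Family

/-- The family of `sl₂`-triples attached to commuting families of operators which satisfy the
commutation relations of the imaginary quaternions. -/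
noncomputable def ofAngular {n : ℕ} {V : Type*} [AddCommGroup V] [Module ℂ V]
    (X : Fin n → Fin 3 → Module.End ℂ V)
    (hX : ∀ i k, X i k * X i (k + 1) - X i (k + 1) * X i k = (2 : ℂ) • X i (k + 2))
    (hc : ∀ i j, i ≠ j → ∀ k l, Commute (X i k) (X j l)) : Sl2Family n V where
  -- The usual change of basis in the complexification of `su(2)`; `ofAngular_eq` inverts it.
  H i := (-Complex.I) • X i 0
  E i := (1 / 2 : ℂ) • (X i 1 - Complex.I • X i 2)
  F i := (1 / 2 : ℂ) • (-X i 1 - Complex.I • X i 2)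
  commutator_H_E i := by
    have h0 : X i 0 * X i 1 - X i 1 * X i 0 = (2 : ℂ) • X i 2 := hX i 0
    have h2 : X i 2 * X i 0 - X i 0 * X i 2 = (2 : ℂ) • X i 1 := hX i 2
    have : (-Complex.I) • X i 0 * (1 / 2 : ℂ) • (X i 1 - Complex.I • X i 2) -
        (1 / 2 : ℂ) • (X i 1 - Complex.I • X i 2) * (-Complex.I) • X i 0 =
        (-Complex.I / 2) • (X i 0 * X i 1 - X i 1 * X i 0) -
        (Complex.I * Complex.I / 2) • (X i 2 * X i 0 - X i 0 * X i 2) := by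
      simp only [smul_mul_assoc, mul_smul_comm, mul_sub, sub_mul]
      module
    rw [this, h0, h2, Complex.I_mul_I]
    module
  commutator_H_F i := by
    have h0 : X i 0 * X i 1 - X i 1 * X i 0 = (2 : ℂ) • X i 2 := hX i 0
    have h2 : X i 2 * X i 0 - X i 0 * X i 2 = (2 : ℂ) • X i 1 := hX i 2
    have : (-Complex.I) • X i 0 * (1 / 2 : ℂ) • (-X i 1 - Complex.I • X i 2) -
        (1 / 2 : ℂ) • (-X i 1 - Complex.I • X i 2) * (-Complex.I) • X i 0 =
        (Complex.I / 2) • (X i 0 * X i 1 - X i 1 * X i 0) -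
        (Complex.I * Complex.I / 2) • (X i 2 * X i 0 - X i 0 * X i 2) := by
      simp only [smul_mul_assoc, mul_smul_comm, mul_sub, sub_mul, mul_neg, neg_mul]
      module
    rw [this, h0, h2, Complex.I_mul_I]
    module
  commutator_E_F i := by
    have h1 : X i 1 * X i 2 - X i 2 * X i 1 = (2 : ℂ) • X i 0 := hX i 1
    have : (1 / 2 : ℂ) • (X i 1 - Complex.I • X i 2) * (1 / 2 : ℂ) • (-X i 1 - Complex.I • X i 2) -
        (1 / 2 : ℂ) • (-X i 1 - Complex.I • X i 2) * (1 / 2 : ℂ) • (X i 1 - Complex.I • X i 2) =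
        (-Complex.I / 2) • (X i 1 * X i 2 - X i 2 * X i 1) := by
      simp only [smul_mul_assoc, mul_smul_comm, mul_sub, sub_mul, mul_neg, neg_mul]
      module
    rw [this, h1]
    module
  commute_H_H i j h := ((hc i j h 0 0).smul_left _).smul_right _
  commute_H_E i j h := (((hc i j h 0 1).sub_right ((hc i j h 0 2).smul_right _)).smul_right
    _).smul_left _
  commute_H_F i j h := (((hc i j h 0 1).neg_right.sub_right ((hc i j h 0 2).smul_right
    _)).smul_right _).smul_left _
  commute_E_F i j h := ((((hc i j h 1 1).neg_right.sub_right ((hc i j h 1 2).smul_right _)).sub_left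
    (((hc i j h 2 1).neg_right.sub_right ((hc i j h 2 2).smul_right _)).smul_left _)).smul_left
    _).smul_right _

variable {n : ℕ} {V W : Type*} [AddCommGroup V] [Module ℂ V] [AddCommGroup W] [Module ℂ W]
  (X : Fin n → Fin 3 → Module.End ℂ V)
  (hX : ∀ i k, X i k * X i (k + 1) - X i (k + 1) * X i k = (2 : ℂ) • X i (k + 2))
  (hc : ∀ i j, i ≠ j → ∀ k l, Commute (X i k) (X j l))

theorem ofAngular_eq (i : Fin n) :
    X i = ![Complex.I • (ofAngular X hX hc).H i, (ofAngular X hX hc).E i - (ofAngular X hX hc).F i,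
      Complex.I • ((ofAngular X hX hc).E i + (ofAngular X hX hc).F i)] := by
  funext k
  have hI : Complex.I * Complex.I = -1 := Complex.I_mul_I
  fin_cases k
  · change X i 0 = Complex.I • ((-Complex.I) • X i 0)
    rw [smul_smul, mul_neg, hI, neg_neg, one_smul]
  · change X i 1 = (1 / 2 : ℂ) • (X i 1 - Complex.I • X i 2) -
      (1 / 2 : ℂ) • (-X i 1 - Complex.I • X i 2)
    module
  · change X i 2 = Complex.I • ((1 / 2 : ℂ) • (X i 1 - Complex.I • X i 2) +
      (1 / 2 : ℂ) • (-X i 1 - Complex.I • X i 2))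
    have : Complex.I • ((1 / 2 : ℂ) • (X i 1 - Complex.I • X i 2) +
      (1 / 2 : ℂ) • (-X i 1 - Complex.I • X i 2)) = (-(Complex.I * Complex.I)) • X i 2 := by module
    rw [this, hI, neg_neg, one_smul]

theorem IsStable.angular_mem {U : Submodule ℂ V} (h : (ofAngular X hX hc).IsStable U) (i : Fin n)
    (k : Fin 3) : ∀ u ∈ U, X i k u ∈ U := by
  intro u hu
  rw [ofAngular_eq X hX hc i]
  have h1 := h.H_mem i u hu
  have h2 := h.E_mem i u hu
  have h3 := h.F_mem i u hu
  fin_cases k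
  · exact U.smul_mem _ h1
  · exact U.sub_mem h2 h3
  · exact U.smul_mem _ (U.add_mem h2 h3)

theorem angular_comm (Y : Fin n → Fin 3 → Module.End ℂ W)
    (hY : ∀ i k, Y i k * Y i (k + 1) - Y i (k + 1) * Y i k = (2 : ℂ) • Y i (k + 2))
    (hd : ∀ i j, i ≠ j → ∀ k l, Commute (Y i k) (Y j l)) (e : V →ₗ[ℂ] W)
    (he : ∀ i x, e ((ofAngular X hX hc).H i x) = (ofAngular Y hY hd).H i (e x) ∧
      e ((ofAngular X hX hc).E i x) = (ofAngular Y hY hd).E i (e x) ∧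
      e ((ofAngular X hX hc).F i x) = (ofAngular Y hY hd).F i (e x)) (i : Fin n) (k : Fin 3)
    (x : V) : e (X i k x) = Y i k (e x) := by
  rw [ofAngular_eq X hX hc i, ofAngular_eq Y hY hd i]
  obtain ⟨h1, h2, h3⟩ := he i x
  fin_cases k
  · change e (Complex.I • _) = Complex.I • _
    rw [map_smul, h1]
  · change e (_ - _) = _ - _
    rw [map_sub, h2, h3]
  · change e (Complex.I • (_ + _)) = Complex.I • (_ + _)
    rw [map_smul, map_add, h2, h3]

end Sl2Family

namespace IsOneParam

variable {V W : Type*} [NormedAddCommGroup V] [NormedSpace ℂ V] [NormedAddCommGroup W]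
  [NormedSpace ℂ W]

/-- Euler's limit writes `F t` through polynomials in its generator, so stable subspaces and
intertwining maps of the generator carry over to the group, with no power series. -/
theorem tendsto_apply [Nontrivial V] {F : ℝ → V →L[ℂ] V} {a : V →L[ℂ] V} (hF : IsOneParam F)
    (ha : HasDerivAt F a 0) (t : ℝ) (v : V) :
    Tendsto (fun k : ℕ => ((1 + ((t / k : ℝ) : ℂ) • a) ^ k) v) atTop (𝓝 (F t v)) :=
  ((ContinuousLinearMap.apply ℂ V v).continuous.tendsto _).comp (hF.tendsto_one_add_pow ha t)

theorem apply_mem [FiniteDimensional ℂ V] [Nontrivial V] {F : ℝ → V →L[ℂ] V} {a : V →L[ℂ] V}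
    (hF : IsOneParam F) (ha : HasDerivAt F a 0) {U : Submodule ℂ V} (hU : ∀ u ∈ U, a u ∈ U)
    (t : ℝ) {u : V} (hu : u ∈ U) : F t u ∈ U := by
  refine U.closed_of_finiteDimensional.mem_of_tendsto (hF.tendsto_apply ha t u)
    (Eventually.of_forall fun k => ?_)
  have h : ∀ (c : ℂ) (m : ℕ), ((1 + c • a) ^ m) u ∈ U := by
    intro c m
    induction m with
    | zero => simpa using hu
    | succ m ih =>
      rw [pow_succ']
      exact U.add_mem ih (U.smul_mem _ (hU _ ih))
  exact h _ _

theorem map_apply [Nontrivial V] [Nontrivial W] {F : ℝ → V →L[ℂ] V}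
    {a : V →L[ℂ] V} {G : ℝ → W →L[ℂ] W} {b : W →L[ℂ] W} (hF : IsOneParam F) (ha : HasDerivAt F a 0)
    (hG : IsOneParam G) (hb : HasDerivAt G b 0) (e : V →L[ℂ] W) (he : ∀ x, e (a x) = b (e x))
    (t : ℝ) (x : V) : e (F t x) = G t (e x) := by
  refine tendsto_nhds_unique ((e.continuous.tendsto _).comp (hF.tendsto_apply ha t x))
    ((hG.tendsto_apply hb t (e x)).congr fun k => ?_)
  have h : ∀ (c : ℂ) (m : ℕ), ((1 + c • b) ^ m) (e x) = e (((1 + c • a) ^ m) x) := by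
    intro c m
    induction m with
    | zero => simp
    | succ m ih =>
      simp [pow_succ', ih, he]
  exact h _ _

end IsOneParam

end

theorem Representation.IsIrreducible.eq_bot_or_eq_top_of_stable {G V : Type*} [Monoid G] [AddCommGroup V]
    [Module ℂ V] {ρ : Representation ℂ G V} (h : ρ.IsIrreducible) (U : Submodule ℂ V)
    (hU : ∀ g, ∀ u ∈ U, ρ g u ∈ U) : U = ⊥ ∨ U = ⊤ := by
  let U' : Subrepresentation ρ := ⟨U, fun g u hu => hU g u hu⟩
  rcases IsSimpleOrder.eq_bot_or_eq_top U' with h | h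
  · exact Or.inl (congrArg Subrepresentation.toSubmodule h)
  · exact Or.inr (congrArg Subrepresentation.toSubmodule h)

theorem Representation.IsIrreducible.nontrivial {G V : Type*} [Monoid G] [AddCommGroup V]
    [Module ℂ V] {ρ : Representation ℂ G V} (h : ρ.IsIrreducible) : Nontrivial V := by
  by_contra hV
  rw [not_nontrivial_iff_subsingleton] at hV
  obtain ⟨a, b, hab⟩ := h.toNontrivial
  exact hab (Subrepresentation.toSubmodule_injective (Subsingleton.elim _ _))

/-! ### Irreducible representations of SU(2)^n and their number -/

namespace SU2

variable {n : ℕ} {V W : Type*} [NormedAddCommGroup V] [NormedSpace ℂ V] [FiniteDimensional ℂ V]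
  [NormedAddCommGroup W] [NormedSpace ℂ W] [FiniteDimensional ℂ W]

/-- The restriction of a representation of `SU(2) ^ n` to one of the factors. -/
noncomputable def factor (ρ : Representation ℂ (SU2Pow n) V) (i : Fin n) : SU2 →* (V →L[ℂ] V) :=
  (((Module.End.toContinuousLinearMap (𝕜 := ℂ) V : (V →ₗ[ℂ] V) ≃ₐ[ℂ] (V →L[ℂ] V)) :
    (V →ₗ[ℂ] V) →* (V →L[ℂ] V)).comp ρ).comp (MonoidHom.mulSingle (fun _ : Fin n => SU2) i)

theorem continuous_factor {ρ : Representation ℂ (SU2Pow n) V}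
    (hρ : ∀ v, Continuous fun g => ρ g v) (i : Fin n) : Continuous (factor ρ i) := by
  rw [continuous_clm_apply]
  intro v
  have h : Continuous fun g : SU2 => (Pi.mulSingle i g : SU2Pow n) := by
    refine continuous_pi fun j => ?_
    rcases eq_or_ne j i with rfl | hj
    · simpa using continuous_id'
    · simpa [Pi.mulSingle_eq_of_ne hj] using continuous_const
  exact (hρ v).comp h

theorem commute_factor (ρ : Representation ℂ (SU2Pow n) V) {i j : Fin n} (hij : i ≠ j)
    (g h : SU2) : Commute (factor ρ i g) (factor ρ j h) := by
  have := (Pi.mulSingle_commute (f := fun _ : Fin n => SU2) hij g h).map ρ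
  exact this.map ((Module.End.toContinuousLinearMap (𝕜 := ℂ) V : (V →ₗ[ℂ] V) ≃ₐ[ℂ] (V →L[ℂ] V)) :
    (V →ₗ[ℂ] V) →* (V →L[ℂ] V))

/-- The infinitesimal generators of a representation of `SU(2) ^ n`. -/
noncomputable def angular (ρ : Representation ℂ (SU2Pow n) V) (i : Fin n) (k : Fin 3) :
    Module.End ℂ V := (generator (factor ρ i) k : V →L[ℂ] V)

theorem angular_commutator [Nontrivial V] {ρ : Representation ℂ (SU2Pow n) V}
    (hρ : ∀ v, Continuous fun g => ρ g v) (i : Fin n) (k : Fin 3) :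
    angular ρ i k * angular ρ i (k + 1) - angular ρ i (k + 1) * angular ρ i k =
      (2 : ℂ) • angular ρ i (k + 2) := by
  have := generator_commutator (continuous_factor hρ i) k
  refine LinearMap.ext fun v => ?_
  have h2 := congrArg (fun f : V →L[ℂ] V => f v) this
  -- Written as a sum, the double no longer depends on whether the scalar 2 is real or complex.
  simp only [two_smul] at h2 ⊢
  exact h2

theorem commute_angular {ρ : Representation ℂ (SU2Pow n) V}
    (hρ : ∀ v, Continuous fun g => ρ g v) (i j : Fin n) (hij : i ≠ j) (k l : Fin 3) :
    Commute (angular ρ i k) (angular ρ j l) := by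
  have h := commute_generator (continuous_factor hρ j) (c := generator (factor ρ i) k)
    (fun g => (commute_generator (continuous_factor hρ i)
      (fun h => commute_factor ρ hij.symm g h) k).symm) l
  exact congrArg (ContinuousLinearMap.toLinearMap) h.eq

/-- The family of `sl₂`-triples of a representation of `SU(2) ^ n`. -/
noncomputable def sl2Family [Nontrivial V] {ρ : Representation ℂ (SU2Pow n) V}
    (hρ : ∀ v, Continuous fun g => ρ g v) : Sl2Family n V :=
  Sl2Family.ofAngular (angular ρ) (angular_commutator hρ) (commute_angular hρ)

/-- `SU(2) ^ n` is generated by the one-parameter subgroups `rot k` of its factors. -/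
theorem mem_of_rot_mem (P : Submonoid (SU2Pow n))
    (hP : ∀ i k t, (Pi.mulSingle i (rot k t) : SU2Pow n) ∈ P) (g : SU2Pow n) : g ∈ P := by
  refine Submonoid.pi_mem_of_mulSingle_mem g fun i => ?_
  obtain ⟨α, β, γ, h⟩ := exists_rot_mul_rot_mul_rot (g i)
  rw [h, Pi.mulSingle_mul, Pi.mulSingle_mul]
  exact P.mul_mem (P.mul_mem (hP _ _ _) (hP _ _ _)) (hP _ _ _)

/-- A subspace stable under the triples is stable under the generators, hence under the subgroups
`rot k` of all factors, and these generate `SU(2) ^ n`. -/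
theorem isIrreducible_sl2Family [Nontrivial V] {ρ : Representation ℂ (SU2Pow n) V}
    (hρ : ∀ v, Continuous fun g => ρ g v) (hirr : ρ.IsIrreducible) :
    (sl2Family hρ).IsIrreducible := by
  intro U hU
  refine hirr.eq_bot_or_eq_top_of_stable U fun g => ?_
  let P : Submonoid (SU2Pow n) :=
    { carrier := {g | ∀ u ∈ U, ρ g u ∈ U}
      one_mem' := fun u hu => by simpa using hu
      mul_mem' := fun {a b} ha hb u hu => by
        rw [map_mul]
        exact ha _ (hb _ hu) }
  refine mem_of_rot_mem P (fun i k t u hu => ?_) g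
  exact (isOneParam_map_rot (factor ρ i) k).apply_mem
    (hasDerivAt_generator (continuous_factor hρ i) k)
    (hU.angular_mem _ (angular_commutator hρ) (commute_angular hρ) i k) t hu

theorem nonempty_equiv [Nontrivial V] [Nontrivial W] {ρ : Representation ℂ (SU2Pow n) V}
    (hρ : ∀ v, Continuous fun g => ρ g v) {σ : Representation ℂ (SU2Pow n) W}
    (hσ : ∀ v, Continuous fun g => σ g v) (e : V ≃ₗ[ℂ] W)
    (he : ∀ i x, e ((sl2Family hρ).H i x) = (sl2Family hσ).H i (e x) ∧
      e ((sl2Family hρ).E i x) = (sl2Family hσ).E i (e x) ∧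
      e ((sl2Family hρ).F i x) = (sl2Family hσ).F i (e x)) :
    Nonempty (ρ.Equiv σ) := by
  refine ⟨Representation.Equiv.mk e fun g => LinearMap.ext ?_⟩
  let P : Submonoid (SU2Pow n) :=
    { carrier := {g | ∀ x, e (ρ g x) = σ g (e x)}
      one_mem' := fun x => by simp
      mul_mem' := fun {a b} ha hb x => by
        rw [map_mul, map_mul, Module.End.mul_apply, Module.End.mul_apply, ha, hb] }
  refine mem_of_rot_mem P (fun i k t x => ?_) g
  exact (isOneParam_map_rot (factor ρ i) k).map_apply
    (hasDerivAt_generator (continuous_factor hρ i) k) (isOneParam_map_rot (factor σ i) k)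
    (hasDerivAt_generator (continuous_factor hσ i) k) (e : V →ₗ[ℂ] W).toContinuousLinearMap
    (Sl2Family.angular_comm _ (angular_commutator hρ) (commute_angular hρ) _
      (angular_commutator hσ) (commute_angular hσ) (e : V →ₗ[ℂ] W) he i k) t x

theorem exists_weight [Nontrivial V] {ρ : Representation ℂ (SU2Pow n) V}
    (hρ : ∀ v, Continuous fun g => ρ g v) :
    ∃ m : Fin n → Fin (Module.finrank ℂ V), ∃ v : V, v ≠ 0 ∧
      (sl2Family hρ).IsHighestWeight (fun i => ((m i : ℕ) : ℂ)) v := by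
  obtain ⟨μ, v, hv, h⟩ := (sl2Family hρ).exists_isHighestWeight
  choose m hm hlt using h.exists_nat hv
  refine ⟨fun i => ⟨m i, hlt i⟩, v, hv, ?_⟩
  have : μ = fun i => ((m i : ℕ) : ℂ) := funext hm
  rwa [this] at h

end SU2

namespace ContIrrep

theorem nonempty_equiv_of_weight {n d : ℕ} (ρ σ : ContIrrep (SU2Pow n) d) [Nontrivial (Fin d → ℂ)]
    {m : Fin n → ℂ} {v w : Fin d → ℂ} (hv0 : v ≠ 0) (hw0 : w ≠ 0)
    (hv : (SU2.sl2Family ρ.2.1).IsHighestWeight m v)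
    (hw : (SU2.sl2Family σ.2.1).IsHighestWeight m w) : Nonempty (ρ.1.Equiv σ.1) := by
  obtain ⟨e, he⟩ := Sl2Family.exists_linearEquiv (SU2.isIrreducible_sl2Family ρ.2.1 ρ.2.2)
    (SU2.isIrreducible_sl2Family σ.2.1 σ.2.2) hv hw hv0 hw0
  exact SU2.nonempty_equiv ρ.2.1 σ.2.1 e he

end ContIrrep

/-- An irreducible representation of `SU(2) ^ n` is determined by its highest weight, whose
entries are less than the degree. -/
theorem exists_injective_irrepClass (n d : ℕ) :
    ∃ f : IrrepClass (SU2Pow n) d → (Fin n → Fin d), Function.Injective f := by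
  have key : ∀ x : IrrepClass (SU2Pow n) d, ∃ m : Fin n → Fin d, ∃ ρ : ContIrrep (SU2Pow n) d,
      ∃ _ : Nontrivial (Fin d → ℂ), ∃ v : Fin d → ℂ, x = Quotient.mk _ ρ ∧ v ≠ 0 ∧
      (SU2.sl2Family ρ.2.1).IsHighestWeight (fun i => ((m i : ℕ) : ℂ)) v := by
    intro x
    induction x using Quotient.inductionOn with
    | h ρ =>
      have := ρ.2.2.nontrivial
      obtain ⟨m, v, hv, h⟩ := SU2.exists_weight ρ.2.1
      refine ⟨fun i => (m i).cast (by simp), ρ, this, v, rfl, hv, ?_⟩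
      simpa using h
  choose m ρ hV v hx hv hm using key
  refine ⟨m, fun x y hxy => ?_⟩
  rw [hx x, hx y]
  refine Quotient.sound ?_
  have := hV x
  have hy := hm y
  rw [← hxy] at hy
  exact ContIrrep.nonempty_equiv_of_weight (ρ x) (ρ y) (hv x) (hv y) (hm x) hy

instance finite_irrepClass (n d : ℕ) : Finite (IrrepClass (SU2Pow n) d) :=
  let ⟨_, hf⟩ := exists_injective_irrepClass n d
  Finite.of_injective _ hf

theorem card_irrepClass_le (n d : ℕ) : Nat.card (IrrepClass (SU2Pow n) d) ≤ d ^ n := by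
  obtain ⟨f, hf⟩ := exists_injective_irrepClass n d
  simpa using Nat.card_le_card_of_injective f hf

/-! ### Pullback and inflation of representations -/

namespace Representation

variable {G H V : Type*} [Monoid G] [Monoid H] [AddCommGroup V] [Module ℂ V]
  (ρ : Representation ℂ G V) (f : H →* G) (hf : Function.Surjective f)

/-- Subrepresentations do not change under pullback along a surjective homomorphism. -/
def subrepresentationCompOrderIso : Subrepresentation ρ ≃o Subrepresentation (ρ.comp f) where
  toFun U := ⟨U.toSubmodule, fun h _ hv => U.apply_mem_toSubmodule (f h) hv⟩
  invFun U := ⟨U.toSubmodule, fun g _ hv => by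
    obtain ⟨h, rfl⟩ := hf g
    exact U.apply_mem_toSubmodule h hv⟩
  left_inv _ := rfl
  right_inv _ := rfl
  map_rel_iff' := Iff.rfl

include hf in
theorem isIrreducible_comp_iff : IsIrreducible (ρ.comp f) ↔ IsIrreducible ρ :=
  (OrderIso.isSimpleOrder_iff (subrepresentationCompOrderIso ρ f hf)).symm

end Representation

namespace ContIrrep

variable {G H : Type*} [Group G] [TopologicalSpace G] [Group H] [TopologicalSpace H] {d : ℕ}

/-- The pullback along a continuous surjective homomorphism. -/
def comap (f : H →* G) (hc : Continuous f) (hs : Function.Surjective f) (ρ : ContIrrep G d) :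
    ContIrrep H d :=
  ⟨ρ.1.comp f, fun v => (ρ.2.1 v).comp hc, (Representation.isIrreducible_comp_iff ρ.1 f hs).2 ρ.2.2⟩

theorem nonempty_equiv_comap_iff (f : H →* G) (hc : Continuous f) (hs : Function.Surjective f)
    (ρ σ : ContIrrep G d) :
    Nonempty ((comap f hc hs ρ).1.Equiv (comap f hc hs σ).1) ↔ Nonempty (ρ.1.Equiv σ.1) := by
  constructor
  · rintro ⟨e⟩
    refine ⟨Representation.Equiv.mk e.toLinearEquiv fun g => ?_⟩
    obtain ⟨h, rfl⟩ := hs g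
    exact e.isIntertwining' h
  · rintro ⟨e⟩
    exact ⟨Representation.Equiv.mk e.toLinearEquiv fun h => e.isIntertwining' (f h)⟩

end ContIrrep

namespace IrrepClass

variable {G H : Type*} [Group G] [TopologicalSpace G] [Group H] [TopologicalSpace H] {d : ℕ}

/-- The pullback along a continuous surjective homomorphism. -/
def comap (f : H →* G) (hc : Continuous f) (hs : Function.Surjective f) :
    IrrepClass G d → IrrepClass H d :=
  Quotient.map (ContIrrep.comap f hc hs)
    fun ρ σ h => (ContIrrep.nonempty_equiv_comap_iff f hc hs ρ σ).2 h

theorem comap_injective (f : H →* G) (hc : Continuous f) (hs : Function.Surjective f) :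
    Function.Injective (comap f hc hs : IrrepClass G d → IrrepClass H d) := by
  intro x y
  induction x using Quotient.inductionOn with
  | h ρ =>
    induction y using Quotient.inductionOn with
    | h σ =>
      intro h
      exact Quotient.sound ((ContIrrep.nonempty_equiv_comap_iff f hc hs ρ σ).1 (Quotient.exact h))

variable (Z : Subgroup G) [Z.Normal]

/-- The classes of representations which are inflated from a quotient group are the classes of
representations with trivial action of the subgroup. -/
theorem exists_comap_mk_eq_iff (ρ : ContIrrep G d) :
    (∃ y : IrrepClass (G ⧸ Z) d, comap (QuotientGroup.mk' Z) QuotientGroup.continuous_mk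
      (QuotientGroup.mk'_surjective Z) y = Quotient.mk _ ρ) ↔ ∀ z ∈ Z, ρ.1 z = 1 := by
  constructor
  · rintro ⟨y, hy⟩ z hz
    induction y using Quotient.inductionOn with
    | h σ =>
      obtain ⟨e⟩ : Nonempty (Representation.Equiv _ _) := Quotient.exact hy
      have h := e.isIntertwining' z
      have hσ : (ContIrrep.comap (QuotientGroup.mk' Z) QuotientGroup.continuous_mk
          (QuotientGroup.mk'_surjective Z) σ).1 z = 1 := by
        change σ.1 (QuotientGroup.mk' Z z) = 1
        have h1 : QuotientGroup.mk' Z z = 1 := (QuotientGroup.eq_one_iff (N := Z) z).2 hz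
        rw [h1, map_one]
      refine LinearMap.ext fun v => ?_
      obtain ⟨w, rfl⟩ := e.toLinearEquiv.surjective v
      have h2 := LinearMap.congr_fun h w
      rw [hσ] at h2
      exact h2.symm
  · intro h
    have hZ : Z ≤ (ρ.1 : G →* _).ker := fun z hz => h z hz
    let σ : Representation ℂ (G ⧸ Z) (Fin d → ℂ) := QuotientGroup.lift Z ρ.1 hZ
    have hσ : σ.comp (QuotientGroup.mk' Z) = ρ.1 := MonoidHom.ext fun g => rfl
    let σ' : ContIrrep (G ⧸ Z) d := ⟨σ, fun v =>
      (QuotientGroup.isQuotientMap_mk Z).continuous_iff.2 (ρ.2.1 v), by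
      rw [← Representation.isIrreducible_comp_iff σ _ (QuotientGroup.mk'_surjective Z), hσ]
      exact ρ.2.2⟩
    exact ⟨Quotient.mk _ σ', congrArg (Quotient.mk _) (Subtype.ext hσ)⟩

end IrrepClass

/-! ### Sign vectors of representations and dual codes -/

/-- The bicharacter `ℤˣ × ℤˣ → ℤˣ` which is nontrivial in both arguments. -/
def signPairing (x y : ℤˣ) : ℤˣ := if x = 1 then 1 else y

theorem signPairing_mul_left (x x' y : ℤˣ) :
    signPairing (x * x') y = signPairing x y * signPairing x' y := by
  revert x x' y; decide

/-- The pairing of sign vectors with values in the group of signs. -/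
def codePairing {n : ℕ} (χ : Fin n → ℤˣ) : (Fin n → ℤˣ) →* ℤˣ where
  toFun u := ∏ i, signPairing (u i) (χ i)
  map_one' := by simp [signPairing]
  map_mul' u v := by simp [signPairing_mul_left, Finset.prod_mul_distrib]

theorem codePairing_apply {n : ℕ} (χ u : Fin n → ℤˣ) :
    codePairing χ u = ∏ i, signPairing (u i) (χ i) := rfl

theorem codePairing_mulSingle {n : ℕ} (χ : Fin n → ℤˣ) (i : Fin n) :
    codePairing χ (Pi.mulSingle i (-1)) = χ i := by
  rw [codePairing_apply, Finset.prod_eq_single i]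
  · simp [signPairing]
  · intro j _ hj
    simp [signPairing, Pi.mulSingle_eq_of_ne hj]
  · simp

namespace ContIrrep

variable {n d : ℕ}

/-- The sign vector `χ` describes the action of the center of `SU(2) ^ n`. -/
def HasSign (ρ : ContIrrep (SU2Pow n) d) (χ : Fin n → ℤˣ) : Prop :=
  ∀ i v, ρ.1 (signPow n (Pi.mulSingle i (-1))) v = ((χ i : ℤ) : ℂ) • v

/-- A form of Schur's lemma for a central involution `T`: the kernel of `T - 1` is stable, hence
everything or zero, and it contains all `T v + v`. -/
theorem exists_hasSign (ρ : ContIrrep (SU2Pow n) d) : ∃ χ, ρ.HasSign χ := by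
  have h : ∀ i, ∃ x : ℤˣ, ∀ v, ρ.1 (signPow n (Pi.mulSingle i (-1))) v = ((x : ℤ) : ℂ) • v := by
    intro i
    set T := ρ.1 (signPow n (Pi.mulSingle i (-1))) with hT
    have hTT : ∀ v, T (T v) = v := by
      intro v
      rw [hT, ← Module.End.mul_apply, ← map_mul, ← map_mul, ← Pi.mulSingle_mul]
      simp
    have hcomm : ∀ g v, T (ρ.1 g v) = ρ.1 g (T v) := by
      intro g v
      rw [hT, ← Module.End.mul_apply, ← map_mul,
        ← Subgroup.mem_center_iff.1 (signPow_mem_center (Pi.mulSingle i (-1))) g, map_mul,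
        Module.End.mul_apply]
    rcases ρ.2.2.eq_bot_or_eq_top_of_stable (LinearMap.ker (T - 1)) (fun g u hu => by
      rw [LinearMap.mem_ker, LinearMap.sub_apply, Module.End.one_apply, sub_eq_zero] at hu ⊢
      rw [hcomm, hu]) with h | h
    · refine ⟨-1, fun v => ?_⟩
      have : T v + v ∈ LinearMap.ker (T - 1) := by
        rw [LinearMap.mem_ker, LinearMap.sub_apply, Module.End.one_apply, map_add, hTT, add_comm,
          sub_self]
      rw [h, Submodule.mem_bot] at this
      simpa using eq_neg_of_add_eq_zero_left this
    · refine ⟨1, fun v => ?_⟩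
      have : v ∈ LinearMap.ker (T - 1) := h ▸ Submodule.mem_top
      rw [LinearMap.mem_ker, LinearMap.sub_apply, Module.End.one_apply, sub_eq_zero] at this
      simpa using this
  choose χ hχ using h
  exact ⟨χ, hχ⟩

theorem smul_injective [Nontrivial (Fin d → ℂ)] {x y : ℤˣ}
    (h : ∀ v : Fin d → ℂ, ((x : ℤ) : ℂ) • v = ((y : ℤ) : ℂ) • v) : x = y := by
  obtain ⟨v, hv⟩ := exists_ne (0 : Fin d → ℂ)
  exact Units.ext (Int.cast_injective (smul_left_injective ℂ hv (h v)))

theorem HasSign.unique {ρ : ContIrrep (SU2Pow n) d} {χ χ' : Fin n → ℤˣ} (h : ρ.HasSign χ)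
    (h' : ρ.HasSign χ') : χ = χ' := by
  have := ρ.2.2.nontrivial
  exact funext fun i => smul_injective fun v => (h i v).symm.trans (h' i v)

theorem HasSign.congr {ρ σ : ContIrrep (SU2Pow n) d} {χ : Fin n → ℤˣ} (h : ρ.HasSign χ)
    (e : ρ.1.Equiv σ.1) : σ.HasSign χ := by
  intro i v
  obtain ⟨w, rfl⟩ := e.toLinearEquiv.surjective v
  have h2 := LinearMap.congr_fun (e.isIntertwining' (signPow n (Pi.mulSingle i (-1)))) w
  rw [LinearMap.comp_apply, h i w, map_smul] at h2
  exact h2.symm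

theorem HasSign.apply_signPow {ρ : ContIrrep (SU2Pow n) d} {χ : Fin n → ℤˣ} (h : ρ.HasSign χ)
    (u : Fin n → ℤˣ) (v : Fin d → ℂ) :
    ρ.1 (signPow n u) v = ((codePairing χ u : ℤ) : ℂ) • v := by
  let P : Submonoid (Fin n → ℤˣ) :=
    { carrier := {u | ∀ v, ρ.1 (signPow n u) v = ((codePairing χ u : ℤ) : ℂ) • v}
      one_mem' := fun v => by simp
      mul_mem' := fun {a b} ha hb v => by
        rw [map_mul, map_mul, Module.End.mul_apply, hb, map_smul, ha, smul_smul, map_mul,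
          Units.val_mul, Int.cast_mul, mul_comm] }
  have : u ∈ P := by
    refine Submonoid.pi_mem_of_mulSingle_mem u fun i => ?_
    rcases Int.units_eq_one_or (u i) with hi | hi
    · rw [hi, Pi.mulSingle_one]
      exact P.one_mem
    · rw [hi]
      intro v
      rw [codePairing_mulSingle]
      exact h i v
  exact this v

theorem HasSign.trivial_iff {ρ : ContIrrep (SU2Pow n) d} {χ : Fin n → ℤˣ} (h : ρ.HasSign χ)
    (C : Subgroup (Fin n → ℤˣ)) :
    (∀ z ∈ codeSubgroup C, ρ.1 z = 1) ↔ ∀ u ∈ C, codePairing χ u = 1 := by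
  have := ρ.2.2.nontrivial
  constructor
  · intro hz u hu
    refine smul_injective (d := d) fun v => ?_
    rw [← h.apply_signPow, hz _ (signPow_mem_codeSubgroup.2 hu)]
    simp
  · rintro hu _ ⟨u, huC, rfl⟩
    refine LinearMap.ext fun v => ?_
    rw [h.apply_signPow, hu u huC]
    simp

end ContIrrep

namespace SU2

/-- The permutation of the coordinates of `SU(2) ^ n`. -/
def permute {n : ℕ} (σ : Equiv.Perm (Fin n)) : SU2Pow n →* SU2Pow n where
  toFun g i := g (σ i)
  map_one' := rfl
  map_mul' _ _ := rfl

theorem continuous_permute {n : ℕ} (σ : Equiv.Perm (Fin n)) : Continuous (permute σ) :=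
  continuous_pi fun i => continuous_apply (σ i)

theorem surjective_permute {n : ℕ} (σ : Equiv.Perm (Fin n)) : Function.Surjective (permute σ) :=
  fun g => ⟨fun i => g (σ.symm i), funext fun i => congrArg g (σ.symm_apply_apply i)⟩

theorem permute_signPow {n : ℕ} (σ : Equiv.Perm (Fin n)) (u : Fin n → ℤˣ) :
    permute σ (signPow n u) = signPow n (u ∘ σ) := rfl

end SU2

namespace IrrepClass

variable {n d : ℕ}

/-- The sign vector which describes the action of the center of `SU(2) ^ n`. -/
noncomputable def sign : IrrepClass (SU2Pow n) d → Fin n → ℤˣ :=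
  Quotient.lift (fun ρ => ρ.exists_hasSign.choose) fun ρ σ h =>
    let ⟨e⟩ := h
    (ρ.exists_hasSign.choose_spec.congr e).unique σ.exists_hasSign.choose_spec

theorem hasSign_sign (ρ : ContIrrep (SU2Pow n) d) : ρ.HasSign (sign (Quotient.mk _ ρ)) :=
  ρ.exists_hasSign.choose_spec

theorem sign_comap_permute (σ : Equiv.Perm (Fin n)) (x : IrrepClass (SU2Pow n) d) :
    sign (comap (SU2.permute σ) (SU2.continuous_permute σ) (SU2.surjective_permute σ) x) =
      sign x ∘ σ.symm := by
  induction x using Quotient.inductionOn with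
  | h ρ =>
    refine (hasSign_sign (ContIrrep.comap (SU2.permute σ) (SU2.continuous_permute σ)
      (SU2.surjective_permute σ) ρ)).unique fun i v => ?_
    have h : (Pi.mulSingle i (-1) : Fin n → ℤˣ) ∘ σ = Pi.mulSingle (σ.symm i) (-1) := by
      funext j
      rcases eq_or_ne j (σ.symm i) with rfl | hj
      · simp
      · rw [Pi.mulSingle_eq_of_ne hj, Function.comp_apply, Pi.mulSingle_eq_of_ne]
        rintro rfl
        simp at hj
    change ρ.1 (SU2.permute σ (signPow n (Pi.mulSingle i (-1)))) v = _
    rw [SU2.permute_signPow, h]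
    exact hasSign_sign ρ _ v

/-- Pullback along a permutation of the factors keeps the degree and permutes the sign vector. The
inverse permutation gives the opposite inequality. -/
theorem card_sign_comp_le (σ : Equiv.Perm (Fin n)) (χ : Fin n → ℤˣ) :
    Nat.card {x : IrrepClass (SU2Pow n) d // sign x = χ} ≤
      Nat.card {x : IrrepClass (SU2Pow n) d // sign x = χ ∘ σ} :=
  Nat.card_le_card_of_injective
    (fun x => ⟨comap (SU2.permute σ.symm) (SU2.continuous_permute _) (SU2.surjective_permute _) x.1,
      by rw [sign_comap_permute, x.2]; rfl⟩)
    fun _ _ h => Subtype.ext (comap_injective _ _ _ (congrArg Subtype.val h))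

theorem card_sign_comp (σ : Equiv.Perm (Fin n)) (χ : Fin n → ℤˣ) :
    Nat.card {x : IrrepClass (SU2Pow n) d // sign x = χ ∘ σ} =
      Nat.card {x : IrrepClass (SU2Pow n) d // sign x = χ} := by
  refine le_antisymm ?_ (card_sign_comp_le σ χ)
  have := card_sign_comp_le (d := d) σ.symm (χ ∘ σ)
  rwa [Function.comp_assoc, Equiv.self_comp_symm, Function.comp_id] at this

/-- The sign vectors which are orthogonal to a code. -/
def dualCode (C : Subgroup (Fin n → ℤˣ)) : Set (Fin n → ℤˣ) := {χ | ∀ u ∈ C, codePairing χ u = 1}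

/-- The representations of a quotient are the representations whose sign vector is in the dual
code. -/
noncomputable def quotientEquiv (C : Subgroup (Fin n → ℤˣ)) :
    IrrepClass (SU2Pow n ⧸ codeSubgroup C) d ≃
      {x : IrrepClass (SU2Pow n) d // sign x ∈ dualCode C} :=
  (Equiv.ofInjective _ (comap_injective (QuotientGroup.mk' (codeSubgroup C))
    QuotientGroup.continuous_mk (QuotientGroup.mk'_surjective _))).trans
    (Equiv.subtypeEquivRight fun x => by
      induction x using Quotient.inductionOn with
      | h ρ =>
        exact (exists_comap_mk_eq_iff _ ρ).trans ((hasSign_sign ρ).trivial_iff C))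

instance finite_quotient (C : Subgroup (Fin n → ℤˣ)) :
    Finite (IrrepClass (SU2Pow n ⧸ codeSubgroup C) d) :=
  Finite.of_equiv _ (quotientEquiv C).symm

theorem card_quotient_le (C : Subgroup (Fin n → ℤˣ)) :
    Nat.card (IrrepClass (SU2Pow n ⧸ codeSubgroup C) d) ≤ d ^ n := by
  rw [Nat.card_congr (quotientEquiv C)]
  exact (Nat.card_le_card_of_injective _ Subtype.val_injective).trans (card_irrepClass_le n d)

theorem card_quotient_eq_sum (C : Subgroup (Fin n → ℤˣ)) :
    Nat.card (IrrepClass (SU2Pow n ⧸ codeSubgroup C) d) =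
      ∑ᶠ χ : dualCode C, Nat.card {x : IrrepClass (SU2Pow n) d // sign x = χ} := by
  let e : {x : IrrepClass (SU2Pow n) d // sign x ∈ dualCode C} ≃
      Σ χ : dualCode C, {x : IrrepClass (SU2Pow n) d // sign x = χ} :=
    { toFun := fun x => ⟨⟨sign x.1, x.2⟩, ⟨x.1, rfl⟩⟩
      invFun := fun p => ⟨p.2.1, p.2.2.symm ▸ p.1.2⟩
      left_inv := fun _ => rfl
      right_inv := by
        rintro ⟨⟨χ, hχ⟩, ⟨x, hx⟩⟩
        change sign x = χ at hx
        subst hx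
        rfl }
  have := Fintype.ofFinite (dualCode C)
  rw [Nat.card_congr ((quotientEquiv C).trans e), Nat.card_sigma, finsum_eq_sum_of_fintype]

/-- The representations are counted one sign vector at a time, so the permutation `σ` is allowed to
vary with `χ`; no single permutation has to match the codes. -/
theorem card_quotient_congr {C D : Subgroup (Fin n → ℤˣ)} (e : dualCode C ≃ dualCode D)
    (he : ∀ χ, ∃ σ : Equiv.Perm (Fin n), (e χ : Fin n → ℤˣ) = χ ∘ σ) :
    Nat.card (IrrepClass (SU2Pow n ⧸ codeSubgroup C) d) =
      Nat.card (IrrepClass (SU2Pow n ⧸ codeSubgroup D) d) := by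
  rw [card_quotient_eq_sum, card_quotient_eq_sum]
  refine finsum_eq_of_bijective e e.bijective fun χ => ?_
  obtain ⟨σ, hσ⟩ := he χ
  rw [hσ, card_sign_comp]

end IrrepClass

/-! ### Weight-preserving bijections of the codes and their duals -/

/-- Sign vectors of the same weight differ by a permutation of the coordinates. -/
theorem exists_perm_of_card_eq {n : ℕ} {u v : Fin n → ℤˣ}
    (h : Fintype.card {i // v i = 1} = Fintype.card {i // u i = 1}) :
    ∃ σ : Equiv.Perm (Fin n), v = u ∘ σ := by
  let e := Fintype.equivOfCardEq h
  refine ⟨e.extendSubtype, funext fun i => ?_⟩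
  rw [Function.comp_apply]
  by_cases hi : v i = 1
  · rw [hi, e.extendSubtype_mem i hi]
  · have h1 := e.extendSubtype_not_mem i hi
    rw [(Int.units_eq_one_or _).resolve_left hi, (Int.units_eq_one_or _).resolve_left h1]

/-- The words of `pairCode`. -/
def pairWord (t : ℤˣ × ℤˣ × ℤˣ) : Fin 6 → ℤˣ := ![t.1, t.1, t.2.1, t.2.1, t.2.2, t.2.2]

/-- The majority of three signs. -/
def majority (t : ℤˣ × ℤˣ × ℤˣ) : ℤˣ := if t.1 = t.2.1 then t.1 else t.2.2

/-- The words of `evenCode`, parametrized in such a way that the weights agree with the weights of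
the words `pairWord`. -/
def evenWord (t : ℤˣ × ℤˣ × ℤˣ) : Fin 6 → ℤˣ :=
  -- The first three entries multiply to `majority t`, as `evenCode` requires. If `t` has 0, 1, 2 or
  -- 3 entries `-1`, the word has 0, 2, 4 or 6 of them, like `pairWord t`.
  ![t.2.1 * t.2.2 * majority t, t.1 * t.2.2 * majority t, t.1 * t.2.1 * majority t, majority t,
    majority t, majority t]

theorem bijective_pairWord :
    Function.Bijective fun t => (⟨pairWord t, by revert t; decide⟩ : pairCode) := by
  constructor
  · intro s t h
    have h := congrArg Subtype.val h
    revert s t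
    decide
  · rintro ⟨u, h1, h2, h3⟩
    refine ⟨⟨u 0, u 2, u 4⟩, Subtype.ext (funext fun i => ?_)⟩
    fin_cases i
    exacts [rfl, h1, rfl, h2, rfl, h3]

theorem bijective_evenWord :
    Function.Bijective fun t => (⟨evenWord t, by revert t; decide⟩ : evenCode) := by
  constructor
  · intro s t h
    have h := congrArg Subtype.val h
    revert s t
    decide
  · rintro ⟨u, h1, h2, h3⟩
    have key : ∀ a b c : ℤˣ, ∃ t, evenWord t = ![a, b, c, a * b * c, a * b * c, a * b * c] := by
      decide
    obtain ⟨t, ht⟩ := key (u 0) (u 1) (u 2)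
    refine ⟨t, Subtype.ext (ht.trans (funext fun i => ?_))⟩
    fin_cases i
    exacts [rfl, rfl, rfl, h1, h1.trans h2, (h1.trans h2).trans h3]

/-- The weight preserving bijection of the two codes. -/
noncomputable def codeEquiv : pairCode ≃ evenCode :=
  (Equiv.ofBijective _ bijective_pairWord).symm.trans (Equiv.ofBijective _ bijective_evenWord)

theorem exists_codeEquiv_eq_comp (u : pairCode) :
    ∃ σ : Equiv.Perm (Fin 6), (codeEquiv u : Fin 6 → ℤˣ) = u ∘ σ := by
  obtain ⟨t, rfl⟩ := (Equiv.ofBijective _ bijective_pairWord).surjective u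
  rw [codeEquiv, Equiv.trans_apply, Equiv.symm_apply_apply]
  apply exists_perm_of_card_eq
  change Fintype.card {i // evenWord t i = 1} = Fintype.card {i // pairWord t i = 1}
  revert t
  decide

/-- The repetition code of length two is self-dual, and `pairCode` is a sum of three copies. -/
theorem dualCode_pairCode : IrrepClass.dualCode pairCode = pairCode := by
  ext χ
  have : ∀ χ : Fin 6 → ℤˣ, (∀ u, u ∈ pairCode → codePairing χ u = 1) ↔ χ ∈ pairCode := by
    decide +kernel
  exact this χ

/-- `evenCode` is generated by the words with `-1` at one of the first three coordinates and at all
of the last three. Orthogonality to them says that `χ 0`, `χ 1`, `χ 2` all equal `χ 3 * χ 4 * χ 5`,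
which is the defining relation read backwards. -/
theorem dualCode_evenCode : IrrepClass.dualCode evenCode = {χ | χ ∘ Fin.rev ∈ evenCode} := by
  ext χ
  have : ∀ χ : Fin 6 → ℤˣ, (∀ u, u ∈ evenCode → codePairing χ u = 1) ↔ χ ∘ Fin.rev ∈ evenCode := by
    decide +kernel
  exact this χ

/-- The weight preserving bijection of the dual codes. -/
noncomputable def dualCodeEquiv :
    IrrepClass.dualCode pairCode ≃ IrrepClass.dualCode evenCode :=
  (Equiv.setCongr dualCode_pairCode).trans <| codeEquiv.trans <|
    ((Equiv.arrowCongr Fin.revPerm (Equiv.refl ℤˣ)).subtypeEquiv fun u => by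
      change u ∈ evenCode ↔ (u ∘ Fin.rev) ∘ Fin.rev ∈ evenCode
      rw [Function.comp_assoc, Fin.rev_involutive.comp_self, Function.comp_id]).trans
    (Equiv.setCongr dualCode_evenCode.symm)

theorem exists_dualCodeEquiv_eq_comp (χ : IrrepClass.dualCode pairCode) :
    ∃ σ : Equiv.Perm (Fin 6), (dualCodeEquiv χ : Fin 6 → ℤˣ) = χ ∘ σ := by
  obtain ⟨σ, hσ⟩ := exists_codeEquiv_eq_comp (Equiv.setCongr dualCode_pairCode χ)
  refine ⟨Fin.revPerm.trans σ, ?_⟩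
  change (codeEquiv (Equiv.setCongr dualCode_pairCode χ) : Fin 6 → ℤˣ) ∘ Fin.rev = _
  rw [hσ]
  rfl

theorem card_irrepClass_quotient_eq (d : ℕ) :
    Nat.card (IrrepClass (SU2Pow 6 ⧸ codeSubgroup pairCode) d) =
      Nat.card (IrrepClass (SU2Pow 6 ⧸ codeSubgroup evenCode) d) :=
  IrrepClass.card_quotient_congr dualCodeEquiv exists_dualCodeEquiv_eq_comp

/-- The code subgroups correspond elementwise under permutations of the coordinates. -/
theorem exists_equiv_codeSubgroup : ∃ e : codeSubgroup pairCode ≃ codeSubgroup evenCode,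
    ∀ z : codeSubgroup pairCode, ∃ σ : Equiv.Perm (Fin 6),
      ∀ i : Fin 6, (e z : SU2Pow 6) i = (z : SU2Pow 6) (σ i) := by
  let f (C : Subgroup (Fin 6 → ℤˣ)) : C ≃ codeSubgroup C :=
    (C.equivMapOfInjective (signPow 6) signPow_injective).toEquiv
  refine ⟨(f pairCode).symm.trans (codeEquiv.trans (f evenCode)), fun z => ?_⟩
  obtain ⟨u, rfl⟩ := (f pairCode).surjective z
  obtain ⟨σ, hσ⟩ := exists_codeEquiv_eq_comp u
  refine ⟨σ, fun i => ?_⟩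
  rw [Equiv.trans_apply, Equiv.trans_apply, Equiv.symm_apply_apply]
  exact congrArg signSU2 (congrFun hσ i)

/-! ### Convergence and equality of the zeta-functions -/

theorem summable_wittenTerm {G : Type*} [Group G] [TopologicalSpace G] {n : ℕ}
    (hfin : ∀ d, Finite (IrrepClass G d)) (hcard : ∀ d, Nat.card (IrrepClass G d) ≤ d ^ n) {s : ℂ}
    (hs : (n : ℝ) + 1 < s.re) : Summable (wittenTerm G s) := by
  refine Summable.of_norm ?_
  have hs0 : 0 < s.re := lt_trans (by positivity) hs
  rw [summable_sigma_of_nonneg fun _ => norm_nonneg _]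
  refine ⟨fun d => Summable.of_finite, ?_⟩
  -- At most `d ^ n` classes of degree `d` contribute at most `d ^ (n - Re s)` in norm, which is
  -- summable for `Re s > n + 1`.
  have hp : Summable fun d : ℕ => (d : ℝ) ^ ((n : ℝ) - s.re) :=
    Real.summable_nat_rpow.2 (by linarith)
  refine Summable.of_nonneg_of_le (fun d => tsum_nonneg fun _ => norm_nonneg _) (fun d => ?_) hp
  have h1 : ∑' V : IrrepClass G d, ‖wittenTerm G s ⟨d, V⟩‖ =
      Nat.card (IrrepClass G d) * ‖(d : ℂ) ^ (-s)‖ := by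
    simp only [wittenTerm, tsum_const, nsmul_eq_mul]
  rw [h1]
  -- In degree zero the term vanishes because `0 ^ (-s) = 0` for `s ≠ 0`, whatever the count.
  rcases Nat.eq_zero_or_pos d with rfl | hd
  · have : -s ≠ 0 := fun h => by
      rw [neg_eq_zero] at h
      simp [h] at hs0
    rw [Nat.cast_zero, Complex.zero_cpow this, norm_zero, mul_zero]
    positivity
  · rw [Complex.norm_natCast_cpow_of_pos hd, Complex.neg_re, Real.rpow_sub (by positivity),
      Real.rpow_natCast, Real.rpow_neg (by positivity), ← div_eq_mul_inv]
    gcongr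
    exact_mod_cast hcard d

/-- A summand depends only on the degree, so any degreewise bijection of the classes matches the two
sums term by term. -/
theorem wittenZeta_congr {G H : Type*} [Group G] [TopologicalSpace G] [Group H]
    [TopologicalSpace H] (hG : ∀ d, Finite (IrrepClass G d)) (hH : ∀ d, Finite (IrrepClass H d))
    (h : ∀ d, Nat.card (IrrepClass G d) = Nat.card (IrrepClass H d)) (s : ℂ) :
    wittenZeta G s = wittenZeta H s :=
  (Equiv.sigmaCongrRight fun d => (Finite.card_eq.1 (h d)).some).tsum_eq (wittenTerm H s)

theorem theorem5p2 :
    ∃ (n : ℕ) (Z₁ Z₂ : Subgroup (SU2Pow n)) (_ : Z₁.Normal) (_ : Z₂.Normal),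
      -- two central subgroups of `SU(2) ^ n`
      Z₁ ≤ Subgroup.center (SU2Pow n) ∧ Z₂ ≤ Subgroup.center (SU2Pow n) ∧
      -- which correspond elementwise under permutations of the coordinates
      (∃ e : Z₁ ≃ Z₂, ∀ z : Z₁, ∃ σ : Equiv.Perm (Fin n),
        ∀ i : Fin n, (e z : SU2Pow n) i = (z : SU2Pow n) (σ i)) ∧
      -- but no automorphism of `SU(2) ^ n` carries one onto the other
      (∀ α : SU2Pow n ≃ₜ* SU2Pow n, Z₁.map α.toMulEquiv.toMonoidHom ≠ Z₂) ∧
      -- the quotients are non-isomorphic compact semisimple Lie groups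
      IsCompactSemisimpleLieGroup (SU2Pow n ⧸ Z₁) ∧
      IsCompactSemisimpleLieGroup (SU2Pow n ⧸ Z₂) ∧
      IsEmpty ((SU2Pow n ⧸ Z₁) ≃ₜ* (SU2Pow n ⧸ Z₂)) ∧
      -- the Witten zeta-functions have the same, finite, Dirichlet coefficients
      (∀ d : ℕ, Finite (IrrepClass (SU2Pow n ⧸ Z₁) d) ∧
        Finite (IrrepClass (SU2Pow n ⧸ Z₂) d) ∧
        Nat.card (IrrepClass (SU2Pow n ⧸ Z₁) d) = Nat.card (IrrepClass (SU2Pow n ⧸ Z₂) d)) ∧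
      -- and converge absolutely and agree as functions on a common right half-plane
      (∃ c : ℝ, ∀ s : ℂ, c < s.re →
        Summable (wittenTerm (SU2Pow n ⧸ Z₁) s) ∧
        Summable (wittenTerm (SU2Pow n ⧸ Z₂) s) ∧
        wittenZeta (SU2Pow n ⧸ Z₁) s = wittenZeta (SU2Pow n ⧸ Z₂) s) := by
  refine ⟨6, codeSubgroup pairCode, codeSubgroup evenCode, inferInstance, inferInstance,
    codeSubgroup_le_center _, codeSubgroup_le_center _, exists_equiv_codeSubgroup, fun α h => ?_,
    isCompactSemisimpleLieGroup_codeQuotient _, isCompactSemisimpleLieGroup_codeQuotient _,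
    ⟨fun φ => isEmpty_mulEquiv_codeSubgroup.false φ.toMulEquiv⟩,
    fun d => ⟨inferInstance, inferInstance, card_irrepClass_quotient_eq d⟩,
    (6 : ℕ) + 1, fun s hs => ⟨?_, ?_, ?_⟩⟩
  -- An automorphism carrying one subgroup onto the other descends to an isomorphism of the
  -- quotients.
  · exact isEmpty_mulEquiv_codeSubgroup.false (QuotientGroup.congr _ _ α.toMulEquiv h)
  · exact summable_wittenTerm (fun _ => inferInstance)
      (fun _ => IrrepClass.card_quotient_le _) hs
  · exact summable_wittenTerm (fun _ => inferInstance)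
      (fun _ => IrrepClass.card_quotient_le _) hs
  · exact wittenZeta_congr (fun _ => inferInstance) (fun _ => inferInstance)
      card_irrepClass_quotient_eq s
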